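/- Let $\mathbb C_+=\{\zeta\in\mathbb C:\operatorname{Im}\zeta>0\}$, with closure $\operatorname{clos}\mathbb C_+$ in $\mathbb C$. Let $H^\infty_{\rm r}(\mathbb C_+)$ be the space of functions $f$ on $\operatorname{clos}\mathbb C_+$ that are bounded and analytic in $\mathbb C_+$ and satisfy $f(x)=\lim_{t\to0^+}f(x+t\mathrm i)$ for every $x\in\mathbb R$. Let $H^\infty_{\rm r}(\mathbb C_+^2)$ be the space of functions $\Phi$ on $(\operatorname{clos}\mathbb C_+)^2$ that are bounded and analytic in $\mathbb C_+^2$ and satisfy $\lim_{t\to0^+}\Phi(z+t\mathrm i,w)=\lim_{t\to0^+}\Phi(z,w+t\mathrm i)=\Phi(z,w)$ for all $z,w\in\operatorname{clos}\mathbb C_+$. For spectral (i.e. projection-valued) Borel measures $E_1,E_2$ on $\mathbb R$ acting on a complex Hilbert space, a bounded Borel function $\Psi$ on $\mathbb R^2$ and a Hilbert–Schmidt operator $Q$, put $\iint\Psi\,dE_1\,Q\,dE_2=\left(\int\Psi\,dE\right)Q$, where $E$ is the spectral measure on the Hilbert–Schmidt class with $E(\Lambda\times\Delta)Q=E_1(\Lambda)QE_2(\Delta)$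 for all Borel sets $\Lambda,\Delta\subset\mathbb R$. A bounded Borel function $\Psi$ on $\mathbb R^2$ is a Borel Schur multiplier if, for all such $E_1,E_2$ on all complex Hilbert spaces, $\iint\Psi\,dE_1\,Q\,dE_2$ is of trace class whenever $Q$ is. Let $\mathfrak M_{\rm A}(\mathbb C_+^2)$, the class of analytic Schur multipliers, be the set of $\Phi\in H^\infty_{\rm r}(\mathbb C_+^2)$ whose restriction $\Phi|\mathbb R^2$ is a Borel Schur multiplier. Let $\|\Phi\|_{\mathfrak M_{\rm d}(\mathbb R^2)}$ be the discrete Schur multiplier norm of $\Phi|\mathbb R^2$, i.e. the norm of the transformer $\{a(s,t)\}\mapsto\{\Phi(s,t)a(s,t)\}$ on the space of matrices $\{a(s,t)\}_{s,t\in\mathbb R}$ of bounded operators on $\ell^2(\mathbb R)$, with the operator norm. Let $H^\infty_{\rm r}(\mathbb C_+)\otimes_{\rm h}H^\infty_{\rm r}(\mathbb C_+)$ be the set of functions $\Phi$ on $(\operatorname{clos}\mathbb C_+)^2$ of the form $\Phi(z,w)=\sum_{n\ge0}\varphi_n(z)\psi_n(w)$ with $\varphi_n,\psi_n\in H^\infty_{\rm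 r}(\mathbb C_+)$ such that $\sum_n|\varphi_n|^2$ and $\sum_n|\psi_n|^2$ are bounded on $\operatorname{clos}\mathbb C_+$, and let the norm of $\Phi$ in it be the infimum of $\sup_z\left(\sum_n|\varphi_n(z)|^2\right)^{1/2}\cdot\sup_w\left(\sum_n|\psi_n(w)|^2\right)^{1/2}$ over all such representations. **Theorem 3.1.** One has $$\mathfrak M_{\rm A}(\mathbb C_+^2)=H^\infty_{\rm r}(\mathbb C_+)\otimes_{\rm h}H^\infty_{\rm r}(\mathbb C_+),$$ and $\|\Phi\|_{H^\infty_{\rm r}(\mathbb C_+)\otimes_{\rm h}H^\infty_{\rm r}(\mathbb C_+)}=\|\Phi\|_{\mathfrak M_{\rm d}(\mathbb R^2)}$ for every $\Phi\in\mathfrak M_{\rm A}(\mathbb C_+^2)$. -/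

import Mathlib

open scoped ENNReal NNReal Topology InnerProductSpace
open Filter MeasureTheory

universe u

noncomputable section

/-! ### Hilbert–Schmidt operators and trace class operators -/

section Operators

variable (H : Type u) [NormedAddCommGroup H] [InnerProductSpace ℂ H] [CompleteSpace H]

/-- Index set of a fixed Hilbert basis of `H`. -/
def basisIndex : Set H := (exists_hilbertBasis ℂ H).choose

/-- A fixed Hilbert basis of `H`. The Hilbert–Schmidt class and its inner product defined from it
do not depend on this choice (Parseval). -/
def fixedBasis : HilbertBasis (basisIndex H) ℂ H := (exists_hilbertBasis ℂ H).choose_spec.choose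

/-- The bounded operators `Q` on `H` with `∑ ‖Q eᵢ‖² < ∞`, as a subspace of all bounded
operators. -/
def hilbertSchmidtSubmodule : Submodule ℂ (H →L[ℂ] H) where
  carrier := {Q | Memℓp (fun i : basisIndex H => Q (fixedBasis H i)) 2}
  add_mem' := fun ha hb => ha.add hb
  zero_mem' := zero_memℓp
  smul_mem' := fun c _ hQ => hQ.const_smul c

/-- The Hilbert–Schmidt class `S₂(H)`. It is a type of its own since it carries the
Hilbert–Schmidt norm and not the operator norm. -/
def HilbertSchmidt : Type u := hilbertSchmidtSubmodule H

namespace HilbertSchmidt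

instance : AddCommGroup (HilbertSchmidt H) :=
  inferInstanceAs (AddCommGroup (hilbertSchmidtSubmodule H))

instance : Module ℂ (HilbertSchmidt H) :=
  inferInstanceAs (Module ℂ (hilbertSchmidtSubmodule H))

/-- The bounded operator underlying a Hilbert–Schmidt operator. -/
def toCLM : HilbertSchmidt H →ₗ[ℂ] (H →L[ℂ] H) := (hilbertSchmidtSubmodule H).subtype

/-- The map `Q ↦ (Q eᵢ)ᵢ` into the Hilbert sum of copies of `H`. -/
def toLp : HilbertSchmidt H →ₗ[ℂ] lp (fun _ : basisIndex H => H) 2 where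
  toFun Q := ⟨fun i => toCLM H Q (fixedBasis H i), Q.2⟩
  map_add' _ _ := rfl
  map_smul' _ _ := rfl

theorem toLp_injective : Function.Injective (toLp H) := by
  intro Q R h
  have h1 : ∀ i, toCLM H Q (fixedBasis H i) = toCLM H R (fixedBasis H i) := fun i =>
    congrFun (congrArg Subtype.val h) i
  have h2 : toCLM H Q = toCLM H R := by
    refine ContinuousLinearMap.ext_on (s := Set.range (fixedBasis H)) ?_ ?_
    · rw [← Submodule.dense_iff_topologicalClosure_eq_top.symm.eq]
      exact (fixedBasis H).dense_span
    · rintro _ ⟨i, rfl⟩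
      exact h1 i
  exact Subtype.ext h2

/-- The Hilbert–Schmidt norm. -/
instance : NormedAddCommGroup (HilbertSchmidt H) :=
  NormedAddCommGroup.induced (HilbertSchmidt H) _ (toLp H) (toLp_injective H)

/-- The Hilbert–Schmidt inner product `∑ ⟪Q eᵢ, R eᵢ⟫`. -/
instance : InnerProductSpace ℂ (HilbertSchmidt H) := InnerProductSpace.induced (toLp H)

theorem inner_eq (Q R : HilbertSchmidt H) :
    ⟪Q, R⟫_ℂ = ∑' i, ⟪toCLM H Q (fixedBasis H i), toCLM H R (fixedBasis H i)⟫_ℂ := rfl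

end HilbertSchmidt

variable {H}

/-- The trace class `S₁(H)`: the operators `h ↦ ∑ₙ ⟪xₙ, h⟫ yₙ` with `∑ₙ ‖xₙ‖ ‖yₙ‖ < ∞`. -/
def IsTraceClass (T : H →L[ℂ] H) : Prop :=
  ∃ x y : ℕ → H, (Summable fun n => ‖x n‖ * ‖y n‖) ∧
    ∀ h, HasSum (fun n => ⟪x n, h⟫_ℂ • y n) (T h)

end Operators

/-! ### Spectral measures and double operator integrals -/

/-- A spectral measure on the measurable space `α` with values in the orthogonal projections of
`K`: normalized and countably additive in the strong operator topology. The values on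
non-measurable sets are irrelevant. -/
structure SpectralMeasure (α : Type*) [MeasurableSpace α] (K : Type*) [NormedAddCommGroup K]
    [InnerProductSpace ℂ K] where
  proj : Set α → K →L[ℂ] K
  isSymmetricProjection : ∀ A, MeasurableSet A → (proj A : K →ₗ[ℂ] K).IsSymmetricProjection
  proj_univ : proj Set.univ = 1
  hasSum_iUnion : ∀ A : ℕ → Set α, (∀ n, MeasurableSet (A n)) →
    Pairwise (Function.onFun Disjoint A) →
      ∀ x, HasSum (fun n => proj (A n) x) (proj (⋃ n, A n) x)

namespace SpectralMeasure

variable {α : Type*} [MeasurableSpace α] {K : Type*} [NormedAddCommGroup K]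
  [InnerProductSpace ℂ K]

/-- `(∫ s dE) x` for a simple function `s`. -/
def simpleIntegral (E : SpectralMeasure α K) (s : SimpleFunc α ℂ) (x : K) : K :=
  ∑ c ∈ s.range, c • E.proj (s ⁻¹' {c}) x

/-- `y = (∫ f dE) x` for a bounded measurable function `f`: it is the limit of `(∫ sₙ dE) x` for
simple functions `sₙ` that converge to `f` uniformly (which sequence is taken does not matter,
as `‖(∫ s dE) x‖ ≤ sup |s| ‖x‖`). -/
def IsIntegral (E : SpectralMeasure α K) (f : α → ℂ) (x y : K) : Prop :=
  ∃ s : ℕ → SimpleFunc α ℂ, TendstoUniformly (fun n => ⇑(s n)) f atTop ∧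
    Tendsto (fun n => E.simpleIntegral (s n) x) atTop (𝓝 y)

end SpectralMeasure

section DoubleOperatorIntegral

variable {α β : Type*} [MeasurableSpace α] [MeasurableSpace β]
  {H : Type u} [NormedAddCommGroup H] [InnerProductSpace ℂ H] [CompleteSpace H]

/-- `E` is the spectral measure on the Hilbert–Schmidt class with
`E (A × B) Q = E₁ A ∘ Q ∘ E₂ B`. -/
def IsProductSpectralMeasure (E₁ : SpectralMeasure α H) (E₂ : SpectralMeasure β H)
    (E : SpectralMeasure (α × β) (HilbertSchmidt H)) : Prop :=
  ∀ A B, MeasurableSet A → MeasurableSet B → ∀ Q : HilbertSchmidt H,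
    HilbertSchmidt.toCLM H (E.proj (A ×ˢ B) Q) =
      E₁.proj A ∘L HilbertSchmidt.toCLM H Q ∘L E₂.proj B

/-- `T = ∬ Φ dE₁ Q dE₂` for a Hilbert–Schmidt operator `Q`, that is `T = (∫ Φ dE) Q` with `E` the
product spectral measure on the Hilbert–Schmidt class. -/
def IsDoubleOperatorIntegral (E₁ : SpectralMeasure α H) (E₂ : SpectralMeasure β H)
    (Φ : α × β → ℂ) (Q T : HilbertSchmidt H) : Prop :=
  ∃ E : SpectralMeasure (α × β) (HilbertSchmidt H),
    IsProductSpectralMeasure E₁ E₂ E ∧ E.IsIntegral Φ Q T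

/-- `Φ` is a Schur multiplier of the trace class with respect to `E₁` and `E₂`. (The trace class
is contained in the Hilbert–Schmidt class.) -/
def IsSchurMultiplier (E₁ : SpectralMeasure α H) (E₂ : SpectralMeasure β H)
    (Φ : α × β → ℂ) : Prop :=
  (Measurable Φ ∧ ∃ C : ℝ, ∀ p, ‖Φ p‖ ≤ C) ∧
    ∀ Q : HilbertSchmidt H, IsTraceClass (HilbertSchmidt.toCLM H Q) →
      ∃ T : HilbertSchmidt H, IsDoubleOperatorIntegral E₁ E₂ Φ Q T ∧
        IsTraceClass (HilbertSchmidt.toCLM H T)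

end DoubleOperatorIntegral

/-- Borel Schur multipliers on `ℝ²`: Schur multipliers with respect to all Borel spectral measures
on `ℝ`, on all Hilbert spaces. -/
def borelSchurMultipliers : Set (ℝ × ℝ → ℂ) :=
  {Φ | ∀ (H : Type u) [NormedAddCommGroup H] [InnerProductSpace ℂ H] [CompleteSpace H]
    (E₁ E₂ : SpectralMeasure ℝ H), IsSchurMultiplier E₁ E₂ Φ}

/-! ### Discrete Schur multipliers -/

section Discrete

variable {S T : Type*}

open scoped Classical in
/-- The bounded operator `L : ℓ²(T) → ℓ²(S)` has the matrix `a`. -/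
def HasMatrix (L : lp (fun _ : T => ℂ) 2 →L[ℂ] lp (fun _ : S => ℂ) 2) (a : S × T → ℂ) : Prop :=
  ∀ s t, L (lp.single 2 t (1 : ℂ)) s = a (s, t)

/-- `C` bounds the transformer `A ↦ Φ ⋆ A` (entrywise product) on the matrices of bounded
operators `ℓ²(T) → ℓ²(S)`, in the operator norm. -/
def IsSchurBound (Φ : S × T → ℂ) (C : ℝ≥0) : Prop :=
  ∀ (a : S × T → ℂ) (L : lp (fun _ : T => ℂ) 2 →L[ℂ] lp (fun _ : S => ℂ) 2), HasMatrix L a →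
    ∃ L' : lp (fun _ : T => ℂ) 2 →L[ℂ] lp (fun _ : S => ℂ) 2,
      HasMatrix L' (fun p => Φ p * a p) ∧ ‖L'‖ ≤ C * ‖L‖

/-- The norm of the transformer `A ↦ Φ ⋆ A`; it is `∞` if `Φ` is not a discrete Schur
multiplier. -/
def discreteSchurNorm (Φ : S × T → ℂ) : ℝ≥0∞ :=
  ⨅ (C : ℝ≥0) (_ : IsSchurBound Φ C), (C : ℝ≥0∞)

end Discrete

/-! ### The Haagerup tensor product of function spaces -/

section Haagerup

variable {α β : Type*}

/-- `‖(∑ₙ |φₙ|²)^{1/2}‖_∞`. -/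
def columnNorm (φ : ℕ → α → ℂ) : ℝ≥0∞ := (⨆ z, ∑' n, ‖φ n z‖ₑ ^ 2) ^ (1 / 2 : ℝ)

/-- `Φ(z, w) = ∑ₙ φₙ(z) ψₙ(w)` with `φₙ ∈ X`, `ψₙ ∈ Y`, and both `∑ₙ |φₙ|²` and `∑ₙ |ψₙ|²`
bounded. -/
structure IsHaagerupRepresentation (X : Set (α → ℂ)) (Y : Set (β → ℂ)) (Φ : α × β → ℂ)
    (φ : ℕ → α → ℂ) (ψ : ℕ → β → ℂ) : Prop where
  left_mem : ∀ n, φ n ∈ X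
  right_mem : ∀ n, ψ n ∈ Y
  left_bounded : columnNorm φ < ∞
  right_bounded : columnNorm ψ < ∞
  hasSum : ∀ z w, HasSum (fun n => φ n z * ψ n w) (Φ (z, w))

/-- The Haagerup tensor product `X ⊗ₕ Y`. -/
def haagerupTensor (X : Set (α → ℂ)) (Y : Set (β → ℂ)) : Set (α × β → ℂ) :=
  {Φ | ∃ φ ψ, IsHaagerupRepresentation X Y Φ φ ψ}

/-- The norm in `X ⊗ₕ Y`. -/
def haagerupNorm (X : Set (α → ℂ)) (Y : Set (β → ℂ)) (Φ : α × β → ℂ) : ℝ≥0∞ :=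
  ⨅ (φ : ℕ → α → ℂ) (ψ : ℕ → β → ℂ) (_ : IsHaagerupRepresentation X Y Φ φ ψ),
    columnNorm φ * columnNorm ψ

end Haagerup

/-! ### Analytic functions with radial boundary values, analytic Schur multipliers -/

/-- The closed upper half-plane. -/
abbrev ClosedHalfPlane : Type := {z : ℂ // 0 ≤ z.im}

/-- A real number as a point of the closed upper half-plane. -/
def realPoint (x : ℝ) : ClosedHalfPlane := ⟨(x : ℂ), by simp⟩

/-- The point `z + t i`, for `t ≥ 0`. -/
def ClosedHalfPlane.raise (z : ClosedHalfPlane) (t : ℝ≥0) : ClosedHalfPlane :=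
  ⟨z.1 + (t : ℝ) * Complex.I, by simpa using add_nonneg z.2 t.2⟩

/-- `H^∞_r` of the upper half-plane: bounded functions, analytic in the open half-plane, whose
value at each real point is the vertical boundary limit there. -/
def HInftyR : Set (ClosedHalfPlane → ℂ) :=
  {f | DifferentiableOn ℂ (Function.extend Subtype.val f 0) {z : ℂ | 0 < z.im} ∧
    (∃ C : ℝ, ∀ z : ClosedHalfPlane, 0 < z.1.im → ‖f z‖ ≤ C) ∧
    ∀ x : ℝ, Tendsto (fun t : ℝ≥0 => f ((realPoint x).raise t)) (𝓝[>] 0) (𝓝 (f (realPoint x)))}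

/-- `H^∞_r` of the bi-half-plane. -/
def HInftyR₂ : Set (ClosedHalfPlane × ClosedHalfPlane → ℂ) :=
  {Φ | DifferentiableOn ℂ
      (Function.extend (Prod.map Subtype.val Subtype.val : _ → ℂ × ℂ) Φ 0)
      {p : ℂ × ℂ | 0 < p.1.im ∧ 0 < p.2.im} ∧
    (∃ C : ℝ, ∀ z w : ClosedHalfPlane, 0 < z.1.im → 0 < w.1.im → ‖Φ (z, w)‖ ≤ C) ∧
    ∀ z w : ClosedHalfPlane,
      Tendsto (fun t : ℝ≥0 => Φ (z.raise t, w)) (𝓝[>] 0) (𝓝 (Φ (z, w))) ∧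
      Tendsto (fun t : ℝ≥0 => Φ (z, w.raise t)) (𝓝[>] 0) (𝓝 (Φ (z, w)))}

/-- The restriction of a function on the closed bi-half-plane to `ℝ²`. -/
def boundaryFunction (Φ : ClosedHalfPlane × ClosedHalfPlane → ℂ) : ℝ × ℝ → ℂ :=
  fun p => Φ (realPoint p.1, realPoint p.2)

/-- The analytic Schur multipliers on the closed bi-half-plane. -/
def analyticSchurMultipliers : Set (ClosedHalfPlane × ClosedHalfPlane → ℂ) :=
  {Φ | Φ ∈ HInftyR₂ ∧ boundaryFunction Φ ∈ borelSchurMultipliers.{u}}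

end

/-! A sum `Φ(z, w) = ∑ φₙ(z) ψₙ(w)` with `∑ |φₙ|² ≤ A` and `∑ |ψₙ|² ≤ B` acts on operators by `Q ↦ ∑
Fₙ Q Gₙ`, where `Fₙ = ∫ φₙ dE₁` and `Gₙ = ∫ ψₙ dE₂`. The spectral theorem turns the pointwise bounds
into `∑ ‖Fₙ y‖² ≤ A ‖y‖²` and `∑ ‖Gₙ* x‖² ≤ B ‖x‖²`, and Cauchy–Schwarz then keeps rank-one
operators, hence the trace class, inside the trace class (`isSchurMultiplier_of_hasSum`). The same
computation on `ℓ²` gives the discrete norm bound `√A √B` (`isSchurBound_of_hasSum`). The double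
operator integral presupposes the product spectral measure on the Hilbert–Schmidt class; it exists
because on a rank-one operator its quadratic form is a product of two scalar measures
(`exists_isProductSpectralMeasure`).

Conversely, a Borel Schur multiplier has a uniform bound on finite submatrices: otherwise bad blocks
could be assembled into one trace class operator with a transform outside the trace class
(`exists_finiteSchurBound`). Hahn–Banach separation from the cone of positive definite kernels,
followed by compactness, converts such a bound `C` into Grothendieck's factorization `Φ(s, t) = ⟪u
s, v t⟫` on `ℝ²` with `‖u s‖², ‖v t‖² ≤ C` (`FiniteSchurBound.exists_inner`). The vectors can be cut
down so that both families are total.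

Analyticity enters last. For real `t` the function `Φ(·, t)` is in `H^∞_r`, and on the boundary `∑
cₜ Φ(x, t)` is bounded by `√C ‖∑ cₜ v t‖`. The maximum principle carries this estimate to all `z`,
so `Φ(z, t) = l_z(v t)` with functionals `l_z` of norm at most `√C` depending analytically on `z`
(`HInftyR.exists_dual`). The functionals `l_z` are total in the dual, so the same argument in `w`
gives `Φ(z, w) = m_w(l_z)` with `m_w` in the bidual. Expansion in an orthonormal basis is the
required series. The constant `C` survives every step, which gives the equality of norms. -/

noncomputable section

/-! ### Orthogonal projections -/

namespace SymProj

variable {K : Type*} [NormedAddCommGroup K] [InnerProductSpace ℂ K] {T S : K →L[ℂ] K}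

theorem apply_apply (hT : (T : K →ₗ[ℂ] K).IsSymmetricProjection) (x : K) : T (T x) = T x :=
  LinearMap.congr_fun hT.isIdempotentElem.eq x

theorem inner_comm (hT : (T : K →ₗ[ℂ] K).IsSymmetricProjection) (x y : K) :
    ⟪T x, y⟫_ℂ = ⟪x, T y⟫_ℂ := hT.isSymmetric x y

theorem inner_self (hT : (T : K →ₗ[ℂ] K).IsSymmetricProjection) (x : K) :
    ⟪x, T x⟫_ℂ = ((‖T x‖ ^ 2 : ℝ) : ℂ) := by
  have h := inner_comm hT x (T x)
  rw [apply_apply hT, inner_self_eq_norm_sq_to_K] at h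
  rw [← h]
  push_cast
  rfl

theorem norm_sub_sq (hT : (T : K →ₗ[ℂ] K).IsSymmetricProjection) (x : K) :
    ‖x - T x‖ ^ 2 = ‖x‖ ^ 2 - ‖T x‖ ^ 2 := by
  rw [_root_.norm_sub_sq (𝕜 := ℂ), inner_self hT]
  simp only [RCLike.re_to_complex, Complex.ofReal_re]
  ring

theorem norm_le (hT : (T : K →ₗ[ℂ] K).IsSymmetricProjection) (x : K) : ‖T x‖ ≤ ‖x‖ := by
  have := norm_sub_sq hT x
  nlinarith [sq_nonneg ‖x - T x‖, norm_nonneg x, norm_nonneg (T x)]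

theorem one_sub (hT : (T : K →ₗ[ℂ] K).IsSymmetricProjection) :
    ((1 - T : K →L[ℂ] K) : K →ₗ[ℂ] K).IsSymmetricProjection := by
  refine ⟨?_, ?_⟩
  · ext x
    simp [apply_apply hT]
  · intro x y
    simp [inner_sub_left, inner_sub_right, inner_comm hT]

/-- A projection is determined by its quadratic form. -/
theorem ext_norm (hT : (T : K →ₗ[ℂ] K).IsSymmetricProjection)
    (hS : (S : K →ₗ[ℂ] K).IsSymmetricProjection) (h : ∀ x, ‖T x‖ ^ 2 = ‖S x‖ ^ 2) : T = S := by
  have : (T : K →ₗ[ℂ] K) = S := by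
    rw [← ext_inner_map]
    intro x
    have h1 := inner_comm hT x x
    have h2 := inner_comm hS x x
    have h3 := inner_self hT x
    have h4 := inner_self hS x
    rw [ContinuousLinearMap.coe_coe, ContinuousLinearMap.coe_coe, h1, h2, h3, h4, h x]
  exact ContinuousLinearMap.coe_injective this

/-- Two projections with `‖T x‖² + ‖S x‖² ≤ ‖x‖²` are orthogonal. -/
theorem comp_eq_zero (hS : (S : K →ₗ[ℂ] K).IsSymmetricProjection)
    (h : ∀ x, ‖T x‖ ^ 2 + ‖S x‖ ^ 2 ≤ ‖x‖ ^ 2) (x : K) : T (S x) = 0 := by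
  have := h (S x)
  rw [apply_apply hS] at this
  have h0 : ‖T (S x)‖ ^ 2 ≤ 0 := by linarith
  have := sq_nonneg ‖T (S x)‖
  exact norm_eq_zero.1 (pow_eq_zero_iff (two_ne_zero) |>.1 (le_antisymm h0 this))

section Family

variable {ι : Type*} {P : ι → K →L[ℂ] K}

theorem sum (hP : ∀ i, (P i : K →ₗ[ℂ] K).IsSymmetricProjection)
    (h : ∀ i j, i ≠ j → ∀ x, P i (P j x) = 0) (I : Finset ι) :
    ((∑ i ∈ I, P i : K →L[ℂ] K) : K →ₗ[ℂ] K).IsSymmetricProjection := by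
  classical
  refine ⟨?_, ?_⟩
  · ext x
    simp only [ContinuousLinearMap.toLinearMap_sum, Module.End.mul_apply, LinearMap.sum_apply,
      ContinuousLinearMap.coe_coe, map_sum]
    refine Finset.sum_congr rfl fun i hi => ?_
    rw [Finset.sum_eq_single i]
    · exact apply_apply (hP i) x
    · exact fun j _ hj => h j i hj x
    · exact fun h' => absurd hi h'
  · intro x y
    simp only [ContinuousLinearMap.toLinearMap_sum, LinearMap.sum_apply, ContinuousLinearMap.coe_coe,
      sum_inner, inner_sum, inner_comm (hP _)]

theorem norm_sum_sq (hP : ∀ i, (P i : K →ₗ[ℂ] K).IsSymmetricProjection)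
    (h : ∀ i j, i ≠ j → ∀ x, P i (P j x) = 0) (I : Finset ι) (x : K) :
    ‖∑ i ∈ I, P i x‖ ^ 2 = ∑ i ∈ I, ‖P i x‖ ^ 2 := by
  have h1 := inner_self (sum hP h I) x
  simp only [_root_.sum_apply, inner_sum, inner_self (hP _)] at h1
  exact_mod_cast h1.symm

theorem sum_norm_sq_le (hP : ∀ i, (P i : K →ₗ[ℂ] K).IsSymmetricProjection)
    (h : ∀ i j, i ≠ j → ∀ x, P i (P j x) = 0) (I : Finset ι) (x : K) :
    ∑ i ∈ I, ‖P i x‖ ^ 2 ≤ ‖x‖ ^ 2 := by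
  rw [← norm_sum_sq hP h]
  have := norm_le (sum hP h I) x
  simp only [_root_.sum_apply] at this
  gcongr

theorem summable_norm_sq (hP : ∀ i, (P i : K →ₗ[ℂ] K).IsSymmetricProjection)
    (h : ∀ i j, i ≠ j → ∀ x, P i (P j x) = 0) (x : K) : Summable fun i => ‖P i x‖ ^ 2 :=
  summable_of_sum_le (fun _ => sq_nonneg _) fun I => sum_norm_sq_le hP h I x

theorem summable [CompleteSpace K] (hP : ∀ i, (P i : K →ₗ[ℂ] K).IsSymmetricProjection)
    (h : ∀ i j, i ≠ j → ∀ x, P i (P j x) = 0) (x : K) : Summable fun i => P i x := by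
  rw [summable_iff_vanishing_norm]
  intro ε hε
  obtain ⟨s, hs⟩ := (summable_iff_vanishing_norm.1 (summable_norm_sq hP h x)) (ε ^ 2) (by positivity)
  refine ⟨s, fun t ht => ?_⟩
  have h1 := hs t ht
  rw [← norm_sum_sq hP h, Real.norm_of_nonneg (sq_nonneg _)] at h1
  exact lt_of_pow_lt_pow_left₀ 2 hε.le h1

/-- The strong sum of pairwise orthogonal projections is a projection. -/
theorem exists_hasSum [CompleteSpace K] (hP : ∀ i, (P i : K →ₗ[ℂ] K).IsSymmetricProjection)
    (h : ∀ i j, i ≠ j → ∀ x, P i (P j x) = 0) :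
    ∃ S : K →L[ℂ] K, (S : K →ₗ[ℂ] K).IsSymmetricProjection ∧
      (∀ x, HasSum (fun i => P i x) (S x)) ∧ ∀ x, HasSum (fun i => ‖P i x‖ ^ 2) (‖S x‖ ^ 2) := by
  classical
  have hs := summable hP h
  let S₀ : K →ₗ[ℂ] K :=
    { toFun := fun x => ∑' i, P i x
      map_add' := fun x y => by
        simp only [map_add]
        exact (hs x).tsum_add (hs y)
      map_smul' := fun c x => by
        simp only [map_smul, RingHom.id_apply]
        exact (hs x).tsum_const_smul c }
  have hsum : ∀ x, HasSum (fun i => P i x) (S₀ x) := fun x => (hs x).hasSum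
  have hb : ∀ x, ‖S₀ x‖ ≤ 1 * ‖x‖ := fun x => by
    rw [one_mul]
    refine le_of_tendsto (hsum x).norm (Eventually.of_forall fun I => ?_)
    have := norm_le (sum hP h I) x
    simpa only [_root_.sum_apply] using this
  let S := S₀.mkContinuous 1 hb
  have hS : ∀ x, HasSum (fun i => P i x) (S x) := hsum
  have hPS : ∀ i x, P i (S x) = P i x := fun i x => by
    have h1 := (P i).hasSum (hS x)
    refine h1.unique ?_
    have : (fun j => P i (P j x)) = fun j => if j = i then P i x else 0 := by
      funext j
      split_ifs with hj
      · rw [hj, apply_apply (hP i)]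
      · exact h i j (Ne.symm hj) x
    rw [this]
    exact hasSum_ite_eq i _
  have hSp : (S : K →ₗ[ℂ] K).IsSymmetricProjection := by
    refine ⟨?_, ?_⟩
    · ext x
      refine (hS (S x)).unique ?_
      simp only [hPS]
      exact hS x
    · intro x y
      have h1 := (hS x).mapL ((innerSL ℂ).flip y)
      have h2 := (hS y).mapL (innerSL ℂ x)
      simp only [ContinuousLinearMap.flip_apply, innerSL_apply_apply] at h1 h2
      simp only [inner_comm (hP _)] at h1
      exact h1.unique h2
  refine ⟨S, hSp, hS, fun x => ?_⟩
  have h2 := (hS x).mapL (innerSL ℂ x)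
  simp only [innerSL_apply_apply, inner_self (hP _), inner_self hSp] at h2
  exact_mod_cast h2

end Family

end SymProj

/-! ### Spectral measures: multiplicativity and scalar measures -/

namespace SpectralMeasure

variable {α : Type*} [MeasurableSpace α] {K : Type*} [NormedAddCommGroup K]
  [InnerProductSpace ℂ K] (E : SpectralMeasure α K)

theorem proj_empty : E.proj ∅ = 0 := by
  ext x
  -- The constant sequence `∅` is pairwise disjoint, and a summable constant sequence must be zero.
  have h := E.hasSum_iUnion (fun _ => ∅) (fun _ => MeasurableSet.empty)
    (fun _ _ _ => disjoint_bot_left) x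
  have := h.summable.tendsto_cofinite_zero
  simpa using tendsto_nhds_unique (tendsto_const_nhds) this

theorem proj_union {A B : Set α} (hA : MeasurableSet A) (hB : MeasurableSet B)
    (h : Disjoint A B) (x : K) : E.proj (A ∪ B) x = E.proj A x + E.proj B x := by
  let f : ℕ → Set α := fun n => if n = 0 then A else if n = 1 then B else ∅
  have hU : ⋃ n, f n = A ∪ B := by
    ext z
    simp only [Set.mem_iUnion, Set.mem_union, f]
    constructor
    · rintro ⟨n, hn⟩
      split_ifs at hn <;> simp_all
    · rintro (h | h)
      exacts [⟨0, by simpa⟩, ⟨1, by simpa⟩]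
  have h1 := E.hasSum_iUnion f (fun n => by simp only [f]; split_ifs <;> simp_all) (by
    intro i j hij
    simp only [f, Function.onFun]
    split_ifs <;> simp_all [disjoint_comm]) x
  rw [hU] at h1
  refine h1.unique ?_
  have h2 : HasSum (fun n => E.proj (f n) x) (∑ n ∈ Finset.range 2, E.proj (f n) x) := by
    apply hasSum_sum_of_ne_finset_zero
    intro n hn
    have : f n = ∅ := by
      simp only [Finset.mem_range, not_lt] at hn
      simp only [f]
      rw [if_neg (by omega), if_neg (by omega)]
    simp [this, proj_empty]
  simpa [Finset.sum_range_succ, f] using h2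

/-- Multiplicativity is not among the axioms of a spectral measure. Additivity gives `‖E(A) y‖² +
‖E(B) y‖² = ‖E(A ∪ B) y‖² ≤ ‖y‖²`, and two projections with this property have orthogonal ranges. -/
theorem proj_apply_of_disjoint {A B : Set α} (hA : MeasurableSet A) (hB : MeasurableSet B)
    (h : Disjoint A B) (x : K) : E.proj A (E.proj B x) = 0 := by
  have hS := E.isSymmetricProjection _ (hA.union hB)
  refine SymProj.comp_eq_zero (E.isSymmetricProjection B hB) (fun y => ?_) x
  have h1 := SymProj.inner_self hS y
  rw [E.proj_union hA hB h, inner_add_right, SymProj.inner_self (E.isSymmetricProjection B hB),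
    SymProj.inner_self (E.isSymmetricProjection A hA), ← E.proj_union hA hB h] at h1
  have h2 : ‖E.proj A y‖ ^ 2 + ‖E.proj B y‖ ^ 2 = ‖E.proj (A ∪ B) y‖ ^ 2 := by exact_mod_cast h1
  rw [h2]
  have := SymProj.norm_le hS y
  gcongr

theorem proj_apply_of_subset {A B : Set α} (hA : MeasurableSet A) (hB : MeasurableSet B)
    (h : A ⊆ B) (x : K) : E.proj A (E.proj B x) = E.proj A x := by
  have h1 := E.proj_union hA (hB.diff hA) Set.disjoint_sdiff_right x
  rw [Set.union_sdiff_cancel h] at h1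
  rw [h1, map_add, E.proj_apply_of_disjoint hA (hB.diff hA) Set.disjoint_sdiff_right,
    SymProj.apply_apply (E.isSymmetricProjection A hA), add_zero]

theorem proj_inter {A B : Set α} (hA : MeasurableSet A) (hB : MeasurableSet B) (x : K) :
    E.proj A (E.proj B x) = E.proj (A ∩ B) x := by
  have h1 := E.proj_union (hA.inter hB) (hA.diff hB)
    (Set.disjoint_sdiff_right.mono_left Set.inter_subset_right) (E.proj B x)
  rw [Set.inter_union_sdiff] at h1
  rw [h1, E.proj_apply_of_disjoint (hA.diff hB) hB Set.disjoint_sdiff_left, add_zero,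
    E.proj_apply_of_subset (hA.inter hB) hB Set.inter_subset_right]

/-- The scalar measure `A ↦ ‖E(A) x‖²`. -/
def scalarMeasure (x : K) : Measure α :=
  Measure.ofMeasurable (fun A _ => ENNReal.ofReal (‖E.proj A x‖ ^ 2)) (by simp [proj_empty])
    (fun A hA hd => by
      have h := (E.hasSum_iUnion A hA hd x).mapL (innerSL ℂ x)
      simp only [innerSL_apply_apply, SymProj.inner_self (E.isSymmetricProjection _ (hA _)),
        SymProj.inner_self (E.isSymmetricProjection _ (MeasurableSet.iUnion hA))] at h
      have h' : HasSum (fun n => ‖E.proj (A n) x‖ ^ 2) (‖E.proj (⋃ n, A n) x‖ ^ 2) := by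
        exact_mod_cast h
      rw [← h'.tsum_eq, ENNReal.ofReal_tsum_of_nonneg (fun _ => sq_nonneg _) h'.summable])

theorem scalarMeasure_apply (x : K) {A : Set α} (hA : MeasurableSet A) :
    E.scalarMeasure x A = ENNReal.ofReal (‖E.proj A x‖ ^ 2) :=
  Measure.ofMeasurable_apply A hA

theorem scalarMeasure_univ (x : K) : E.scalarMeasure x Set.univ = ENNReal.ofReal (‖x‖ ^ 2) := by
  rw [E.scalarMeasure_apply x MeasurableSet.univ, E.proj_univ]
  rfl

instance (x : K) : IsFiniteMeasure (E.scalarMeasure x) :=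
  ⟨by rw [E.scalarMeasure_univ]; exact ENNReal.ofReal_lt_top⟩

theorem scalarMeasure_real (x : K) {A : Set α} (hA : MeasurableSet A) :
    (E.scalarMeasure x).real A = ‖E.proj A x‖ ^ 2 := by
  rw [measureReal_def, E.scalarMeasure_apply x hA, ENNReal.toReal_ofReal (sq_nonneg _)]

/-! ### Integrals of simple functions -/

/-- The set function `A ↦ (c ↦ c • E(A) x)`. -/
def vectorFun (x : K) (A : Set α) : ℂ →L[ℝ] K :=
  (ContinuousLinearMap.toSpanSingleton ℂ (E.proj A x)).restrictScalars ℝ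

theorem simpleIntegral_eq (s : SimpleFunc α ℂ) (x : K) :
    E.simpleIntegral s x = SimpleFunc.setToSimpleFunc (E.vectorFun x) s := rfl

/-- The reference measure `0` makes every set finite and every simple function integrable, so the
general calculus of `setToSimpleFunc` applies without side conditions. -/
theorem vectorFun_additive (x : K) : FinMeasAdditive (0 : Measure α) (E.vectorFun x) := by
  intro A B hA hB _ _ h
  ext
  simp [vectorFun, E.proj_union hA hB h]

theorem simpleIntegral_add (s t : SimpleFunc α ℂ) (x : K) :
    E.simpleIntegral (s + t) x = E.simpleIntegral s x + E.simpleIntegral t x := by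
  simp only [simpleIntegral_eq]
  exact SimpleFunc.setToSimpleFunc_add _ (E.vectorFun_additive x) (integrable_zero_measure)
    (integrable_zero_measure)

theorem simpleIntegral_sub (s t : SimpleFunc α ℂ) (x : K) :
    E.simpleIntegral (s - t) x = E.simpleIntegral s x - E.simpleIntegral t x := by
  simp only [simpleIntegral_eq]
  exact SimpleFunc.setToSimpleFunc_sub _ (E.vectorFun_additive x) (integrable_zero_measure)
    (integrable_zero_measure)

theorem simpleIntegral_add_right (s : SimpleFunc α ℂ) (x y : K) :
    E.simpleIntegral s (x + y) = E.simpleIntegral s x + E.simpleIntegral s y := by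
  simp [simpleIntegral, Finset.sum_add_distrib]

theorem simpleIntegral_smul_right (s : SimpleFunc α ℂ) (c : ℂ) (x : K) :
    E.simpleIntegral s (c • x) = c • E.simpleIntegral s x := by
  simp [simpleIntegral, Finset.smul_sum, smul_comm c]

/-- The fibres of `s` are disjoint, so the summands are orthogonal. This isometry into `L²` of the
scalar measure is the source of all later estimates and limits. -/
theorem norm_simpleIntegral_sq (s : SimpleFunc α ℂ) (x : K) :
    ‖E.simpleIntegral s x‖ ^ 2 = ∫ a, ‖s a‖ ^ 2 ∂E.scalarMeasure x := by
  have h1 : (fun a => ‖s a‖ ^ 2) = ⇑(s.map fun c => ‖c‖ ^ 2) := rfl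
  rw [h1, ← SimpleFunc.integral_eq_integral _ (SimpleFunc.integrable_of_isFiniteMeasure _),
    SimpleFunc.map_integral _ _ (SimpleFunc.integrable_of_isFiniteMeasure _) (by simp)]
  have hm : ∀ c, MeasurableSet (s ⁻¹' {c}) := fun c => s.measurableSet_fiber c
  have h2 : ‖E.simpleIntegral s x‖ ^ 2 =
      ∑ c ∈ s.range, ‖c • E.proj (s ⁻¹' {c}) x‖ ^ 2 := by
    have key : ∀ c d, c ≠ d →
        ⟪E.proj (s ⁻¹' {c}) x, E.proj (s ⁻¹' {d}) x⟫_ℂ = 0 := fun c d hcd => by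
      rw [SymProj.inner_comm (E.isSymmetricProjection _ (hm c)),
        E.proj_apply_of_disjoint (hm c) (hm d), inner_zero_right]
      exact Disjoint.preimage _ (by simpa using hcd)
    have : ⟪E.simpleIntegral s x, E.simpleIntegral s x⟫_ℂ =
        ((∑ c ∈ s.range, ‖c • E.proj (s ⁻¹' {c}) x‖ ^ 2 : ℝ) : ℂ) := by
      rw [simpleIntegral, sum_inner]
      push_cast
      refine Finset.sum_congr rfl fun c hc => ?_
      rw [inner_sum, Finset.sum_eq_single c]
      · rw [inner_self_eq_norm_sq_to_K]; rfl
      · intro d _ hd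
        rw [inner_smul_left, inner_smul_right, key c d hd.symm]; simp
      · exact fun h => absurd hc h
    rw [inner_self_eq_norm_sq_to_K] at this
    apply Complex.ofReal_injective
    rw [← this]
    push_cast
    rfl
  rw [h2]
  refine Finset.sum_congr rfl fun c _ => ?_
  rw [norm_smul, mul_pow, E.scalarMeasure_real x (hm c), smul_eq_mul, mul_comm]

theorem proj_simpleIntegral_singleton (s : SimpleFunc α ℂ) (x : K) {p : α}
    (hp : MeasurableSet {p}) :
    E.proj {p} (E.simpleIntegral s x) = s p • E.proj {p} x := by
  classical
  simp only [simpleIntegral, map_sum, map_smul]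
  rw [Finset.sum_eq_single (s p)]
  · rw [E.proj_apply_of_subset hp (s.measurableSet_fiber _) (by simp)]
  · intro c _ hc
    rw [E.proj_apply_of_disjoint hp (s.measurableSet_fiber _), smul_zero]
    simpa using Ne.symm hc
  · intro h
    exact absurd (SimpleFunc.mem_range_self s p) h

end SpectralMeasure

/-- A bounded measurable function is a uniform limit of simple functions. -/
theorem exists_simpleFunc_tendstoUniformly {α : Type*} [MeasurableSpace α] {f : α → ℂ}
    (hf : Measurable f) {C : ℝ} (hC : ∀ a, ‖f a‖ ≤ C) :
    ∃ s : ℕ → SimpleFunc α ℂ, TendstoUniformly (fun n => ⇑(s n)) f atTop := by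
  have key : ∀ ε > 0, ∃ s : SimpleFunc α ℂ, ∀ a, dist (f a) (s a) < ε := by
    intro ε hε
    let e := TopologicalSpace.denseSeq ℂ
    obtain ⟨t, ht⟩ := (isCompact_closedBall (0 : ℂ) C).elim_finite_subcover
      (fun k : ℕ => Metric.ball (e k) ε) (fun _ => Metric.isOpen_ball) (by
        intro z _
        obtain ⟨k, hk⟩ := (TopologicalSpace.denseRange_denseSeq ℂ).exists_dist_lt z hε
        exact Set.mem_iUnion.2 ⟨k, hk⟩)
    obtain ⟨N, hN⟩ := t.bddAbove
    refine ⟨(SimpleFunc.nearestPt e N).comp f hf, fun a => ?_⟩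
    have ha := ht (show f a ∈ Metric.closedBall (0 : ℂ) C by simpa using hC a)
    simp only [Set.mem_iUnion] at ha
    obtain ⟨k, hk, hak⟩ := ha
    have h1 := SimpleFunc.edist_nearestPt_le e (f a) (hN hk)
    rw [edist_dist, edist_dist, ENNReal.ofReal_le_ofReal_iff dist_nonneg] at h1
    rw [SimpleFunc.coe_comp, Function.comp_apply, dist_comm]
    refine h1.trans_lt ?_
    rw [dist_comm]
    exact hak
  choose s hs using fun n : ℕ => key (1 / ((n : ℝ) + 1)) Nat.one_div_pos_of_nat
  refine ⟨s, Metric.tendstoUniformly_iff.2 fun ε hε => ?_⟩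
  obtain ⟨N, hN⟩ := exists_nat_one_div_lt hε
  filter_upwards [eventually_ge_atTop N] with n hn a
  exact (hs n a).trans ((Nat.one_div_le_one_div hn).trans_lt hN)

/-! ### Integrals of bounded functions -/

namespace SpectralMeasure

variable {α : Type*} [MeasurableSpace α] {K : Type*} [NormedAddCommGroup K]
  [InnerProductSpace ℂ K] {E : SpectralMeasure α K}

theorem norm_simpleIntegral_le {s : SimpleFunc α ℂ} {C : ℝ} (hC : 0 ≤ C) (h : ∀ a, ‖s a‖ ≤ C)
    (x : K) : ‖E.simpleIntegral s x‖ ≤ C * ‖x‖ := by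
  refine le_of_sq_le_sq ?_ (by positivity)
  rw [E.norm_simpleIntegral_sq]
  calc ∫ a, ‖s a‖ ^ 2 ∂E.scalarMeasure x ≤ ∫ _, C ^ 2 ∂E.scalarMeasure x := by
        refine integral_mono_of_nonneg (Eventually.of_forall fun _ => sq_nonneg _)
          (integrable_const _) (Eventually.of_forall fun a => ?_)
        have := h a
        dsimp only
        gcongr
    _ = (C * ‖x‖) ^ 2 := by
        rw [integral_const, measureReal_def, E.scalarMeasure_univ,
          ENNReal.toReal_ofReal (sq_nonneg _), smul_eq_mul]
        ring

theorem isIntegral_simpleFunc (s : SimpleFunc α ℂ) (x : K) :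
    E.IsIntegral s x (E.simpleIntegral s x) :=
  ⟨fun _ => s, Metric.tendstoUniformly_iff.2 fun ε hε => by simp [hε], tendsto_const_nhds⟩

/-- The isometry for simple functions passes to the limit by dominated convergence. For `f = g` it
shows that the integral does not depend on the approximating sequence. -/
theorem IsIntegral.norm_sub_sq {f g : α → ℂ} {x y z : K} (hf : E.IsIntegral f x y)
    (hg : E.IsIntegral g x z) {C : ℝ} (hfC : ∀ a, ‖f a‖ ≤ C) (hgC : ∀ a, ‖g a‖ ≤ C) :
    ‖y - z‖ ^ 2 = ∫ a, ‖f a - g a‖ ^ 2 ∂E.scalarMeasure x := by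
  obtain ⟨s, hs, hsy⟩ := hf
  obtain ⟨t, ht, htz⟩ := hg
  have h1 : Tendsto (fun n => ‖E.simpleIntegral (s n - t n) x‖ ^ 2) atTop (𝓝 (‖y - z‖ ^ 2)) := by
    simp only [simpleIntegral_sub]
    exact ((hsy.sub htz).norm).pow 2
  refine tendsto_nhds_unique h1 ?_
  simp only [norm_simpleIntegral_sq]
  refine tendsto_integral_filter_of_dominated_convergence (fun _ => (2 * C + 2) ^ 2)
    (Eventually.of_forall fun n => ?_) ?_ (integrable_const _) (Eventually.of_forall fun a => ?_)
  · exact (((s n - t n).measurable.norm).pow_const 2).aestronglyMeasurable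
  · filter_upwards [Metric.tendstoUniformly_iff.1 hs 1 one_pos,
      Metric.tendstoUniformly_iff.1 ht 1 one_pos] with n hn hm
    refine Eventually.of_forall fun a => ?_
    rw [norm_pow, norm_norm]
    have h3 := hn a
    have h4 := hm a
    rw [dist_eq_norm] at h3 h4
    -- Eventually each simple function is within 1 of its limit, and the limits differ by at most `2
    -- * C`.
    have : ‖(s n - t n) a‖ ≤ 2 * C + 2 := by
      have e : (s n - t n) a = f a - g a - (f a - s n a) + (g a - t n a) := by
        simp only [SimpleFunc.coe_sub, Pi.sub_apply]; ring
      rw [e]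
      have := norm_add_le (f a - g a - (f a - s n a)) (g a - t n a)
      have := norm_sub_le (f a - g a) (f a - s n a)
      have := norm_sub_le (f a) (g a)
      have := hfC a
      have := hgC a
      linarith
    gcongr
  · have h3 := (hs.tendsto_at a).sub (ht.tendsto_at a)
    exact (h3.norm).pow 2

theorem IsIntegral.norm_sq {f : α → ℂ} {x y : K} (hf : E.IsIntegral f x y) {C : ℝ} (hC : ∀ a, ‖f a‖ ≤ C) :
    ‖y‖ ^ 2 = ∫ a, ‖f a‖ ^ 2 ∂E.scalarMeasure x := by
  have h0 : E.IsIntegral (0 : SimpleFunc α ℂ) x (E.simpleIntegral 0 x) := isIntegral_simpleFunc 0 x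
  have h0' : E.simpleIntegral 0 x = 0 := by
    have := E.simpleIntegral_sub 0 0 x
    simpa using this
  rw [h0'] at h0
  have := hf.norm_sub_sq h0 hC (fun a => by simpa using (norm_nonneg _).trans (hC a))
  simpa using this

theorem IsIntegral.add {f g : α → ℂ} {x y z : K} (hf : E.IsIntegral f x y)
    (hg : E.IsIntegral g x z) : E.IsIntegral (f + g) x (y + z) := by
  obtain ⟨s, hs, hsy⟩ := hf
  obtain ⟨t, ht, htz⟩ := hg
  refine ⟨fun n => s n + t n, ?_, ?_⟩
  · exact hs.add ht
  · simp only [simpleIntegral_add]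
    exact hsy.add htz

/-- Bounded convergence for integrals with respect to a spectral measure. -/
theorem IsIntegral.tendsto {f : ℕ → α → ℂ} {g : α → ℂ} {x z : K} {y : ℕ → K}
    (hf : ∀ n, E.IsIntegral (f n) x (y n)) (hg : E.IsIntegral g x z) {C : ℝ}
    (hfm : ∀ n, Measurable (f n)) (hgm : Measurable g)
    (hfC : ∀ n a, ‖f n a‖ ≤ C) (hgC : ∀ a, ‖g a‖ ≤ C)
    (h : ∀ a, Tendsto (fun n => f n a) atTop (𝓝 (g a))) : Tendsto y atTop (𝓝 z) := by
  rw [tendsto_iff_norm_sub_tendsto_zero]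
  have h1 : Tendsto (fun n => ‖y n - z‖ ^ 2) atTop (𝓝 0) := by
    simp only [(hf _).norm_sub_sq hg (hfC _) hgC]
    have : (0 : ℝ) = ∫ a, ‖g a - g a‖ ^ 2 ∂E.scalarMeasure x := by simp
    rw [this]
    refine tendsto_integral_filter_of_dominated_convergence (fun _ => (C + C) ^ 2)
      (Eventually.of_forall fun n => ?_) (Eventually.of_forall fun n => Eventually.of_forall
      fun a => ?_) (integrable_const _) (Eventually.of_forall fun a => ?_)
    · exact ((((hfm n).sub hgm).norm).pow_const 2).aestronglyMeasurable
    · rw [norm_pow, norm_norm]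
      have := (norm_sub_le (f n a) (g a)).trans (add_le_add (hfC n a) (hgC a))
      gcongr
    · exact (((h a).sub_const (g a)).norm).pow 2
  have h2 := h1.sqrt
  simpa using h2

/-- The integral of a bounded measurable function exists as a bounded operator. -/
theorem exists_integralCLM [CompleteSpace K] (E : SpectralMeasure α K) {f : α → ℂ}
    (hf : Measurable f) {C : ℝ} (hC : ∀ a, ‖f a‖ ≤ C) :
    ∃ L : K →L[ℂ] K, ∀ x, E.IsIntegral f x (L x) := by
  obtain ⟨s, hs⟩ := exists_simpleFunc_tendstoUniformly hf hC
  have hex : ∀ x, ∃ y, Tendsto (fun n => E.simpleIntegral (s n) x) atTop (𝓝 y) := by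
    intro x
    refine cauchySeq_tendsto_of_complete (Metric.cauchySeq_iff'.2 fun ε hε => ?_)
    have hd : 0 < ε / (2 * (‖x‖ + 1)) := by positivity
    obtain ⟨N, hN⟩ := eventually_atTop.1 (Metric.tendstoUniformly_iff.1 hs _ hd)
    refine ⟨N, fun n hn => ?_⟩
    rw [dist_eq_norm, ← simpleIntegral_sub]
    have : ‖E.simpleIntegral (s n - s N) x‖ ≤ ε / (‖x‖ + 1) * ‖x‖ := by
      refine norm_simpleIntegral_le (by positivity) (fun a => ?_) x
      have h3 := (dist_triangle_left (s n a) (s N a) (f a)).trans_lt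
        (add_lt_add (hN n hn a) (hN N le_rfl a))
      rw [dist_eq_norm] at h3
      have e : ε / (‖x‖ + 1) = ε / (2 * (‖x‖ + 1)) + ε / (2 * (‖x‖ + 1)) := by field_simp; norm_num
      rw [e]
      exact h3.le
    refine this.trans_lt ?_
    rw [div_mul_eq_mul_div, div_lt_iff₀ (by positivity)]
    nlinarith [norm_nonneg x]
  choose y hy using hex
  have hI : ∀ x, E.IsIntegral f x (y x) := fun x => ⟨s, hs, hy x⟩
  let L₀ : K →ₗ[ℂ] K :=
    { toFun := y
      map_add' := fun a b => by
        refine tendsto_nhds_unique (hy (a + b)) ?_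
        simp only [simpleIntegral_add_right]
        exact (hy a).add (hy b)
      map_smul' := fun c a => by
        refine tendsto_nhds_unique (hy (c • a)) ?_
        simp only [simpleIntegral_smul_right]
        exact (hy a).const_smul c }
  refine ⟨L₀.mkContinuous (|C| + 1) fun x => ?_, hI⟩
  refine le_of_tendsto (hy x).norm ?_
  filter_upwards [Metric.tendstoUniformly_iff.1 hs 1 one_pos] with n hn
  refine norm_simpleIntegral_le (by positivity) (fun a => ?_) x
  have h3 := hn a
  rw [dist_eq_norm, norm_sub_rev] at h3
  have := norm_sub_norm_le (s n a) (f a)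
  have := hC a
  have := le_abs_self C
  linarith

/-- Compression to an atom evaluates the integrand there. This is how the matrix entries of a double
operator integral are read off. -/
theorem IsIntegral.proj_singleton {f : α → ℂ} {x y : K} (hf : E.IsIntegral f x y) {p : α}
    (hp : MeasurableSet {p}) : E.proj {p} y = f p • E.proj {p} x := by
  obtain ⟨s, hs, hsy⟩ := hf
  have h1 := ((E.proj {p}).continuous.tendsto y).comp hsy
  refine tendsto_nhds_unique h1 ?_
  simp only [Function.comp_def, proj_simpleIntegral_singleton _ _ _ hp]
  exact (hs.tendsto_at p).smul_const _

end SpectralMeasure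

/-! ### Extension of projection-valued set functions -/

namespace ProjectionContent

variable {α : Type*} {K : Type*} [NormedAddCommGroup K] [InnerProductSpace ℂ K]

/-- `∏_{j<n} (1 - P (R j))`. -/
def residual (P : Set α → K →L[ℂ] K) (R : ℕ → Set α) : ℕ → K →L[ℂ] K
  | 0 => 1
  | n + 1 => residual P R n - P (R n) ∘L residual P R n

variable {𝒞 : Set (Set α)} {P : Set α → K →L[ℂ] K} {R : ℕ → Set α}

theorem residual_succ (n : ℕ) (x : K) :
    residual P R (n + 1) x = residual P R n x - P (R n) (residual P R n x) := rfl

theorem proj_residual (hinter : ∀ s ∈ 𝒞, ∀ t ∈ 𝒞, ∀ x, P s (P t x) = P (s ∩ t) x)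
    (hR : ∀ n, R n ∈ 𝒞) {s : Set α} (hs : s ∈ 𝒞) (n : ℕ) (x : K) :
    P s (residual P R n x) = residual P R n (P s x) := by
  induction n with
  | zero => rfl
  | succ n ih =>
    rw [residual_succ, residual_succ, map_sub, ih, hinter _ hs _ (hR n), Set.inter_comm,
      ← hinter _ (hR n) _ hs, ih]

theorem norm_residual_le (hP : ∀ s ∈ 𝒞, (P s : K →ₗ[ℂ] K).IsSymmetricProjection)
    (hR : ∀ n, R n ∈ 𝒞) (n : ℕ) (x : K) : ‖residual P R n x‖ ≤ ‖x‖ := by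
  induction n with
  | zero => exact le_rfl
  | succ n ih =>
    refine le_trans ?_ ih
    exact SymProj.norm_le (SymProj.one_sub (hP _ (hR n))) (residual P R n x)

/-- The `n`-th step removes exactly `‖P (R n) (residual P R n x)‖²`; as the projections commute and
the residual is a contraction, this is at most `‖P (R n) x‖²`. It is subadditivity up to the
residual term. -/
theorem le_norm_residual_sq (hP : ∀ s ∈ 𝒞, (P s : K →ₗ[ℂ] K).IsSymmetricProjection)
    (hinter : ∀ s ∈ 𝒞, ∀ t ∈ 𝒞, ∀ x, P s (P t x) = P (s ∩ t) x)
    (hR : ∀ n, R n ∈ 𝒞) (n : ℕ) (x : K) :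
    ‖x‖ ^ 2 ≤ ‖residual P R n x‖ ^ 2 + ∑ j ∈ Finset.range n, ‖P (R j) x‖ ^ 2 := by
  induction n with
  | zero => simp [residual]
  | succ n ih =>
    rw [residual_succ, SymProj.norm_sub_sq (hP _ (hR n)), Finset.sum_range_succ,
      proj_residual hinter hR (hR n)]
    have := norm_residual_le hP hR n (P (R n) x)
    have : ‖residual P R n (P (R n) x)‖ ^ 2 ≤ ‖P (R n) x‖ ^ 2 := by gcongr
    linarith

variable [MeasurableSpace α]

/-- For a vector whose quadratic form is already a measure, the algebra of commuting projections
mirrors set difference, so the residual is controlled by measure theory. -/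
theorem norm_proj_residual_sq (hmeas : ∀ s ∈ 𝒞, MeasurableSet s)
    (hC : ∀ s ∈ 𝒞, ∀ t ∈ 𝒞, s ∩ t ∈ 𝒞)
    (hP : ∀ s ∈ 𝒞, (P s : K →ₗ[ℂ] K).IsSymmetricProjection)
    (hinter : ∀ s ∈ 𝒞, ∀ t ∈ 𝒞, ∀ x, P s (P t x) = P (s ∩ t) x)
    (hR : ∀ n, R n ∈ 𝒞) {q : K} {m : Measure α} [IsFiniteMeasure m]
    (hm : ∀ s ∈ 𝒞, ‖P s q‖ ^ 2 = m.real s) (n : ℕ) {s : Set α} (hs : s ∈ 𝒞) :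
    ‖P s (residual P R n q)‖ ^ 2 = m.real (s \ ⋃ j < n, R j) := by
  induction n generalizing s with
  | zero => simpa [residual] using hm s hs
  | succ n ih =>
    have h1 : P s (residual P R (n + 1) q) =
        P s (residual P R n q) - P (R n) (P s (residual P R n q)) := by
      rw [residual_succ, map_sub, hinter _ hs _ (hR n), hinter _ (hR n) _ hs, Set.inter_comm]
    rw [h1, SymProj.norm_sub_sq (hP _ (hR n)), hinter _ (hR n) _ hs, ih hs,
      ih (hC _ (hR n) _ hs)]
    have hU : MeasurableSet (⋃ j < n, R j) :=
      MeasurableSet.biUnion (Set.to_countable _) fun j _ => hmeas _ (hR j)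
    have h2 := measureReal_sdiff_add_inter (μ := m) (s := s \ ⋃ j < n, R j) (hmeas _ (hR n))
    have h3 : (s \ ⋃ j < n, R j) \ R n = s \ ⋃ j < n + 1, R j := by
      ext z
      simp only [Set.mem_sdiff, Set.mem_iUnion, not_exists]
      constructor
      · rintro ⟨⟨h, h'⟩, h''⟩
        refine ⟨h, fun j hj => ?_⟩
        rcases Nat.lt_succ_iff_lt_or_eq.1 hj with h1 | rfl
        exacts [h' j h1, h'']
      · rintro ⟨h, h'⟩
        exact ⟨⟨h, fun j hj => h' j (hj.trans (Nat.lt_succ_self n))⟩, h' n (Nat.lt_succ_self n)⟩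
    have h4 : (s \ ⋃ j < n, R j) ∩ R n = (R n ∩ s) \ ⋃ j < n, R j := by
      ext z; simp only [Set.mem_sdiff, Set.mem_inter_iff]; tauto
    rw [h3, h4] at h2
    linarith

/-- The residuals are contractions, so it is enough to treat a total set of vectors. There the
squared norm is the measure of `s \ ⋃ j < n, R j`, which decreases to zero by continuity from above.
-/
theorem tendsto_residual (hmeas : ∀ s ∈ 𝒞, MeasurableSet s)
    (hC : ∀ s ∈ 𝒞, ∀ t ∈ 𝒞, s ∩ t ∈ 𝒞)
    (hP : ∀ s ∈ 𝒞, (P s : K →ₗ[ℂ] K).IsSymmetricProjection)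
    (hinter : ∀ s ∈ 𝒞, ∀ t ∈ 𝒞, ∀ x, P s (P t x) = P (s ∩ t) x)
    {D : Set K} (hD : Dense (Submodule.span ℂ D : Set K))
    (hm : ∀ q ∈ D, ∃ m : Measure α, IsFiniteMeasure m ∧ ∀ s ∈ 𝒞, ‖P s q‖ ^ 2 = m.real s)
    (hR : ∀ n, R n ∈ 𝒞) {s : Set α} (hs : s ∈ 𝒞) (hsR : s ⊆ ⋃ n, R n) (x : K) :
    Tendsto (fun n => residual P R n (P s x)) atTop (𝓝 0) := by
  let W : Submodule ℂ K :=
    { carrier := {x | Tendsto (fun n => residual P R n (P s x)) atTop (𝓝 0)}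
      add_mem' := fun {a b} ha hb => by
        simp only [Set.mem_ofPred_eq, map_add] at *
        simpa using ha.add hb
      zero_mem' := by simp
      smul_mem' := fun c a ha => by
        simp only [Set.mem_ofPred_eq, map_smul] at *
        simpa using ha.const_smul c }
  have hDW : Submodule.span ℂ D ≤ W := by
    rw [Submodule.span_le]
    intro q hq
    obtain ⟨m, hmf, hmq⟩ := hm q hq
    have h1 : Tendsto (fun n => ‖residual P R n (P s q)‖ ^ 2) atTop (𝓝 0) := by
      simp only [← proj_residual hinter hR hs,
        norm_proj_residual_sq hmeas hC hP hinter hR hmq _ hs]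
      have h2 := tendsto_measure_iInter_atTop (μ := m) (s := fun n => s \ ⋃ j < n, R j)
        (fun n => ((hmeas s hs).diff (MeasurableSet.biUnion (Set.to_countable _)
          fun j _ => hmeas _ (hR j))).nullMeasurableSet)
        (fun a b hab => by
          apply Set.sdiff_subset_sdiff_right
          exact Set.biUnion_subset_biUnion_left fun j hj => lt_of_lt_of_le hj hab)
        ⟨0, measure_ne_top _ _⟩
      have h3 : ⋂ n, s \ ⋃ j < n, R j = ∅ := by
        rw [Set.eq_empty_iff_forall_notMem]
        intro z hz
        simp only [Set.mem_iInter, Set.mem_sdiff, Set.mem_iUnion, not_exists] at hz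
        obtain ⟨n, hn⟩ := Set.mem_iUnion.1 (hsR (hz 0).1)
        exact (hz (n + 1)).2 n (Nat.lt_succ_self n) hn
      rw [h3, measure_empty] at h2
      exact (ENNReal.tendsto_toReal ENNReal.zero_ne_top).comp h2
    have h2 := h1.sqrt
    simp only [Real.sqrt_sq (norm_nonneg _), Real.sqrt_zero] at h2
    exact tendsto_zero_iff_norm_tendsto_zero.2 h2
  rw [Metric.tendsto_nhds]
  intro ε hε
  obtain ⟨y, hy, hxy⟩ := hD.exists_dist_lt x (half_pos hε)
  have hy' : Tendsto (fun n => residual P R n (P s y)) atTop (𝓝 0) := hDW hy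
  filter_upwards [Metric.tendsto_nhds.1 hy' _ (half_pos hε)] with n hn
  rw [dist_zero_right] at hn ⊢
  have h1 : residual P R n (P s x) = residual P R n (P s y) + residual P R n (P s (x - y)) := by
    simp
  have h2 := (norm_residual_le hP hR n (P s (x - y))).trans (SymProj.norm_le (hP s hs) _)
  rw [dist_eq_norm] at hxy
  rw [h1]
  have := norm_add_le (residual P R n (P s y)) (residual P R n (P s (x - y)))
  linarith

/-- The sum of the projections of the pieces is a projection. On `q ∈ D` its distance to `P (⋃₀ I)
q` has square `m (⋃₀ I) - ∑ m s = 0`, so the two operators agree on a total set and hence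
everywhere. -/
theorem proj_sUnion (hmeas : ∀ s ∈ 𝒞, MeasurableSet s)
    (hP : ∀ s ∈ 𝒞, (P s : K →ₗ[ℂ] K).IsSymmetricProjection)
    (hinter : ∀ s ∈ 𝒞, ∀ t ∈ 𝒞, ∀ x, P s (P t x) = P (s ∩ t) x) (hempty : P ∅ = 0)
    {D : Set K} (hD : Dense (Submodule.span ℂ D : Set K))
    (hm : ∀ q ∈ D, ∃ m : Measure α, IsFiniteMeasure m ∧ ∀ s ∈ 𝒞, ‖P s q‖ ^ 2 = m.real s)
    (I : Finset (Set α)) (hI : ↑I ⊆ 𝒞) (hd : (I : Set (Set α)).PairwiseDisjoint id)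
    (hU : ⋃₀ ↑I ∈ 𝒞) (x : K) :
    ‖P (⋃₀ I) x‖ ^ 2 = ∑ s ∈ I, ‖P s x‖ ^ 2 := by
  classical
  let Q : I → K →L[ℂ] K := fun i => P i
  have hQ : ∀ i, (Q i : K →ₗ[ℂ] K).IsSymmetricProjection := fun i => hP _ (hI i.2)
  have hQ0 : ∀ i j, i ≠ j → ∀ x, Q i (Q j x) = 0 := fun i j hij x => by
    simp only [Q]
    have hdij : Disjoint (i : Set α) j := hd i.2 j.2 fun h => hij (Subtype.ext h)
    rw [hinter _ (hI i.2) _ (hI j.2), Set.disjoint_iff_inter_eq_empty.1 hdij, hempty]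
    rfl
  have hsum : P (⋃₀ I) = ∑ i, Q i := by
    refine ContinuousLinearMap.ext_on hD fun q hq => ?_
    obtain ⟨m, hmf, hmq⟩ := hm q hq
    have hS := SymProj.sum hQ hQ0 Finset.univ
    have h1 : (∑ i, Q i) (P (⋃₀ I) q) = (∑ i, Q i) q := by
      simp only [_root_.sum_apply]
      refine Finset.sum_congr rfl fun i _ => ?_
      simp only [Q]
      rw [hinter _ (hI i.2) _ hU, Set.inter_eq_left.2 (Set.subset_sUnion_of_mem i.2)]
    have h2 := SymProj.norm_sub_sq hS (P (⋃₀ I) q)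
    rw [h1, hmq _ hU, _root_.sum_apply, SymProj.norm_sum_sq hQ hQ0] at h2
    have h3 : m.real (⋃₀ ↑I) = ∑ i : I, m.real i := by
      rw [Set.sUnion_eq_biUnion]
      refine Eq.trans ?_ (Finset.sum_coe_sort I (fun i => m.real i)).symm
      exact measureReal_biUnion_finset hd fun i hi => hmeas _ (hI hi)
    have h4 : ∑ i, ‖Q i q‖ ^ 2 = ∑ i : I, m.real i :=
      Finset.sum_congr rfl fun i _ => hmq _ (hI i.2)
    rw [h3, h4, sub_self, sq_eq_zero_iff, norm_eq_zero, sub_eq_zero] at h2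
    rw [h2, _root_.sum_apply]
  rw [hsum, _root_.sum_apply, SymProj.norm_sum_sq hQ hQ0,
    ← Finset.sum_coe_sort I (fun s => ‖P s x‖ ^ 2)]

/-- A projection-valued set function on a semiring, whose quadratic form is a measure for a total
set of vectors, has a measure as its quadratic form for all vectors. -/
theorem exists_measure (hC : IsSetSemiring 𝒞)
    (hgen : ‹MeasurableSpace α› = MeasurableSpace.generateFrom 𝒞)
    (hP : ∀ s ∈ 𝒞, (P s : K →ₗ[ℂ] K).IsSymmetricProjection)
    (hinter : ∀ s ∈ 𝒞, ∀ t ∈ 𝒞, ∀ x, P s (P t x) = P (s ∩ t) x)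
    {D : Set K} (hD : Dense (Submodule.span ℂ D : Set K))
    (hm : ∀ q ∈ D, ∃ m : Measure α, IsFiniteMeasure m ∧ ∀ s ∈ 𝒞, ‖P s q‖ ^ 2 = m.real s)
    (x : K) : ∃ μ : Measure α, ∀ s ∈ 𝒞, μ s = ENNReal.ofReal (‖P s x‖ ^ 2) := by
  have hmeas : ∀ s ∈ 𝒞, MeasurableSet s := fun s hs => by
    rw [hgen]; exact MeasurableSpace.measurableSet_generateFrom hs
  have hempty : P ∅ = 0 := by
    refine ContinuousLinearMap.ext_on hD fun q hq => ?_
    obtain ⟨m, _, hmq⟩ := hm q hq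
    have := hmq _ hC.empty_mem
    simpa using this
  let c : AddContent ℝ≥0∞ 𝒞 :=
    { toFun := fun s => ENNReal.ofReal (‖P s x‖ ^ 2)
      empty' := by simp [hempty]
      sUnion' := fun I hI hd hU => by
        rw [proj_sUnion hmeas hP hinter hempty hD hm I hI hd hU,
          ENNReal.ofReal_sum_of_nonneg fun _ _ => sq_nonneg _] }
  have hc : ∀ s, c s = ENNReal.ofReal (‖P s x‖ ^ 2) := fun _ => rfl
  have hsub : c.IsSigmaSubadditive := by
    intro R hR hU
    have hlim := tendsto_residual hmeas hC.inter_mem hP hinter hD hm hR hU subset_rfl x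
    -- The vector `P (⋃ n, R n) x` loses at most `∑ c (R j)` in squared norm, and what is left of it
    -- tends to zero by `hlim`.
    have h1 : ∀ n, ENNReal.ofReal (‖P (⋃ n, R n) x‖ ^ 2) ≤
        ENNReal.ofReal (‖residual P R n (P (⋃ n, R n) x)‖ ^ 2) + ∑' j, c (R j) := by
      intro n
      have h2 := le_norm_residual_sq hP hinter hR n (P (⋃ n, R n) x)
      refine (ENNReal.ofReal_le_ofReal h2).trans ?_
      rw [ENNReal.ofReal_add (sq_nonneg _) (Finset.sum_nonneg fun _ _ => sq_nonneg _),
        ENNReal.ofReal_sum_of_nonneg fun _ _ => sq_nonneg _]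
      gcongr
      refine le_trans (Finset.sum_le_sum fun j _ => ?_)
        (ENNReal.sum_le_tsum (f := fun j => c (R j)) (Finset.range n))
      rw [hinter _ (hR j) _ hU, Set.inter_eq_left.2 (Set.subset_iUnion R j), hc]
    have h3 : Tendsto (fun n => ENNReal.ofReal (‖residual P R n (P (⋃ n, R n) x)‖ ^ 2) +
        ∑' j, c (R j)) atTop (𝓝 (ENNReal.ofReal (‖(0 : K)‖ ^ 2) + ∑' j, c (R j))) :=
      (ENNReal.tendsto_ofReal (hlim.norm.pow 2)).add tendsto_const_nhds
    have h4 := ge_of_tendsto' h3 h1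
    simpa [hc] using h4
  exact ⟨c.measure hC hgen.le hsub, fun s hs => c.measure_eq hC hgen hsub hs⟩

/-- If the quadratic forms of a projection-valued set function on a semiring are measures, then it
extends to a spectral measure. -/
theorem exists_spectralMeasure [CompleteSpace K] (hC : IsSetSemiring 𝒞)
    (hgen : ‹MeasurableSpace α› = MeasurableSpace.generateFrom 𝒞) (huniv : Set.univ ∈ 𝒞)
    (hP : ∀ s ∈ 𝒞, (P s : K →ₗ[ℂ] K).IsSymmetricProjection)
    (hinter : ∀ s ∈ 𝒞, ∀ t ∈ 𝒞, ∀ x, P s (P t x) = P (s ∩ t) x) (hPuniv : P Set.univ = 1)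
    {D : Set K} (hD : Dense (Submodule.span ℂ D : Set K))
    (hm : ∀ q ∈ D, ∃ m : Measure α, IsFiniteMeasure m ∧ ∀ s ∈ 𝒞, ‖P s q‖ ^ 2 = m.real s) :
    ∃ E : SpectralMeasure α K, ∀ s ∈ 𝒞, E.proj s = P s := by
  classical
  choose μ hμ using exists_measure hC hgen hP hinter hD hm
  have hμu : ∀ x, μ x Set.univ = ENNReal.ofReal (‖x‖ ^ 2) := fun x => by
    rw [hμ x _ huniv, hPuniv]; rfl
  have hfin : ∀ x, IsFiniteMeasure (μ x) := fun x => ⟨by rw [hμu]; exact ENNReal.ofReal_lt_top⟩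
  have hμur : ∀ x, (μ x).real Set.univ = ‖x‖ ^ 2 := fun x => by
    rw [measureReal_def, hμu, ENNReal.toReal_ofReal (sq_nonneg _)]
  have horth : ∀ {A B : Set α} {T S : K →L[ℂ] K}, MeasurableSet B → Disjoint A B →
      (S : K →ₗ[ℂ] K).IsSymmetricProjection → (∀ x, ‖T x‖ ^ 2 = (μ x).real A) →
      (∀ x, ‖S x‖ ^ 2 = (μ x).real B) → ∀ x, T (S x) = 0 := by
    intro A B T S hB hd hS hTA hSB
    refine SymProj.comp_eq_zero hS fun x => ?_
    rw [hTA, hSB, ← measureReal_union hd hB, ← hμur]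
    exact measureReal_mono (Set.subset_univ _)
  have hfam : ∀ (f : ℕ → Set α) (T : ℕ → K →L[ℂ] K), (∀ n, MeasurableSet (f n)) →
      Pairwise (Function.onFun Disjoint f) →
      (∀ n, (T n : K →ₗ[ℂ] K).IsSymmetricProjection) →
      (∀ n x, ‖T n x‖ ^ 2 = (μ x).real (f n)) →
      ∃ S : K →L[ℂ] K, (S : K →ₗ[ℂ] K).IsSymmetricProjection ∧
        (∀ x, HasSum (fun n => T n x) (S x)) ∧ ∀ x, ‖S x‖ ^ 2 = (μ x).real (⋃ n, f n) := by
    intro f T hf hd hT hTf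
    obtain ⟨S, hS, h1, h2⟩ := SymProj.exists_hasSum hT fun i j hij =>
      horth (hf j) (hd hij) (hT j) (hTf i) (hTf j)
    refine ⟨S, hS, h1, fun x => (h2 x).unique ?_⟩
    simp only [hTf]
    have h3 := measure_iUnion (μ := μ x) hd hf
    have h4 := (ENNReal.hasSum_toReal (f := fun n => μ x (f n)) (by
      rw [← h3]; exact measure_ne_top _ _))
    rw [← ENNReal.tsum_toReal_eq (fun n => measure_ne_top _ _), ← h3] at h4
    exact h4
  -- The sets `A` for which `x ↦ μ x A` is the quadratic form of a projection form a Dynkin system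
  -- containing `𝒞`: complements correspond to `1 - T`, disjoint unions to strong sums of orthogonal
  -- projections.
  have hex : ∀ A, MeasurableSet A → ∃ T : K →L[ℂ] K, (T : K →ₗ[ℂ] K).IsSymmetricProjection ∧
      ∀ x, ‖T x‖ ^ 2 = (μ x).real A := by
    intro A hA
    induction A, hA using MeasurableSpace.induction_on_inter hgen hC.isPiSystem with
    | empty => exact ⟨0, ⟨by ext; simp, fun _ _ => by simp⟩, by simp⟩
    | basic s hs =>
      exact ⟨P s, hP s hs, fun x => by
        rw [measureReal_def, hμ x s hs, ENNReal.toReal_ofReal (sq_nonneg _)]⟩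
    | compl s hs ih =>
      obtain ⟨T, hT, h⟩ := ih
      refine ⟨1 - T, SymProj.one_sub hT, fun x => ?_⟩
      rw [measureReal_compl hs, hμur, ← h]
      exact SymProj.norm_sub_sq hT x
    | iUnion f hd hf ih =>
      choose T hT h using ih
      obtain ⟨S, hS, _, h2⟩ := hfam f T hf hd hT h
      exact ⟨S, hS, h2⟩
  choose T hT hTn using hex
  let E : SpectralMeasure α K :=
    { proj := fun A => if h : MeasurableSet A then T A h else 0
      isSymmetricProjection := fun A hA => by rw [dif_pos hA]; exact hT A hA
      proj_univ := by
        rw [dif_pos MeasurableSet.univ]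
        refine SymProj.ext_norm (hT _ _) ⟨by ext; simp, fun _ _ => by simp⟩ fun x => ?_
        rw [hTn, hμur]
        rfl
      hasSum_iUnion := fun A hA hd x => by
        obtain ⟨S, hS, h1, h2⟩ := hfam A (fun n => T (A n) (hA n)) hA hd (fun n => hT _ _)
          (fun n x => hTn _ _ x)
        have : S = T _ (MeasurableSet.iUnion hA) :=
          SymProj.ext_norm hS (hT _ _) fun x => by rw [h2, hTn]
        simp only [hA, dif_pos, MeasurableSet.iUnion hA, ← this]
        exact h1 x }
  refine ⟨E, fun s hs => ?_⟩
  have hsm : MeasurableSet s := by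
    rw [hgen]; exact MeasurableSpace.measurableSet_generateFrom hs
  have h1 : E.proj s = T s hsm := dif_pos hsm
  rw [h1]
  refine SymProj.ext_norm (hT _ _) (hP s hs) fun x => ?_
  rw [hTn, measureReal_def, hμ x s hs, ENNReal.toReal_ofReal (sq_nonneg _)]

end ProjectionContent

/-- Measurable rectangles form a semiring. -/
theorem isSetSemiring_rectangles {α β : Type*} [MeasurableSpace α] [MeasurableSpace β] :
    IsSetSemiring (Set.image2 (· ×ˢ ·) {s : Set α | MeasurableSet s} {t : Set β | MeasurableSet t}) where
  empty_mem := ⟨∅, MeasurableSet.empty, ∅, MeasurableSet.empty, by simp⟩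
  inter_mem := by
    rintro _ ⟨A, hA, B, hB, rfl⟩ _ ⟨A', hA', B', hB', rfl⟩
    exact ⟨A ∩ A', MeasurableSet.inter hA hA', B ∩ B', MeasurableSet.inter hB hB',
      Set.prod_inter_prod.symm⟩
  sdiff_eq_sUnion' := by
    classical
    rintro _ ⟨A, hA, B, hB, rfl⟩ _ ⟨A', hA', B', hB', rfl⟩
    refine ⟨{(A \ A') ×ˢ B, (A ∩ A') ×ˢ (B \ B')}, ?_, ?_, ?_⟩
    · intro s hs
      simp only [Finset.coe_insert, Finset.coe_singleton, Set.mem_insert_iff,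
        Set.mem_singleton_iff] at hs
      rcases hs with rfl | rfl
      · exact ⟨_, MeasurableSet.diff hA hA', _, hB, rfl⟩
      · exact ⟨_, MeasurableSet.inter hA hA', _, MeasurableSet.diff hB hB', rfl⟩
    · have hd : Disjoint ((A \ A') ×ˢ B) ((A ∩ A') ×ˢ (B \ B')) :=
        Set.disjoint_prod.2 (Or.inl (Set.disjoint_sdiff_left.mono_right Set.inter_subset_right))
      intro s hs t ht hst
      simp only [Finset.coe_insert, Finset.coe_singleton, Set.mem_insert_iff,
        Set.mem_singleton_iff] at hs ht
      rcases hs with rfl | rfl <;> rcases ht with rfl | rfl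
      · exact absurd rfl hst
      · exact hd
      · exact hd.symm
      · exact absurd rfl hst
    · ext ⟨a, b⟩
      simp only [Set.mem_sdiff, Set.mem_prod, Finset.coe_insert, Finset.coe_singleton,
        Set.sUnion_insert, Set.sUnion_singleton, Set.mem_union, Set.mem_inter_iff]
      tauto

/-! ### The Hilbert–Schmidt class -/

namespace HilbertSchmidt

variable {H : Type u} [NormedAddCommGroup H] [InnerProductSpace ℂ H] [CompleteSpace H]

/-- `∑ ‖Q eᵢ‖²` as an extended nonnegative number. -/
def sqSum (Q : H →L[ℂ] H) : ℝ≥0∞ := ∑' i, ‖Q (fixedBasis H i)‖ₑ ^ 2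

theorem tsum_enorm_inner_sq (x : H) : ∑' i, ‖⟪fixedBasis H i, x⟫_ℂ‖ₑ ^ 2 = ‖x‖ₑ ^ 2 := by
  have h := (fixedBasis H).hasSum_inner_mul_inner x x
  have h2 : HasSum (fun i => ‖⟪fixedBasis H i, x⟫_ℂ‖ ^ 2) (‖x‖ ^ 2) := by
    have h3 : (fun i => ⟪x, fixedBasis H i⟫_ℂ * ⟪fixedBasis H i, x⟫_ℂ) =
        fun i => ((‖⟪fixedBasis H i, x⟫_ℂ‖ ^ 2 : ℝ) : ℂ) := by
      funext i
      rw [← inner_conj_symm x, ← Complex.normSq_eq_conj_mul_self, Complex.normSq_eq_norm_sq]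
    rw [h3, inner_self_eq_norm_sq_to_K] at h
    have h4 : HasSum (fun i => ((‖⟪fixedBasis H i, x⟫_ℂ‖ ^ 2 : ℝ) : ℂ)) ((‖x‖ ^ 2 : ℝ) : ℂ) := by
      rw [Complex.ofReal_pow]
      exact h
    exact_mod_cast h4
  have h5 : ∀ r : H, ‖r‖ₑ ^ 2 = ENNReal.ofReal (‖r‖ ^ 2) := fun r => by
    rw [ENNReal.ofReal_pow (norm_nonneg _), ofReal_norm]
  have h6 : ∀ r : ℂ, ‖r‖ₑ ^ 2 = ENNReal.ofReal (‖r‖ ^ 2) := fun r => by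
    rw [ENNReal.ofReal_pow (norm_nonneg _), ofReal_norm]
  simp only [h5, h6]
  rw [← h2.tsum_eq, ENNReal.ofReal_tsum_of_nonneg (fun _ => sq_nonneg _) h2.summable]

/-- Parseval writes both sides as the double sum of `|⟪eⱼ, Q eᵢ⟫|²`, and nonnegative sums may be
interchanged. It yields the ideal property on the right from the one on the left. -/
theorem sqSum_adjoint (Q : H →L[ℂ] H) : sqSum (ContinuousLinearMap.adjoint Q) = sqSum Q := by
  simp only [sqSum]
  have h1 : ∀ i, ‖Q (fixedBasis H i)‖ₑ ^ 2 =
      ∑' j, ‖⟪fixedBasis H j, Q (fixedBasis H i)⟫_ℂ‖ₑ ^ 2 := fun i =>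
    (tsum_enorm_inner_sq _).symm
  simp only [h1]
  rw [ENNReal.tsum_comm]
  refine tsum_congr fun i => ?_
  rw [← tsum_enorm_inner_sq]
  refine tsum_congr fun j => ?_
  rw [ContinuousLinearMap.adjoint_inner_right, ← inner_conj_symm, RCLike.enorm_conj]

theorem sqSum_comp_le (A Q : H →L[ℂ] H) : sqSum (A ∘L Q) ≤ ‖A‖ₑ ^ 2 * sqSum Q := by
  simp only [sqSum]
  rw [← ENNReal.tsum_mul_left]
  refine ENNReal.tsum_le_tsum fun i => ?_
  rw [← mul_pow]
  gcongr
  exact A.le_opENorm _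

theorem sqSum_comp_le' (Q B : H →L[ℂ] H) : sqSum (Q ∘L B) ≤ ‖B‖ₑ ^ 2 * sqSum Q := by
  rw [← sqSum_adjoint, ContinuousLinearMap.adjoint_comp, ← sqSum_adjoint Q]
  refine (sqSum_comp_le _ _).trans_eq ?_
  congr 2
  rw [← ofReal_norm, ← ofReal_norm, LinearIsometryEquiv.norm_map]

theorem mem_iff (Q : H →L[ℂ] H) : Q ∈ hilbertSchmidtSubmodule H ↔ sqSum Q < ∞ := by
  change Memℓp _ 2 ↔ _
  rw [memℓp_gen_iff (by norm_num)]
  have h6 : ∀ r : H, ‖r‖ₑ ^ 2 = ENNReal.ofReal (‖r‖ ^ 2) := fun r => by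
    rw [ENNReal.ofReal_pow (norm_nonneg _), ofReal_norm]
  simp only [sqSum, h6, ENNReal.toReal_ofNat, Real.rpow_ofNat]
  rw [lt_top_iff_ne_top]
  constructor
  · intro h; exact h.tsum_ofReal_ne_top
  · intro h
    have := ENNReal.summable_toReal h
    simpa only [ENNReal.toReal_ofReal (sq_nonneg _)] using this

/-- A bounded operator with `∑ ‖Q eᵢ‖² < ∞`, as an element of the Hilbert–Schmidt class. -/
def mk (Q : H →L[ℂ] H) (h : sqSum Q < ∞) : HilbertSchmidt H :=
  show hilbertSchmidtSubmodule H from ⟨Q, (mem_iff Q).2 h⟩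

@[simp] theorem toCLM_mk (Q : H →L[ℂ] H) (h : sqSum Q < ∞) : toCLM H (mk Q h) = Q := rfl

theorem toCLM_injective : Function.Injective (toCLM H) := Subtype.val_injective

theorem sqSum_toCLM_lt_top (Q : HilbertSchmidt H) : sqSum (toCLM H Q) < ∞ :=
  (mem_iff _).1 Q.2

theorem hasSum_inner (Q R : HilbertSchmidt H) :
    HasSum (fun i => ⟪toCLM H Q (fixedBasis H i), toCLM H R (fixedBasis H i)⟫_ℂ) ⟪Q, R⟫_ℂ :=
  lp.hasSum_inner (toLp H Q) (toLp H R)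

theorem enorm_sq (Q : HilbertSchmidt H) : ‖Q‖ₑ ^ 2 = sqSum (toCLM H Q) := by
  have h := hasSum_inner Q Q
  simp only [inner_self_eq_norm_sq_to_K] at h
  have h2 : HasSum (fun i => ‖toCLM H Q (fixedBasis H i)‖ ^ 2) (‖Q‖ ^ 2) := by
    have h4 : HasSum (fun i => ((‖toCLM H Q (fixedBasis H i)‖ ^ 2 : ℝ) : ℂ))
        ((‖Q‖ ^ 2 : ℝ) : ℂ) := by
      push_cast
      exact h
    exact_mod_cast h4
  have h6 : ∀ r : H, ‖r‖ₑ ^ 2 = ENNReal.ofReal (‖r‖ ^ 2) := fun r => by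
    rw [ENNReal.ofReal_pow (norm_nonneg _), ofReal_norm]
  simp only [sqSum, h6]
  rw [← ENNReal.ofReal_tsum_of_nonneg (fun _ => sq_nonneg _) h2.summable, h2.tsum_eq,
    ENNReal.ofReal_pow (norm_nonneg _), ofReal_norm]

/-- The operator `h ↦ ⟪x, h⟫ y`. -/
def rankOne (x y : H) : HilbertSchmidt H :=
  mk ((innerSL ℂ x).smulRight y) (by
    have : ∀ i, ‖((innerSL ℂ x).smulRight y) (fixedBasis H i)‖ₑ ^ 2 =
        ‖⟪fixedBasis H i, x⟫_ℂ‖ₑ ^ 2 * ‖y‖ₑ ^ 2 := fun i => by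
      rw [ContinuousLinearMap.smulRight_apply, innerSL_apply_apply, enorm_smul, mul_pow,
        ← inner_conj_symm, RCLike.enorm_conj]
    simp only [sqSum, this]
    rw [ENNReal.tsum_mul_right, tsum_enorm_inner_sq]
    exact ENNReal.mul_lt_top (ENNReal.pow_lt_top enorm_lt_top) (ENNReal.pow_lt_top enorm_lt_top))

@[simp] theorem toCLM_rankOne (x y h : H) : toCLM H (rankOne x y) h = ⟪x, h⟫_ℂ • y := rfl

/-- Moving `Q` to its adjoint turns the defining sum into Parseval's identity. With this formula the
norm, density and symmetry arguments below no longer refer to the chosen basis. -/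
theorem inner_rankOne (Q : HilbertSchmidt H) (x y : H) :
    ⟪Q, rankOne x y⟫_ℂ = ⟪toCLM H Q x, y⟫_ℂ := by
  have h1 := hasSum_inner Q (rankOne x y)
  have h2 := (fixedBasis H).hasSum_inner_mul_inner x (ContinuousLinearMap.adjoint (toCLM H Q) y)
  rw [ContinuousLinearMap.adjoint_inner_right] at h2
  simp only [toCLM_rankOne, inner_smul_right] at h1
  simp only [ContinuousLinearMap.adjoint_inner_right] at h2
  exact h1.unique h2

theorem norm_rankOne (x y : H) : ‖rankOne x y‖ = ‖x‖ * ‖y‖ := by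
  have h := inner_rankOne (rankOne x y) x y
  rw [toCLM_rankOne, inner_smul_left, inner_self_eq_norm_sq_to_K, inner_self_eq_norm_sq_to_K,
    inner_self_eq_norm_sq_to_K] at h
  have h2 : ‖rankOne x y‖ ^ 2 = (‖x‖ * ‖y‖) ^ 2 := by
    apply Complex.ofReal_injective
    push_cast
    rw [mul_pow]
    simpa using h
  exact (pow_left_inj₀ (norm_nonneg _) (by positivity) two_ne_zero).1 h2

theorem norm_toCLM_le (Q : HilbertSchmidt H) : ‖toCLM H Q‖ ≤ ‖Q‖ := by
  refine ContinuousLinearMap.opNorm_le_bound _ (norm_nonneg _) fun x => ?_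
  -- Cauchy–Schwarz against the rank-one operator with `y = Q x` reads `‖Q x‖² ≤ ‖Q‖ ‖x‖ ‖Q x‖`.
  have h := norm_inner_le_norm (𝕜 := ℂ) Q (rankOne x (toCLM H Q x))
  rw [inner_rankOne, norm_rankOne, inner_self_eq_norm_sq_to_K] at h
  simp only [norm_pow, Complex.coe_algebraMap, Complex.norm_real, norm_norm] at h
  rcases eq_or_lt_of_le (norm_nonneg (toCLM H Q x)) with h0 | h0
  · rw [← h0]; positivity
  · nlinarith

/-- `toCLM` as a continuous linear map. -/
def toCLML : HilbertSchmidt H →L[ℂ] (H →L[ℂ] H) :=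
  (toCLM H).mkContinuous 1 fun Q => by simpa using norm_toCLM_le Q

instance : CompleteSpace (HilbertSchmidt H) := by
  refine Metric.complete_of_cauchySeq_tendsto fun Q hQ => ?_
  let ι : HilbertSchmidt H →ₗᵢ[ℂ] lp (fun _ : basisIndex H => H) 2 := ⟨toLp H, fun _ => rfl⟩
  obtain ⟨f, hf⟩ := cauchySeq_tendsto_of_complete (ι.isometry.uniformContinuous.comp_cauchySeq hQ)
  obtain ⟨L, hL⟩ := cauchySeq_tendsto_of_complete ((toCLML (H := H)).uniformContinuous.comp_cauchySeq hQ)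
  -- The sequence converges both in the Hilbert sum and in operator norm; the two limits agree on
  -- the basis, so the limit sequence comes from a bounded operator.
  have hLf : ∀ i, L (fixedBasis H i) = f i := fun i => by
    have h1 : Tendsto (fun n => toCLM H (Q n) (fixedBasis H i)) atTop (𝓝 (L (fixedBasis H i))) :=
      ((ContinuousLinearMap.apply ℂ H (fixedBasis H i)).continuous.tendsto L).comp hL
    refine tendsto_nhds_unique h1 ?_
    have h2 := (lp.uniformContinuous_coe (E := fun _ : basisIndex H => H)
      (p := 2)).continuous.tendsto f
    exact ((tendsto_pi_nhds.1 h2) i).comp hf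
  have hLm : L ∈ hilbertSchmidtSubmodule H := by
    change Memℓp _ 2
    simp only [hLf]
    exact f.2
  let R : HilbertSchmidt H := show hilbertSchmidtSubmodule H from ⟨L, hLm⟩
  have hR : ι R = f := by
    apply Subtype.ext
    funext i
    exact hLf i
  refine ⟨R, ?_⟩
  rw [ι.isometry.isEmbedding.tendsto_nhds_iff, hR]
  exact hf

/-- An operator orthogonal to all rank-one operators is in particular orthogonal to `rankOne x (Q
x)`, which says `‖Q x‖² = 0`. -/
theorem dense_span_rankOne :
    Dense (Submodule.span ℂ (Set.range fun p : H × H => rankOne p.1 p.2) :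
      Set (HilbertSchmidt H)) := by
  rw [Submodule.dense_iff_topologicalClosure_eq_top, Submodule.topologicalClosure_eq_top_iff,
    Submodule.eq_bot_iff]
  intro Q hQ
  apply toCLM_injective
  ext x
  have h1 : ⟪Q, rankOne x (toCLM H Q x)⟫_ℂ = 0 := Submodule.inner_left_of_mem_orthogonal
    (Submodule.subset_span (Set.mem_range_self (x, toCLM H Q x))) hQ
  rw [inner_rankOne, inner_self_eq_zero] at h1
  rw [h1, map_zero]
  rfl

/-- The transformer `Q ↦ A Q B` on the Hilbert–Schmidt class. -/
def sandwich (A B : H →L[ℂ] H) : HilbertSchmidt H →L[ℂ] HilbertSchmidt H :=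
  LinearMap.mkContinuous
    { toFun := fun Q => mk (A ∘L toCLM H Q ∘L B) (by
        refine (sqSum_comp_le _ _).trans_lt (ENNReal.mul_lt_top (ENNReal.pow_lt_top enorm_lt_top) ?_)
        exact (sqSum_comp_le' _ _).trans_lt
          (ENNReal.mul_lt_top (ENNReal.pow_lt_top enorm_lt_top) (sqSum_toCLM_lt_top Q)))
      map_add' := fun Q R => by
        apply toCLM_injective
        ext h
        simp
      map_smul' := fun c Q => by
        apply toCLM_injective
        ext h
        simp } (‖A‖ * ‖B‖) (fun Q => by
      refine le_of_sq_le_sq ?_ (by positivity)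
      have h1 : ∀ h, ‖mk (A ∘L toCLM H Q ∘L B) h‖ₑ ^ 2 ≤ (‖A‖ₑ * ‖B‖ₑ * ‖Q‖ₑ) ^ 2 := fun h => by
        rw [enorm_sq, mul_pow, mul_pow, enorm_sq, toCLM_mk, mul_assoc]
        refine (sqSum_comp_le _ _).trans ?_
        gcongr
        exact sqSum_comp_le' _ _
      have h2 := ENNReal.toReal_mono (ENNReal.pow_ne_top (ENNReal.mul_ne_top
        (ENNReal.mul_ne_top enorm_ne_top enorm_ne_top) enorm_ne_top)) (h1 (by
        refine (sqSum_comp_le _ _).trans_lt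
          (ENNReal.mul_lt_top (ENNReal.pow_lt_top enorm_lt_top) ?_)
        exact (sqSum_comp_le' _ _).trans_lt
          (ENNReal.mul_lt_top (ENNReal.pow_lt_top enorm_lt_top) (sqSum_toCLM_lt_top Q))))
      simp only [ENNReal.toReal_pow, ENNReal.toReal_mul, toReal_enorm] at h2
      exact h2)

@[simp] theorem toCLM_sandwich (A B : H →L[ℂ] H) (Q : HilbertSchmidt H) :
    toCLM H (sandwich A B Q) = A ∘L toCLM H Q ∘L B := rfl

@[simp] theorem sandwich_rankOne (A B : H →L[ℂ] H) (x y : H) :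
    sandwich A B (rankOne x y) = rankOne (ContinuousLinearMap.adjoint B x) (A y) := by
  apply toCLM_injective
  ext h
  simp [ContinuousLinearMap.adjoint_inner_left]

theorem isSymmetricProjection_sandwich {A B : H →L[ℂ] H}
    (hA : (A : H →ₗ[ℂ] H).IsSymmetricProjection) (hB : (B : H →ₗ[ℂ] H).IsSymmetricProjection) :
    (sandwich A B : HilbertSchmidt H →ₗ[ℂ] HilbertSchmidt H).IsSymmetricProjection := by
  refine ⟨?_, ?_⟩
  · ext Q
    apply toCLM_injective
    ext h
    simp [SymProj.apply_apply hA, SymProj.apply_apply hB]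
  · intro Q R
    have hB' : ContinuousLinearMap.adjoint B = B :=
      ContinuousLinearMap.isSelfAdjoint_iff_isSymmetric.2 hB.isSymmetric
    have : innerSL ℂ (sandwich A B Q) = (innerSL ℂ Q) ∘L (sandwich A B) := by
      refine ContinuousLinearMap.ext_on dense_span_rankOne ?_
      rintro _ ⟨⟨x, y⟩, rfl⟩
      simp [inner_rankOne, hB', SymProj.inner_comm hA]
    exact DFunLike.congr_fun this R

end HilbertSchmidt

/-! ### The product spectral measure -/

section Product

variable {α β : Type*} [MeasurableSpace α] [MeasurableSpace β]
  {H : Type u} [NormedAddCommGroup H] [InnerProductSpace ℂ H] [CompleteSpace H]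

open HilbertSchmidt

theorem SpectralMeasure.adjoint_proj (E : SpectralMeasure α H) {A : Set α}
    (hA : MeasurableSet A) : ContinuousLinearMap.adjoint (E.proj A) = E.proj A :=
  ContinuousLinearMap.isSelfAdjoint_iff_isSymmetric.2 (E.isSymmetricProjection A hA).isSymmetric

/-- The product spectral measure on the Hilbert–Schmidt class exists. -/
theorem exists_isProductSpectralMeasure (E₁ : SpectralMeasure α H) (E₂ : SpectralMeasure β H) :
    ∃ E : SpectralMeasure (α × β) (HilbertSchmidt H), IsProductSpectralMeasure E₁ E₂ E := by
  -- The sides of a rectangle are recovered as its coordinate images. For an empty rectangle this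
  -- loses a nonempty side, but then both expressions vanish.
  let P : Set (α × β) → HilbertSchmidt H →L[ℂ] HilbertSchmidt H := fun s =>
    sandwich (E₁.proj (Prod.fst '' s)) (E₂.proj (Prod.snd '' s))
  have hP : ∀ A B, P (A ×ˢ B) = sandwich (E₁.proj A) (E₂.proj B) := by
    intro A B
    rcases A.eq_empty_or_nonempty with rfl | hA
    · ext Q
      apply toCLM_injective
      ext h
      simp [P, E₁.proj_empty]
    rcases B.eq_empty_or_nonempty with rfl | hB
    · ext Q
      apply toCLM_injective
      ext h
      simp [P, E₁.proj_empty, E₂.proj_empty]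
    simp only [P]
    rw [Set.fst_image_prod _ hB, Set.snd_image_prod hA]
  obtain ⟨E, hE⟩ := ProjectionContent.exists_spectralMeasure (P := P)
    (isSetSemiring_rectangles (α := α) (β := β)) generateFrom_prod.symm
    ⟨Set.univ, MeasurableSet.univ, Set.univ, MeasurableSet.univ, Set.univ_prod_univ⟩
    (by
      rintro _ ⟨A, hA, B, hB, rfl⟩
      rw [hP]
      exact isSymmetricProjection_sandwich (E₁.isSymmetricProjection A hA)
        (E₂.isSymmetricProjection B hB))
    (by
      rintro _ ⟨A, hA, B, hB, rfl⟩ _ ⟨A', hA', B', hB', rfl⟩ Q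
      rw [Set.prod_inter_prod, hP, hP, hP]
      apply toCLM_injective
      ext h
      simp only [toCLM_sandwich, ContinuousLinearMap.comp_apply]
      rw [E₁.proj_inter hA hA', E₂.proj_inter hB' hB, Set.inter_comm B'])
    (by
      rw [← Set.univ_prod_univ, hP, E₁.proj_univ, E₂.proj_univ]
      ext Q
      apply toCLM_injective
      ext h
      simp)
    dense_span_rankOne
    (by
      rintro _ ⟨⟨x, y⟩, rfl⟩
      -- On a rank-one operator the quadratic form factors as `‖E₁(A) y‖² ‖E₂(B) x‖²`, so countable
      -- additivity comes from the product measure.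
      refine ⟨(E₁.scalarMeasure y).prod (E₂.scalarMeasure x), inferInstance, ?_⟩
      rintro _ ⟨A, hA, B, hB, rfl⟩
      rw [hP, sandwich_rankOne, E₂.adjoint_proj hB, norm_rankOne, measureReal_prod_prod,
        E₁.scalarMeasure_real y hA, E₂.scalarMeasure_real x hB]
      ring)
  refine ⟨E, fun A B hA hB Q => ?_⟩
  rw [hE _ ⟨A, hA, B, hB, rfl⟩, hP]
  rfl

end Product

/-! ### Schur multipliers of the trace class from factorizations -/

theorem sum_norm_isIntegral_sq_le {α : Type*} [MeasurableSpace α] {H : Type*}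
    [NormedAddCommGroup H] [InnerProductSpace ℂ H] {E : SpectralMeasure α H} {φ : ℕ → α → ℂ} {A : ℝ}
    (hφm : ∀ n, Measurable (φ n)) (hφ : ∀ N a, ∑ n ∈ Finset.range N, ‖φ n a‖ ^ 2 ≤ A)
    {C : ℝ} (hC : ∀ n a, ‖φ n a‖ ≤ C) {y : H} {a : ℕ → H} (ha : ∀ n, E.IsIntegral (φ n) y (a n))
    (N : ℕ) : ∑ n ∈ Finset.range N, ‖a n‖ ^ 2 ≤ A * ‖y‖ ^ 2 := by
  have hint : ∀ n, Integrable (fun s => ‖φ n s‖ ^ 2) (E.scalarMeasure y) := fun n => by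
    refine Integrable.of_bound (((hφm n).norm).pow_const 2).aestronglyMeasurable (C ^ 2)
      (Eventually.of_forall fun s => ?_)
    rw [norm_pow, norm_norm]
    have := hC n s
    gcongr
  simp only [(ha _).norm_sq (hC _)]
  rw [← integral_finsetSum _ fun n _ => hint n]
  -- The pointwise bound on `∑ |φₙ|²` is integrated against the scalar measure of `y`, whose total
  -- mass is `‖y‖²`.
  calc ∫ s, ∑ n ∈ Finset.range N, ‖φ n s‖ ^ 2 ∂E.scalarMeasure y
      ≤ ∫ _, A ∂E.scalarMeasure y :=
        integral_mono_of_nonneg (Eventually.of_forall fun s => Finset.sum_nonneg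
          fun _ _ => sq_nonneg _) (integrable_const _) (Eventually.of_forall fun s => hφ N s)
    _ = A * ‖y‖ ^ 2 := by
        rw [integral_const, measureReal_def, E.scalarMeasure_univ,
          ENNReal.toReal_ofReal (sq_nonneg _), smul_eq_mul, mul_comm]

section Tensor

variable {α β : Type*} [MeasurableSpace α] [MeasurableSpace β]
  {H : Type u} [NormedAddCommGroup H] [InnerProductSpace ℂ H] [CompleteSpace H]

open HilbertSchmidt ComplexConjugate

namespace HilbertSchmidt

theorem rankOne_sub_right (x y z : H) : rankOne x (y - z) = rankOne x y - rankOne x z := by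
  apply toCLM_injective; ext h; simp [smul_sub]

theorem rankOne_sub_left (x y z : H) : rankOne (x - y) z = rankOne x z - rankOne y z := by
  apply toCLM_injective; ext h; simp [sub_smul]

theorem rankOne_sum {ι κ : Type*} (s : Finset ι) (t : Finset κ) (c : ι → ℂ) (d : κ → ℂ)
    (x : κ → H) (y : ι → H) :
    rankOne (∑ j ∈ t, conj (d j) • x j) (∑ i ∈ s, c i • y i) =
      ∑ i ∈ s, ∑ j ∈ t, (c i * d j) • rankOne (x j) (y i) := by
  apply toCLM_injective
  ext h
  simp only [toCLM_rankOne, map_sum, map_smul, _root_.sum_apply, sum_inner, inner_smul_left,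
    Complex.conj_conj, Finset.smul_sum, smul_apply, smul_smul]
  refine Finset.sum_congr rfl fun i _ => ?_
  rw [Finset.sum_mul, Finset.sum_smul]
  refine Finset.sum_congr rfl fun j _ => ?_
  congr 1
  ring

theorem tendsto_rankOne {ι : Type*} {l : Filter ι} {x y : ι → H} {a b : H}
    (hx : Tendsto x l (𝓝 a)) (hy : Tendsto y l (𝓝 b)) :
    Tendsto (fun i => rankOne (x i) (y i)) l (𝓝 (rankOne a b)) := by
  rw [tendsto_iff_norm_sub_tendsto_zero]
  have h1 : ∀ i, ‖rankOne (x i) (y i) - rankOne a b‖ ≤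
      ‖x i - a‖ * ‖y i‖ + ‖a‖ * ‖y i - b‖ := fun i => by
    have : rankOne (x i) (y i) - rankOne a b =
        rankOne (x i - a) (y i) + rankOne a (y i - b) := by
      rw [rankOne_sub_left, rankOne_sub_right]; abel
    rw [this, ← norm_rankOne, ← norm_rankOne]
    exact norm_add_le _ _
  refine squeeze_zero (fun _ => norm_nonneg _) h1 ?_
  have h2 := ((tendsto_iff_norm_sub_tendsto_zero.1 hx).mul hy.norm).add
    ((tendsto_const_nhds (x := ‖a‖)).mul (tendsto_iff_norm_sub_tendsto_zero.1 hy))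
  simpa using h2

end HilbertSchmidt

/-- The simple function `(a, b) ↦ s(a) t(b)`. -/
def MeasureTheory.SimpleFunc.tensor (s : SimpleFunc α ℂ) (t : SimpleFunc β ℂ) :
    SimpleFunc (α × β) ℂ :=
  ((s.comp Prod.fst measurable_fst).pair (t.comp Prod.snd measurable_snd)).map
    fun p => p.1 * p.2

theorem MeasureTheory.SimpleFunc.tensor_apply (s : SimpleFunc α ℂ) (t : SimpleFunc β ℂ)
    (p : α × β) : s.tensor t p = s p.1 * t p.2 := rfl

/-- On rank-one operators the product integral decouples. The conjugate on `t` compensates for the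
antilinearity of `rankOne` in its first argument. -/
theorem simpleIntegral_tensor {E₁ : SpectralMeasure α H} {E₂ : SpectralMeasure β H}
    {E : SpectralMeasure (α × β) (HilbertSchmidt H)} (hE : IsProductSpectralMeasure E₁ E₂ E)
    (s : SimpleFunc α ℂ) (t : SimpleFunc β ℂ) (x y : H) :
    E.simpleIntegral (s.tensor (t.map conj)) (rankOne x y) =
      rankOne (E₂.simpleIntegral t x) (E₁.simpleIntegral s y) := by
  classical
  have hE' : ∀ A B, MeasurableSet A → MeasurableSet B →
      E.proj (A ×ˢ B) (rankOne x y) = rankOne (E₂.proj B x) (E₁.proj A y) := by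
    intro A B hA hB
    apply toCLM_injective
    rw [hE A B hA hB]
    ext h
    simp [SymProj.inner_comm (E₂.isSymmetricProjection B hB)]
  let p : SimpleFunc (α × β) (ℂ × ℂ) :=
    (s.comp Prod.fst measurable_fst).pair (t.comp Prod.snd measurable_snd)
  have hp : s.tensor (t.map conj) = p.map fun q => q.1 * conj q.2 := by
    ext q; rfl
  rw [hp, E.simpleIntegral_eq, SimpleFunc.map_setToSimpleFunc _ (E.vectorFun_additive _)
    integrable_zero_measure (by simp)]
  have hfib : ∀ c d, p ⁻¹' {(c, d)} = (s ⁻¹' {c}) ×ˢ (t ⁻¹' {d}) := by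
    intro c d
    ext q
    simp only [Set.mem_preimage, Set.mem_singleton_iff, Set.mem_prod]
    exact Prod.ext_iff
  have hsub : p.range ⊆ s.range ×ˢ t.range := by
    intro q hq
    obtain ⟨z, rfl⟩ := SimpleFunc.mem_range.1 hq
    exact Finset.mem_product.2 ⟨SimpleFunc.mem_range_self s z.1, SimpleFunc.mem_range_self t z.2⟩
  rw [Finset.sum_subset hsub]
  · rw [Finset.sum_product]
    have h1 : E₂.simpleIntegral t x =
        ∑ d ∈ t.range, conj (conj d) • E₂.proj (t ⁻¹' {d}) x := by
      simp [SpectralMeasure.simpleIntegral]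
    rw [h1, SpectralMeasure.simpleIntegral, rankOne_sum]
    refine Finset.sum_congr rfl fun c _ => Finset.sum_congr rfl fun d _ => ?_
    rw [hfib, ← hE' _ _ (s.measurableSet_fiber c) (t.measurableSet_fiber d)]
    rfl
  · intro q _ hq
    have : p ⁻¹' {q} = ∅ := by
      rw [Set.preimage_eq_empty_iff, Set.disjoint_singleton_left]
      intro h
      exact hq (SimpleFunc.mem_range.2 h)
    rw [this]
    simp [SpectralMeasure.vectorFun, E.proj_empty]

theorem isIntegral_tensor {E₁ : SpectralMeasure α H} {E₂ : SpectralMeasure β H}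
    {E : SpectralMeasure (α × β) (HilbertSchmidt H)} (hE : IsProductSpectralMeasure E₁ E₂ E)
    {f : α → ℂ} {g : β → ℂ} {C : ℝ} (hf : ∀ a, ‖f a‖ ≤ C) (hg : ∀ b, ‖g b‖ ≤ C) (hC : 0 ≤ C)
    {x y a b : H} (ha : E₁.IsIntegral f y a) (hb : E₂.IsIntegral (fun t => conj (g t)) x b) :
    E.IsIntegral (fun p => f p.1 * g p.2) (rankOne x y) (rankOne b a) := by
  obtain ⟨s, hs, hsa⟩ := ha
  obtain ⟨t, ht, htb⟩ := hb
  refine ⟨fun n => (s n).tensor ((t n).map conj), ?_, ?_⟩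
  · rw [Metric.tendstoUniformly_iff] at hs ht ⊢
    intro ε hε
    have hδ : 0 < min 1 (ε / (2 * C + 2)) := by positivity
    filter_upwards [hs _ hδ, ht _ hδ] with n h1 h2 p
    have h1 := h1 p.1
    have h2 := h2 p.2
    rw [dist_eq_norm] at *
    have h3 : ‖g p.2 - conj (t n p.2)‖ < min 1 (ε / (2 * C + 2)) := by
      rw [← RCLike.norm_conj, map_sub, Complex.conj_conj]
      exact h2
    rw [SimpleFunc.tensor_apply]
    change ‖f p.1 * g p.2 - s n p.1 * conj (t n p.2)‖ < ε
    have e : f p.1 * g p.2 - s n p.1 * conj (t n p.2) = (f p.1 - s n p.1) * g p.2 +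
        (f p.1 - (f p.1 - s n p.1)) * (g p.2 - conj (t n p.2)) := by ring
    rw [e]
    refine (norm_add_le _ _).trans_lt ?_
    rw [norm_mul, norm_mul]
    set δ := min 1 (ε / (2 * C + 2))
    have hδ1 : δ ≤ 1 := min_le_left _ _
    have hδ2 : δ * (2 * C + 2) ≤ ε := by
      rw [← le_div_iff₀ (by positivity)]; exact min_le_right _ _
    have h4 : ‖f p.1 - (f p.1 - s n p.1)‖ ≤ C + 1 := by
      refine (norm_sub_le _ _).trans (add_le_add (hf _) (h1.le.trans hδ1))
    have h5 : ‖f p.1 - s n p.1‖ * ‖g p.2‖ ≤ δ * C := by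
      have := hg p.2
      gcongr
    have h6 : ‖f p.1 - (f p.1 - s n p.1)‖ * ‖g p.2 - conj (t n p.2)‖ ≤ (C + 1) * δ := by
      gcongr
    nlinarith
  · simp only [simpleIntegral_tensor hE]
    exact tendsto_rankOne htb hsa

/-- A trace class series that converges strongly also converges in Hilbert–Schmidt norm, so bounded
transformers on the Hilbert–Schmidt class can be applied term by term. -/
theorem isTraceClass_hasSum_rankOne {Q : HilbertSchmidt H} {x y : ℕ → H}
    (hs : Summable fun n => ‖x n‖ * ‖y n‖)
    (h : ∀ h, HasSum (fun n => ⟪x n, h⟫_ℂ • y n) (toCLM H Q h)) :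
    HasSum (fun n => rankOne (x n) (y n)) Q := by
  have h1 : Summable fun n => rankOne (x n) (y n) := by
    refine Summable.of_norm ?_
    simpa only [norm_rankOne] using hs
  have h2 : ∑' n, rankOne (x n) (y n) = Q := by
    apply toCLM_injective
    ext z
    have h3 := (h1.hasSum.mapL toCLML).mapL (ContinuousLinearMap.apply ℂ H z)
    exact h3.unique (h z)
  rw [← h2]
  exact h1.hasSum

/-- Functions that factor as `∑ₙ φₙ ⊗ ψₙ` with `∑ |φₙ|²` and `∑ |ψₙ|²` bounded are Schur
multipliers. -/
theorem isSchurMultiplier_of_hasSum (E₁ : SpectralMeasure α H) (E₂ : SpectralMeasure β H)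
    {Φ : α × β → ℂ} {φ : ℕ → α → ℂ} {ψ : ℕ → β → ℂ} {A B : ℝ}
    (hφm : ∀ n, Measurable (φ n)) (hψm : ∀ n, Measurable (ψ n))
    (hφ : ∀ N a, ∑ n ∈ Finset.range N, ‖φ n a‖ ^ 2 ≤ A)
    (hψ : ∀ N b, ∑ n ∈ Finset.range N, ‖ψ n b‖ ^ 2 ≤ B) (hA : 0 ≤ A) (hB : 0 ≤ B)
    (hΦ : ∀ a b, HasSum (fun n => φ n a * ψ n b) (Φ (a, b))) :
    IsSchurMultiplier E₁ E₂ Φ := by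
  -- From `2 r ≤ 1 + r²`; the crude constant is chosen symmetric in `A` and `B` so that one bound
  -- serves both families.
  have hφC : ∀ n a, ‖φ n a‖ ≤ 1 + A + B := fun n a => by
    have h1 := hφ (n + 1) a
    rw [Finset.sum_range_succ] at h1
    have h2 : 0 ≤ ∑ n ∈ Finset.range n, ‖φ n a‖ ^ 2 := Finset.sum_nonneg fun _ _ => sq_nonneg _
    nlinarith [sq_nonneg (‖φ n a‖ - 1), norm_nonneg (φ n a)]
  have hψC : ∀ n a, ‖ψ n a‖ ≤ 1 + A + B := fun n a => by
    have h1 := hψ (n + 1) a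
    rw [Finset.sum_range_succ] at h1
    have h2 : 0 ≤ ∑ n ∈ Finset.range n, ‖ψ n a‖ ^ 2 := Finset.sum_nonneg fun _ _ => sq_nonneg _
    nlinarith [sq_nonneg (‖ψ n a‖ - 1), norm_nonneg (ψ n a)]
  let S : ℕ → α × β → ℂ := fun N p => ∑ n ∈ Finset.range N, φ n p.1 * ψ n p.2
  have hSm : ∀ N, Measurable (S N) := fun N => Finset.measurable_fun_sum _ fun n _ =>
    ((hφm n).comp measurable_fst).mul ((hψm n).comp measurable_snd)
  have hSC : ∀ N p, ‖S N p‖ ≤ A + B := fun N p => by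
    refine (norm_sum_le _ _).trans ?_
    refine le_trans ?_ (add_le_add (hφ N p.1) (hψ N p.2))
    rw [← Finset.sum_add_distrib]
    refine Finset.sum_le_sum fun n _ => ?_
    rw [norm_mul]
    nlinarith [sq_nonneg (‖φ n p.1‖ - ‖ψ n p.2‖), sq_nonneg ‖φ n p.1‖, sq_nonneg ‖ψ n p.2‖]
  have hSlim : ∀ p, Tendsto (fun N => S N p) atTop (𝓝 (Φ p)) := fun p =>
    (hΦ p.1 p.2).tendsto_sum_nat
  have hΦm : Measurable Φ := measurable_of_tendsto_metrizable hSm (tendsto_pi_nhds.2 hSlim)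
  have hΦC : ∀ p, ‖Φ p‖ ≤ A + B := fun p =>
    le_of_tendsto (hSlim p).norm (Eventually.of_forall fun N => hSC N p)
  refine ⟨⟨hΦm, A + B, hΦC⟩, fun Q hQ => ?_⟩
  obtain ⟨E, hE⟩ := exists_isProductSpectralMeasure E₁ E₂
  obtain ⟨L, hL⟩ := E.exists_integralCLM hΦm hΦC
  refine ⟨L Q, ⟨E, hE, hL Q⟩, ?_⟩
  choose F hF using fun n => E₁.exists_integralCLM (hφm n) (hφC n)
  choose G hG using fun n => E₂.exists_integralCLM (f := fun t => conj (ψ n t))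
    (Complex.continuous_conj.measurable.comp (hψm n))
    (fun b => by rw [RCLike.norm_conj]; exact hψC n b)
  obtain ⟨x, y, hxy, hsum⟩ := hQ
  have hQsum := isTraceClass_hasSum_rankOne hxy hsum
  have hFs : ∀ (N : ℕ) (z : H), ∑ n ∈ Finset.range N, ‖F n z‖ ^ 2 ≤ A * ‖z‖ ^ 2 := fun N z =>
    sum_norm_isIntegral_sq_le hφm hφ hφC (fun n => hF n z) N
  have hGs : ∀ (N : ℕ) (z : H), ∑ n ∈ Finset.range N, ‖G n z‖ ^ 2 ≤ B * ‖z‖ ^ 2 := fun N z =>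
    sum_norm_isIntegral_sq_le (φ := fun n t => conj (ψ n t))
      (fun n => Complex.continuous_conj.measurable.comp (hψm n))
      (fun N b => by simpa only [RCLike.norm_conj] using hψ N b)
      (fun n b => by rw [RCLike.norm_conj]; exact hψC n b) (fun n => hG n z) N
  -- The partial sums converge boundedly and pointwise to `Φ`, so their integrals, which are finite
  -- sums of rank-one operators, converge to the integral of `Φ`.
  have hone : ∀ x y : H, Tendsto (fun N => ∑ n ∈ Finset.range N, rankOne (G n x) (F n y)) atTop
      (𝓝 (L (rankOne x y))) := by
    intro x y
    refine SpectralMeasure.IsIntegral.tendsto (E := E) (f := S) (x := rankOne x y) (fun N => ?_)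
      (hL _) hSm hΦm hSC hΦC hSlim
    induction N with
    | zero =>
      have h0 := SpectralMeasure.isIntegral_simpleFunc (E := E) 0 (rankOne x y)
      have h1 := E.simpleIntegral_sub 0 0 (rankOne x y)
      simp only [sub_self] at h1
      rw [h1] at h0
      exact h0
    | succ N ih =>
      have h1 := ih.add (isIntegral_tensor hE (hφC N) (hψC N) (by positivity) (hF N y) (hG N x))
      rw [Finset.sum_range_succ]
      convert h1 using 1
      funext p
      simp only [S, Finset.sum_range_succ, Pi.add_apply]
  -- Cauchy–Schwarz in `n` bounds the trace norm of the transform of a rank-one operator. The bound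
  -- is proportional to `‖x‖ ‖y‖` and can therefore be summed over the terms of `Q`.
  have hbd : ∀ (N : ℕ) (x y : H), ∑ n ∈ Finset.range N, ‖G n x‖ * ‖F n y‖ ≤
      √B * √A * (‖x‖ * ‖y‖) := fun N x y => by
    refine (Real.sum_mul_le_sqrt_mul_sqrt _ _ _).trans ?_
    calc √(∑ n ∈ Finset.range N, ‖G n x‖ ^ 2) * √(∑ n ∈ Finset.range N, ‖F n y‖ ^ 2)
        ≤ √(B * ‖x‖ ^ 2) * √(A * ‖y‖ ^ 2) := by
          gcongr
          exacts [hGs N x, hFs N y]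
      _ = √B * √A * (‖x‖ * ‖y‖) := by
          rw [Real.sqrt_mul hB, Real.sqrt_mul hA, Real.sqrt_sq (norm_nonneg _),
            Real.sqrt_sq (norm_nonneg _)]
          ring
  have hsk : ∀ k, Summable fun n => ‖G n (x k)‖ * ‖F n (y k)‖ := fun k =>
    summable_of_sum_range_le (fun _ => by positivity) fun N => hbd N (x k) (y k)
  have hprod : Summable fun p : ℕ × ℕ => ‖G p.2 (x p.1)‖ * ‖F p.2 (y p.1)‖ := by
    rw [summable_prod_of_nonneg (fun _ => by positivity)]
    refine ⟨hsk, ?_⟩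
    refine Summable.of_nonneg_of_le (fun k => tsum_nonneg fun _ => by positivity) (fun k => ?_)
      (hxy.mul_left (√B * √A))
    exact Real.tsum_le_of_sum_range_le (fun _ => by positivity) fun N => hbd N (x k) (y k)
  have hprod' : Summable fun p : ℕ × ℕ => rankOne (G p.2 (x p.1)) (F p.2 (y p.1)) := by
    refine Summable.of_norm ?_
    simpa only [norm_rankOne] using hprod
  have hT : HasSum (fun p : ℕ × ℕ => rankOne (G p.2 (x p.1)) (F p.2 (y p.1))) (L Q) := by
    have h1 : ∀ k, HasSum (fun n => rankOne (G n (x k)) (F n (y k))) (L (rankOne (x k) (y k))) := by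
      intro k
      have h2 : Summable fun n => rankOne (G n (x k)) (F n (y k)) := by
        refine Summable.of_norm ?_
        simpa only [norm_rankOne] using hsk k
      have h3 := tendsto_nhds_unique h2.hasSum.tendsto_sum_nat (hone (x k) (y k))
      rw [← h3]
      exact h2.hasSum
    have h4 := hprod'.hasSum.prod_fiberwise h1
    rw [h4.unique (hQsum.mapL L) |>.symm]
    exact hprod'.hasSum
  -- `IsTraceClass` asks for a single sequence, so the double series is enumerated.
  let e : ℕ ≃ ℕ × ℕ := Nat.pairEquiv.symm
  refine ⟨fun m => G (e m).2 (x (e m).1), fun m => F (e m).2 (y (e m).1), ?_, fun h => ?_⟩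
  · exact (e.summable_iff (f := fun p : ℕ × ℕ => ‖G p.2 (x p.1)‖ * ‖F p.2 (y p.1)‖)).2 hprod
  · have h1 := (((e.hasSum_iff (f := fun p : ℕ × ℕ =>
      rankOne (G p.2 (x p.1)) (F p.2 (y p.1)))).2 hT).mapL toCLML).mapL
      (ContinuousLinearMap.apply ℂ H h)
    exact h1

end Tensor

/-! ### Operators on `ℓ²` -/

/-- The Hilbert space `ℓ²(ι)`. -/
abbrev Ell2 (ι : Type*) : Type _ := lp (fun _ : ι => ℂ) 2

namespace Ell2

variable {ι : Type*}

theorem hasSum_norm_sq (f : Ell2 ι) : HasSum (fun i => ‖f i‖ ^ 2) (‖f‖ ^ 2) := by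
  have h := lp.hasSum_norm (p := 2) (by norm_num) f
  simpa using h

theorem sum_norm_sq_le (f : Ell2 ι) (s : Finset ι) : ∑ i ∈ s, ‖f i‖ ^ 2 ≤ ‖f‖ ^ 2 :=
  sum_le_hasSum s (fun _ _ => sq_nonneg _) (hasSum_norm_sq f)

theorem norm_sq_le {f : Ell2 ι} {C : ℝ} (h : ∀ s : Finset ι, ∑ i ∈ s, ‖f i‖ ^ 2 ≤ C) :
    ‖f‖ ^ 2 ≤ C :=
  le_of_tendsto (hasSum_norm_sq f) (Eventually.of_forall h)

/-- Multiplication by a bounded function. -/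
def mulCLM (m : ι → ℂ) {C : ℝ} (hm : ∀ i, ‖m i‖ ≤ C) : Ell2 ι →L[ℂ] Ell2 ι :=
  have key : ∀ (f : Ell2 ι) i, ‖m i * f i‖ ^ 2 ≤ C ^ 2 * ‖f i‖ ^ 2 := fun f i => by
    rw [norm_mul, mul_pow]
    have := hm i
    gcongr
  LinearMap.mkContinuous
    { toFun := fun f => ⟨fun i => m i * f i, by
        refine (memℓp_gen_iff (by norm_num)).2 ?_
        simp only [ENNReal.toReal_ofNat, Real.rpow_ofNat]
        exact Summable.of_nonneg_of_le (fun _ => sq_nonneg _) (key f)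
          ((hasSum_norm_sq f).summable.mul_left _)⟩
      map_add' := fun f g => by
        ext i
        exact mul_add _ _ _
      map_smul' := fun c f => by
        ext i
        exact mul_left_comm _ _ _ } |C| fun f => by
      refine le_of_sq_le_sq ?_ (by positivity)
      refine norm_sq_le fun s => ?_
      calc ∑ i ∈ s, ‖m i * f i‖ ^ 2 ≤ ∑ i ∈ s, C ^ 2 * ‖f i‖ ^ 2 :=
            Finset.sum_le_sum fun i _ => key f i
        _ ≤ (|C| * ‖f‖) ^ 2 := by
            rw [← Finset.mul_sum, mul_pow, sq_abs]
            gcongr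
            exact sum_norm_sq_le f s

@[simp] theorem mulCLM_apply (m : ι → ℂ) {C : ℝ} (hm : ∀ i, ‖m i‖ ≤ C) (f : Ell2 ι) (i : ι) :
    mulCLM m hm f i = m i * f i := rfl

theorem eval_continuous (i : ι) : Continuous fun f : Ell2 ι => f i :=
  (lp.lipschitzWith_one_eval 2 i).continuous

theorem hasSum_eval {κ : Type*} {f : κ → Ell2 ι} {g : Ell2 ι} (h : HasSum f g) (i : ι) :
    HasSum (fun k => f k i) (g i) := by
  have := h.map (lp.evalₗ (𝕜 := ℂ) (fun _ : ι => ℂ) 2 i) (eval_continuous i)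
  exact this

theorem inner_eq_hasSum (f g : Ell2 ι) :
    HasSum (fun i => ⟪f i, g i⟫_ℂ) ⟪f, g⟫_ℂ := lp.hasSum_inner f g

open scoped Classical in
/-- The spectral measure of multiplication by a real function. -/
def spectralMeasure {α : Type*} [MeasurableSpace α] (π : ι → α) : SpectralMeasure α (Ell2 ι) :=
  have hm : ∀ (A : Set α) i, ‖(if π i ∈ A then 1 else 0 : ℂ)‖ ≤ 1 := fun A i => by
    split_ifs <;> simp
  have hproj : ∀ A : Set α, (mulCLM (fun i => if π i ∈ A then (1 : ℂ) else 0) (hm A) :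
      Ell2 ι →ₗ[ℂ] Ell2 ι).IsSymmetricProjection := fun A => by
    refine ⟨?_, fun f g => ?_⟩
    · ext f i
      change (if π i ∈ A then (1 : ℂ) else 0) * ((if π i ∈ A then (1 : ℂ) else 0) * f i) =
        (if π i ∈ A then (1 : ℂ) else 0) * f i
      split_ifs <;> simp
    · refine (inner_eq_hasSum _ _).unique ?_
      convert inner_eq_hasSum f _ using 2 with i
      simp only [ContinuousLinearMap.coe_coe, mulCLM_apply]
      split_ifs <;> simp
  { proj := fun A => mulCLM (fun i => if π i ∈ A then (1 : ℂ) else 0) (hm A)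
    isSymmetricProjection := fun A _ => hproj A
    proj_univ := by
      ext f i
      simp
    hasSum_iUnion := fun A _ hd f => by
      have horth : ∀ n k, n ≠ k → ∀ f : Ell2 ι,
          mulCLM (fun i => if π i ∈ A n then (1 : ℂ) else 0) (hm _)
            (mulCLM (fun i => if π i ∈ A k then (1 : ℂ) else 0) (hm _) f) = 0 := by
        intro n k hnk f
        ext i
        simp only [mulCLM_apply, lp.coeFn_zero, Pi.zero_apply]
        split_ifs with h1 h2
        · exact absurd h2 (Set.disjoint_left.1 (hd hnk) h1)
        all_goals simp
      obtain ⟨S, _, hS, _⟩ := SymProj.exists_hasSum (fun n => hproj (A n)) horth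
      have : S f = mulCLM (fun i => if π i ∈ ⋃ n, A n then (1 : ℂ) else 0) (hm _) f := by
        ext i
        refine (hasSum_eval (hS f) i).unique ?_
        simp only [mulCLM_apply]
        by_cases h : π i ∈ ⋃ n, A n
        · obtain ⟨n, hn⟩ := Set.mem_iUnion.1 h
          rw [if_pos h]
          have h1 := hasSum_single (f := fun k => (if π i ∈ A k then (1 : ℂ) else 0) * f i) n
            fun k hk => by
              have : π i ∉ A k := fun h' => Set.disjoint_left.1 (hd hk) h' hn
              rw [if_neg this, zero_mul]
          rw [if_pos hn] at h1
          exact h1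
        · rw [if_neg h, zero_mul]
          have : ∀ k, π i ∉ A k := fun k hk => h (Set.mem_iUnion.2 ⟨k, hk⟩)
          simp [this, hasSum_zero]
      rw [← this]
      exact hS f }

open scoped Classical in
theorem spectralMeasure_proj_apply {α : Type*} [MeasurableSpace α] (π : ι → α) (A : Set α)
    (f : Ell2 ι) (i : ι) :
    (spectralMeasure π).proj A f i = (if π i ∈ A then 1 else 0) * f i := rfl

open scoped Classical in
/-- The vector of the standard basis. -/
def δ (i : ι) : Ell2 ι := lp.single 2 i (1 : ℂ)

theorem inner_δ (i : ι) (f : Ell2 ι) : ⟪δ i, f⟫_ℂ = f i := by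
  classical
  rw [δ, lp.inner_single_left]
  simp

theorem δ_apply_self (i : ι) : δ i i = 1 := by
  classical
  exact lp.single_apply_self _ _ _

theorem δ_apply_ne {i j : ι} (h : j ≠ i) : δ i j = 0 := by
  classical
  exact lp.single_apply_ne _ _ _ h

theorem spectralMeasure_proj_δ {α : Type*} [MeasurableSpace α] (π : ι → α) (i : ι) :
    (spectralMeasure π).proj {π i} (δ i) = δ i := by
  ext j
  rw [spectralMeasure_proj_apply]
  by_cases h : j = i
  · simp [h]
  · rw [δ_apply_ne h, mul_zero]

theorem norm_sum_δ_sq (s : Finset ι) (c : ι → ℂ) :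
    ‖∑ i ∈ s, c i • δ i‖ ^ 2 = ∑ i ∈ s, ‖c i‖ ^ 2 := by
  classical
  have h := lp.norm_sum_single (p := 2) (E := fun _ : ι => ℂ) (by norm_num) c s
  have h2 : ∀ i, lp.single 2 i (c i) = c i • (δ i : Ell2 ι) := fun i => by
    rw [δ, ← lp.single_smul, smul_eq_mul, mul_one]
  simpa [h2] using h

theorem sum_δ_apply (s : Finset ι) (c : ι → ℂ) {i : ι} (hi : i ∈ s) :
    (∑ i ∈ s, c i • δ i : Ell2 ι) i = c i := by
  rw [← inner_δ, inner_sum, Finset.sum_eq_single i]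
  · rw [inner_δ]; simp [δ_apply_self]
  · intro j _ hj
    rw [inner_δ]; simp [δ_apply_ne hj.symm]
  · exact fun h => absurd hi h

theorem sum_δ_apply_notMem (s : Finset ι) (c : ι → ℂ) {i : ι} (hi : i ∉ s) :
    (∑ i ∈ s, c i • δ i : Ell2 ι) i = 0 := by
  rw [← inner_δ, inner_sum]
  refine Finset.sum_eq_zero fun j hj => ?_
  have : i ≠ j := fun h => hi (h ▸ hj)
  rw [inner_δ]; simp [δ_apply_ne this]

end Ell2

/-! ### Finite Schur bounds -/

/-- `C` bounds Schur multiplication by all finite submatrices of `Φ`. -/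
def FiniteSchurBound {S T : Type*} (Φ : S × T → ℂ) (C : ℝ) : Prop :=
  ∀ (F : Finset S) (G : Finset T) (b : S → T → ℂ),
    (∀ (ξ : S → ℂ) (η : T → ℂ), ‖∑ s ∈ F, ∑ t ∈ G, b s t * (ξ s * η t)‖ ≤
      √(∑ s ∈ F, ‖ξ s‖ ^ 2) * √(∑ t ∈ G, ‖η t‖ ^ 2)) →
    ∀ (ξ : S → ℂ) (η : T → ℂ), ‖∑ s ∈ F, ∑ t ∈ G, b s t * (Φ (s, t) * (ξ s * η t))‖ ≤
      C * (√(∑ s ∈ F, ‖ξ s‖ ^ 2) * √(∑ t ∈ G, ‖η t‖ ^ 2))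

open Ell2 ComplexConjugate in
-- A matrix `b` with contractive bilinear form on `F × G` is extended by zero to a contraction of
-- `ℓ²`. The bilinear form of its Schur product with `Φ` is then an inner product with finitely
-- supported vectors.
theorem IsSchurBound.finiteSchurBound {S T : Type*} {Φ : S × T → ℂ} {C : ℝ≥0}
    (h : IsSchurBound Φ C) : FiniteSchurBound Φ C := by
  classical
  intro F G b hb ξ η
  let L : Ell2 T →L[ℂ] Ell2 S :=
    ∑ s ∈ F, ∑ t ∈ G, (innerSL ℂ (δ t : Ell2 T)).smulRight (b s t • (δ s : Ell2 S))
  have hL : ∀ (g : Ell2 S) (f : Ell2 T), ⟪g, L f⟫_ℂ =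
      ∑ s ∈ F, ∑ t ∈ G, b s t * (conj (g s) * f t) := fun g f => by
    simp only [L, _root_.sum_apply, ContinuousLinearMap.smulRight_apply, innerSL_apply_apply,
      inner_δ, inner_sum, inner_smul_right]
    refine Finset.sum_congr rfl fun s _ => Finset.sum_congr rfl fun t _ => ?_
    rw [← inner_conj_symm, inner_δ]
    ring
  have hL1 : ‖L‖ ≤ 1 := by
    refine ContinuousLinearMap.opNorm_le_bound _ zero_le_one fun f => ?_
    have h1 : ‖⟪L f, L f⟫_ℂ‖ ≤ ‖L f‖ * ‖f‖ := by
      rw [hL]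
      refine (hb (fun s => conj (L f s)) f).trans ?_
      simp only [RCLike.norm_conj]
      gcongr
      · exact Real.sqrt_le_iff.2 ⟨norm_nonneg _, sum_norm_sq_le _ _⟩
      · exact Real.sqrt_le_iff.2 ⟨norm_nonneg _, sum_norm_sq_le _ _⟩
    rw [inner_self_eq_norm_sq_to_K] at h1
    simp only [norm_pow, Complex.coe_algebraMap, Complex.norm_real, norm_norm] at h1
    rcases eq_or_lt_of_le (norm_nonneg (L f)) with h0 | h0
    · rw [← h0]; positivity
    · nlinarith
  obtain ⟨L', hL', hn⟩ := h (fun p => L (δ p.2) p.1) L fun s t => rfl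
  have hent : ∀ s ∈ F, ∀ t ∈ G, ⟪δ s, L' (δ t)⟫_ℂ = Φ (s, t) * b s t := by
    intro s hs t ht
    rw [inner_δ]
    refine (hL' s t).trans ?_
    change Φ (s, t) * (L (δ t) : Ell2 S) s = _
    congr 1
    rw [← inner_δ, hL, Finset.sum_eq_single s, Finset.sum_eq_single t]
    · simp [δ_apply_self]
    · intro t' _ ht'
      rw [δ_apply_ne ht']; simp
    · exact fun h => absurd ht h
    · intro s' _ hs'
      rw [δ_apply_ne hs']; simp
    · exact fun h => absurd hs h
  have hsum : ⟪∑ s ∈ F, conj (ξ s) • (δ s : Ell2 S), L' (∑ t ∈ G, η t • (δ t : Ell2 T))⟫_ℂ =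
      ∑ s ∈ F, ∑ t ∈ G, b s t * (Φ (s, t) * (ξ s * η t)) := by
    simp only [map_sum, sum_inner, inner_sum, map_smul, inner_smul_left, inner_smul_right,
      Complex.conj_conj, Finset.mul_sum]
    rw [Finset.sum_comm]
    refine Finset.sum_congr rfl fun s hs => Finset.sum_congr rfl fun t ht => ?_
    rw [hent s hs t ht]
    ring
  rw [← hsum]
  refine (norm_inner_le_norm _ _).trans ?_
  have h1 : ‖∑ s ∈ F, conj (ξ s) • (δ s : Ell2 S)‖ = √(∑ s ∈ F, ‖ξ s‖ ^ 2) := by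
    rw [← Real.sqrt_sq (norm_nonneg (∑ s ∈ F, conj (ξ s) • (δ s : Ell2 S))), norm_sum_δ_sq]
    simp only [RCLike.norm_conj]
  have h2 : ‖∑ t ∈ G, η t • (δ t : Ell2 T)‖ = √(∑ t ∈ G, ‖η t‖ ^ 2) := by
    rw [← Real.sqrt_sq (norm_nonneg (∑ t ∈ G, η t • (δ t : Ell2 T))), norm_sum_δ_sq]
  rw [h1, mul_left_comm]
  gcongr
  refine (L'.le_opNorm _).trans ?_
  rw [h2]
  gcongr
  refine hn.trans ?_
  nlinarith [C.2]

open Ell2 in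
/-- Functions that factor as `∑ₙ φₙ ⊗ ψₙ` are discrete Schur multipliers. -/
theorem isSchurBound_of_hasSum {S T : Type*} {Φ : S × T → ℂ} {φ : ℕ → S → ℂ} {ψ : ℕ → T → ℂ}
    {A B : ℝ} (hφ : ∀ (I : Finset ℕ) s, ∑ n ∈ I, ‖φ n s‖ ^ 2 ≤ A)
    (hψ : ∀ (I : Finset ℕ) t, ∑ n ∈ I, ‖ψ n t‖ ^ 2 ≤ B) (hA : 0 ≤ A) (hB : 0 ≤ B)
    (hΦ : ∀ s t, HasSum (fun n => φ n s * ψ n t) (Φ (s, t))) :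
    IsSchurBound Φ (Real.toNNReal (√A * √B)) := by
  classical
  intro a L hLa
  have hφC : ∀ n s, ‖φ n s‖ ≤ √A := fun n s => Real.le_sqrt_of_sq_le (by simpa using hφ {n} s)
  have hψC : ∀ n t, ‖ψ n t‖ ≤ √B := fun n t => Real.le_sqrt_of_sq_le (by simpa using hψ {n} t)
  -- Entrywise multiplication by `φₙ ⊗ ψₙ` is `M_φₙ L M_ψₙ`. The family `M_ψₙ` acts as a column of
  -- norm at most `√B` and `M_φₙ` as a row of norm at most `√A`, which gives strong convergence and
  -- the bound together.
  let X : ℕ → Ell2 T →L[ℂ] Ell2 S := fun n =>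
    mulCLM (φ n) (hφC n) ∘L L ∘L mulCLM (ψ n) (hψC n)
  have hψsum : ∀ (I : Finset ℕ) (f : Ell2 T),
      ∑ n ∈ I, ‖mulCLM (ψ n) (hψC n) f‖ ^ 2 ≤ B * ‖f‖ ^ 2 := fun I f => by
    refine hasSum_le (fun t => ?_) (hasSum_sum fun n _ => hasSum_norm_sq (mulCLM (ψ n) (hψC n) f))
      ((hasSum_norm_sq f).mul_left B)
    simp only [mulCLM_apply, norm_mul, mul_pow]
    rw [← Finset.sum_mul]
    have := hψ I t
    gcongr
  have hX : ∀ (I : Finset ℕ) (f : Ell2 T), ‖∑ n ∈ I, X n f‖ ^ 2 ≤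
      A * ‖L‖ ^ 2 * ∑ n ∈ I, ‖mulCLM (ψ n) (hψC n) f‖ ^ 2 := fun I f => by
    have h1 : ‖∑ n ∈ I, X n f‖ ^ 2 ≤ A * ∑ n ∈ I, ‖L (mulCLM (ψ n) (hψC n) f)‖ ^ 2 := by
      refine hasSum_le (fun s => ?_) (hasSum_norm_sq _)
        ((hasSum_sum fun n _ => hasSum_norm_sq (L (mulCLM (ψ n) (hψC n) f))).mul_left A)
      have e : (∑ n ∈ I, X n f) s = ∑ n ∈ I, φ n s * L (mulCLM (ψ n) (hψC n) f) s := by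
        rw [lp.coeFn_sum, Finset.sum_apply]
        rfl
      rw [e]
      have h2 := Finset.sum_mul_sq_le_sq_mul_sq I (fun n => ‖φ n s‖)
        (fun n => ‖L (mulCLM (ψ n) (hψC n) f) s‖)
      have h3 : ‖∑ n ∈ I, φ n s * L (mulCLM (ψ n) (hψC n) f) s‖ ≤
          ∑ n ∈ I, ‖φ n s‖ * ‖L (mulCLM (ψ n) (hψC n) f) s‖ := by
        refine (norm_sum_le _ _).trans_eq ?_
        simp only [norm_mul]
      refine (pow_le_pow_left₀ (norm_nonneg _) h3 2).trans (h2.trans ?_)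
      have := hφ I s
      gcongr
    refine h1.trans ?_
    rw [mul_assoc]
    gcongr
    rw [Finset.mul_sum]
    refine Finset.sum_le_sum fun n _ => ?_
    rw [← mul_pow]
    gcongr
    exact L.le_opNorm _
  have hsummable : ∀ f, Summable fun n => X n f := by
    intro f
    have hs : Summable fun n => A * ‖L‖ ^ 2 * ‖mulCLM (ψ n) (hψC n) f‖ ^ 2 :=
      (summable_of_sum_le (fun _ => sq_nonneg _) fun I => hψsum I f).mul_left _
    rw [summable_iff_vanishing_norm] at hs ⊢
    intro ε hε
    obtain ⟨s, hs⟩ := hs (ε ^ 2) (by positivity)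
    refine ⟨s, fun t ht => ?_⟩
    have h1 := hs t ht
    rw [← Finset.mul_sum] at h1
    exact lt_of_pow_lt_pow_left₀ 2 hε.le
      ((hX t f).trans_lt ((Real.le_norm_self _).trans_lt h1))
  have hbd : ∀ f, ‖∑' n, X n f‖ ≤ √A * √B * ‖L‖ * ‖f‖ := fun f => by
    refine le_of_tendsto (hsummable f).hasSum.norm (Eventually.of_forall fun I => ?_)
    refine le_of_sq_le_sq ((hX I f).trans ?_) (by positivity)
    calc A * ‖L‖ ^ 2 * ∑ n ∈ I, ‖mulCLM (ψ n) (hψC n) f‖ ^ 2 ≤ A * ‖L‖ ^ 2 * (B * ‖f‖ ^ 2) := by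
          gcongr
          exact hψsum I f
      _ = (√A * √B * ‖L‖ * ‖f‖) ^ 2 := by
          rw [mul_pow, mul_pow, mul_pow, Real.sq_sqrt hA, Real.sq_sqrt hB]
          ring
  let L₀ : Ell2 T →ₗ[ℂ] Ell2 S :=
    { toFun := fun f => ∑' n, X n f
      map_add' := fun f g => by
        simp only [map_add]
        exact (hsummable f).tsum_add (hsummable g)
      map_smul' := fun c f => by
        simp only [map_smul, RingHom.id_apply]
        exact (hsummable f).tsum_const_smul c }
  refine ⟨L₀.mkContinuous _ hbd, fun s t => ?_, ?_⟩
  · refine (hasSum_eval (hsummable (δ t)).hasSum s).unique ?_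
    have h1 : ∀ n, X n (δ t) s = φ n s * ψ n t * a (s, t) := fun n => by
      have h2 : mulCLM (ψ n) (hψC n) (δ t) = ψ n t • (δ t : Ell2 T) := by
        ext t'
        by_cases h : t' = t
        · subst h; rfl
        · rw [mulCLM_apply, δ_apply_ne h]
          simp [δ_apply_ne h]
      simp only [X, ContinuousLinearMap.comp_apply, mulCLM_apply]
      rw [h2, map_smul, ← hLa s t, mul_assoc]
      rfl
    simp only [h1]
    exact (hΦ s t).mul_right _
  · rw [Real.coe_toNNReal _ (by positivity)]
    exact LinearMap.mkContinuous_norm_le _ (by positivity) _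

/-! ### Borel Schur multipliers have finite Schur bounds -/

section BorelMultipliers

open HilbertSchmidt Ell2 ComplexConjugate

/-- Vectors carried by atoms see only the value of `Φ` at the corresponding point. The argument
works for whichever product spectral measure `E` witnesses the integral, so its uniqueness is not
needed. -/
theorem IsDoubleOperatorIntegral.inner_eq {α β : Type*} [MeasurableSpace α] [MeasurableSpace β]
    [MeasurableSingletonClass α] [MeasurableSingletonClass β]
    {H : Type u} [NormedAddCommGroup H] [InnerProductSpace ℂ H] [CompleteSpace H]
    {E₁ : SpectralMeasure α H} {E₂ : SpectralMeasure β H} {Φ : α × β → ℂ} {Q T : HilbertSchmidt H}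
    (h : IsDoubleOperatorIntegral E₁ E₂ Φ Q T) {s : α} {t : β} {e f : H}
    (he : E₁.proj {s} e = e) (hf : E₂.proj {t} f = f) :
    ⟪e, toCLM H T f⟫_ℂ = Φ (s, t) * ⟪e, toCLM H Q f⟫_ℂ := by
  obtain ⟨E, hE, hT⟩ := h
  have hs := measurableSet_singleton s
  have ht := measurableSet_singleton t
  have key : ∀ R : HilbertSchmidt H,
      ⟪e, toCLM H (E.proj {(s, t)} R) f⟫_ℂ = ⟪e, toCLM H R f⟫_ℂ := fun R => by
    rw [← Set.singleton_prod_singleton, hE _ _ hs ht]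
    simp only [ContinuousLinearMap.comp_apply]
    rw [hf, ← SymProj.inner_comm (E₁.isSymmetricProjection _ hs), he]
  rw [← key T, ← key Q, hT.proj_singleton (measurableSet_singleton _), map_smul, smul_apply,
    inner_smul_right]

/-- Failure of all finite Schur bounds is witnessed by nonzero vectors. -/
theorem exists_of_not_finiteSchurBound {S T : Type*} {Φ : S × T → ℂ} {C : ℝ}
    (h : ¬ FiniteSchurBound Φ C) : ∃ (F : Finset S) (G : Finset T) (b : S → T → ℂ),
    (∀ (ξ : S → ℂ) (η : T → ℂ), ‖∑ s ∈ F, ∑ t ∈ G, b s t * (ξ s * η t)‖ ≤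
      √(∑ s ∈ F, ‖ξ s‖ ^ 2) * √(∑ t ∈ G, ‖η t‖ ^ 2)) ∧
    ∃ (ξ : S → ℂ) (η : T → ℂ), ∑ s ∈ F, ‖ξ s‖ ^ 2 ≤ 1 ∧ ∑ t ∈ G, ‖η t‖ ^ 2 ≤ 1 ∧
      C < ‖∑ s ∈ F, ∑ t ∈ G, b s t * (Φ (s, t) * (ξ s * η t))‖ := by
  rw [FiniteSchurBound] at h
  push Not at h
  obtain ⟨F, G, b, hb, ξ, η, hlt⟩ := h
  refine ⟨F, G, b, hb, ?_⟩
  set p := √(∑ s ∈ F, ‖ξ s‖ ^ 2) with hp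
  set q := √(∑ t ∈ G, ‖η t‖ ^ 2) with hq
  have hp2 : p ^ 2 = ∑ s ∈ F, ‖ξ s‖ ^ 2 := Real.sq_sqrt (Finset.sum_nonneg fun _ _ => sq_nonneg _)
  have hq2 : q ^ 2 = ∑ t ∈ G, ‖η t‖ ^ 2 := Real.sq_sqrt (Finset.sum_nonneg fun _ _ => sq_nonneg _)
  have hp0 : p ≠ 0 := fun h0 => by
    have h1 : ∀ s ∈ F, ξ s = 0 := fun s hs => by
      have := (Finset.sum_eq_zero_iff_of_nonneg fun _ _ => sq_nonneg _).1
        (hp2.symm.trans (by rw [h0]; simp)) s hs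
      simpa using this
    rw [h0, zero_mul, mul_zero, Finset.sum_eq_zero, norm_zero] at hlt
    · exact lt_irrefl _ hlt
    · exact fun s hs => Finset.sum_eq_zero fun t _ => by rw [h1 s hs]; simp
  have hq0 : q ≠ 0 := fun h0 => by
    have h1 : ∀ t ∈ G, η t = 0 := fun s hs => by
      have := (Finset.sum_eq_zero_iff_of_nonneg fun _ _ => sq_nonneg _).1
        (hq2.symm.trans (by rw [h0]; simp)) s hs
      simpa using this
    rw [h0, mul_zero, mul_zero, Finset.sum_eq_zero, norm_zero] at hlt
    · exact lt_irrefl _ hlt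
    · exact fun s hs => Finset.sum_eq_zero fun t ht => by rw [h1 t ht]; simp
  have hp1 : 0 < p := lt_of_le_of_ne (Real.sqrt_nonneg _) hp0.symm
  have hq1 : 0 < q := lt_of_le_of_ne (Real.sqrt_nonneg _) hq0.symm
  refine ⟨fun s => ξ s / p, fun t => η t / q, ?_, ?_, ?_⟩
  · simp only [norm_div, div_pow, Complex.norm_real, Real.norm_eq_abs, sq_abs]
    rw [← Finset.sum_div, ← hp2, div_self (by positivity)]
  · simp only [norm_div, div_pow, Complex.norm_real, Real.norm_eq_abs, sq_abs]
    rw [← Finset.sum_div, ← hq2, div_self (by positivity)]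
  · have e : ∑ s ∈ F, ∑ t ∈ G, b s t * (Φ (s, t) * (ξ s / p * (η t / q))) =
        (∑ s ∈ F, ∑ t ∈ G, b s t * (Φ (s, t) * (ξ s * η t))) / (p * q : ℝ) := by
      simp only [Finset.sum_div]
      refine Finset.sum_congr rfl fun s _ => Finset.sum_congr rfl fun t _ => ?_
      push_cast
      have : (p : ℂ) ≠ 0 := by exact_mod_cast hp0
      have : (q : ℂ) ≠ 0 := by exact_mod_cast hq0
      field_simp
    rw [e, norm_div, Complex.norm_real, Real.norm_of_nonneg (by positivity), lt_div_iff₀ (by positivity)]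
    exact hlt

/-- If the bound `4ⁿ` fails for every `n`, witnesses of the failures are placed in mutually
orthogonal blocks with weights `2⁻ⁿ`. The resulting `Q` is trace class, but pairing its transform
with the `n`-th contraction `b n` gives at least `2ⁿ`, which no trace class operator allows. -/
theorem exists_finiteSchurBound {Φ : ℝ × ℝ → ℂ} (h : Φ ∈ borelSchurMultipliers.{u}) :
    ∃ C : ℝ, 0 ≤ C ∧ FiniteSchurBound Φ C := by
  classical
  by_contra hcon
  push Not at hcon
  choose F G b hb ξ η hξ hη hlt using fun n : ℕ =>
    exists_of_not_finiteSchurBound (hcon ((4 : ℝ) ^ n) (by positivity))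
  -- One copy of `ℝ` for each block, lifted to the universe of the test spaces. The spectral measure
  -- sees only the real coordinate, so all blocks meet the same function `Φ` while remaining
  -- orthogonal.
  let ι : Type u := ULift.{u} (ℕ × ℝ)
  let p : ℕ → ℝ → ι := fun n s => ⟨(n, s)⟩
  have hpinj : ∀ {n m s t}, p n s = p m t → n = m ∧ s = t := fun {n m s t} h => by
    have : ((n, s) : ℕ × ℝ) = (m, t) := congrArg ULift.down h
    simpa using this
  let E : SpectralMeasure ℝ (Ell2 ι) := Ell2.spectralMeasure fun i => i.down.2
  have hEδ : ∀ n s, E.proj {s} (δ (p n s)) = δ (p n s) := fun n s =>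
    spectralMeasure_proj_δ (fun i : ι => i.down.2) (p n s)
  let P : ℕ → ℝ ↪ ι := fun n => ⟨p n, fun s t h => (hpinj h).2⟩
  let X : ℕ → Ell2 ι := fun n => ∑ i ∈ (G n).map (P n), conj (η n i.down.2) • δ i
  let Y : ℕ → Ell2 ι := fun n => ∑ i ∈ (F n).map (P n), ξ n i.down.2 • δ i
  have hX : ∀ n, ‖X n‖ ≤ 1 := fun n => by
    refine le_of_sq_le_sq ?_ zero_le_one
    simp only [X]
    rw [norm_sum_δ_sq, Finset.sum_map]
    simp only [RCLike.norm_conj, one_pow]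
    exact hη n
  have hY : ∀ n, ‖Y n‖ ≤ 1 := fun n => by
    refine le_of_sq_le_sq ?_ zero_le_one
    simp only [Y]
    rw [norm_sum_δ_sq, Finset.sum_map]
    rw [one_pow]
    exact hξ n
  have hYs : ∀ n, ∀ s ∈ F n, Y n (p n s) = ξ n s := fun n s hs =>
    sum_δ_apply _ _ (Finset.mem_map_of_mem (P n) hs)
  have hXt : ∀ n, ∀ t ∈ G n, X n (p n t) = conj (η n t) := fun n t ht =>
    sum_δ_apply _ (fun i : ι => conj (η n i.down.2)) (Finset.mem_map_of_mem (P n) ht)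
  have hYs0 : ∀ n m s, m ≠ n → Y m (p n s) = 0 := fun n m s hmn => by
    refine sum_δ_apply_notMem _ _ fun hmem => ?_
    obtain ⟨s', _, h⟩ := Finset.mem_map.1 hmem
    exact hmn (hpinj h).1
  let ε : ℕ → ℂ := fun n => ((1 / 2 : ℝ) ^ n : ℝ)
  have hε : ∀ n, ‖ε n‖ = (1 / 2) ^ n := fun n => by
    simp only [ε]
    rw [Complex.norm_real, Real.norm_of_nonneg (by positivity)]
  have hsummable : Summable fun n => ‖ε n • X n‖ * ‖Y n‖ := by
    refine Summable.of_nonneg_of_le (fun _ => by positivity) (fun n => ?_)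
      (summable_geometric_of_lt_one (by norm_num : (0 : ℝ) ≤ 1 / 2) (by norm_num))
    rw [norm_smul, hε]
    calc (1 / 2 : ℝ) ^ n * ‖X n‖ * ‖Y n‖ ≤ (1 / 2 : ℝ) ^ n * 1 * 1 := by
          gcongr
          exacts [hX n, hY n]
      _ = _ := by ring
  have hQs : Summable fun n => rankOne (ε n • X n) (Y n) := by
    refine Summable.of_norm ?_
    simpa only [norm_rankOne] using hsummable
  let Q : HilbertSchmidt (Ell2 ι) := ∑' n, rankOne (ε n • X n) (Y n)
  have hQapply : ∀ f, HasSum (fun n => ⟪ε n • X n, f⟫_ℂ • Y n) (toCLM _ Q f) := fun f =>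
    (hQs.hasSum.mapL toCLML).mapL (ContinuousLinearMap.apply ℂ _ f)
  obtain ⟨T, hT, x, y, hxy, hTsum⟩ := (h (Ell2 ι) E E).2 Q ⟨_, _, hsummable, hQapply⟩
  have hQent : ∀ n, ∀ s ∈ F n, ∀ t ∈ G n,
      ⟪δ (p n s), toCLM _ Q (δ (p n t))⟫_ℂ = ε n * (ξ n s * η n t) := by
    intro n s hs t ht
    rw [inner_δ]
    have h1 := hasSum_eval (hQapply (δ (p n t))) (p n s)
    refine h1.unique ?_
    have h2 : ε n * (ξ n s * η n t) =
        (⟪ε n • X n, δ (p n t)⟫_ℂ • Y n : Ell2 ι) (p n s) := by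
      rw [lp.coeFn_smul, Pi.smul_apply, hYs n s hs, inner_smul_left, ← inner_conj_symm, inner_δ,
        hXt n t ht, Complex.conj_conj, smul_eq_mul]
      have : conj (ε n) = ε n := Complex.conj_ofReal _
      rw [this]
      ring
    rw [h2]
    refine hasSum_single n fun m hm => ?_
    rw [lp.coeFn_smul, Pi.smul_apply, hYs0 n m s hm, smul_zero]
  have hTent : ∀ n, ∀ s ∈ F n, ∀ t ∈ G n, ⟪δ (p n s), toCLM _ T (δ (p n t))⟫_ℂ =
      ε n * (Φ (s, t) * (ξ n s * η n t)) := by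
    intro n s hs t ht
    rw [hT.inner_eq (hEδ n s) (hEδ n t), hQent n s hs t ht]
    ring
  have hbes : ∀ n (I : Finset ℝ) (f : Ell2 ι), √(∑ s ∈ I, ‖f (p n s)‖ ^ 2) ≤ ‖f‖ := fun n I f => by
    rw [Real.sqrt_le_iff]
    refine ⟨norm_nonneg _, ?_⟩
    have := sum_norm_sq_le f (I.map (P n))
    rwa [Finset.sum_map] at this
  -- The `n`-th block of `T` is tested against `b n`. Each term `⟪x k, ·⟫ y k` contributes at most
  -- `‖x k‖ ‖y k‖` since `b n` is contractive, whereas the total is at least `2⁻ⁿ 4ⁿ`.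
  have hbound : ∀ n, (2 : ℝ) ^ n ≤ ∑' k, ‖x k‖ * ‖y k‖ := by
    intro n
    have h1 : HasSum (fun k => ∑ s ∈ F n, ∑ t ∈ G n,
        b n s t * (y k (p n s) * conj (x k (p n t))))
        (∑ s ∈ F n, ∑ t ∈ G n, b n s t * (ε n * (Φ (s, t) * (ξ n s * η n t)))) := by
      refine hasSum_sum fun s hs => hasSum_sum fun t ht => ?_
      rw [← hTent n s hs t ht, inner_δ]
      refine HasSum.mul_left _ ?_
      have e : (fun k => y k (p n s) * conj (x k (p n t))) =
          fun k => (⟪x k, δ (p n t)⟫_ℂ • y k : Ell2 ι) (p n s) := by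
        funext k
        rw [lp.coeFn_smul, Pi.smul_apply, ← inner_conj_symm, inner_δ, smul_eq_mul, mul_comm]
      rw [e]
      exact hasSum_eval (hTsum (δ (p n t))) (p n s)
    have h2 : ‖∑ s ∈ F n, ∑ t ∈ G n, b n s t * (ε n * (Φ (s, t) * (ξ n s * η n t)))‖ ≤
        ∑' k, ‖x k‖ * ‖y k‖ := by
      rw [← h1.tsum_eq]
      refine tsum_of_norm_bounded hxy.hasSum fun k => ?_
      refine (hb n (fun s => y k (p n s)) (fun t => conj (x k (p n t)))).trans ?_
      rw [mul_comm ‖x k‖]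
      simp only [RCLike.norm_conj]
      gcongr
      exacts [hbes n _ _, hbes n _ _]
    refine le_trans ?_ h2
    have h3 : ∑ s ∈ F n, ∑ t ∈ G n, b n s t * (ε n * (Φ (s, t) * (ξ n s * η n t))) =
        ε n * ∑ s ∈ F n, ∑ t ∈ G n, b n s t * (Φ (s, t) * (ξ n s * η n t)) := by
      simp only [Finset.mul_sum]
      refine Finset.sum_congr rfl fun s _ => Finset.sum_congr rfl fun t _ => by ring
    rw [h3, norm_mul, hε]
    have h4 := (hlt n).le
    calc (2 : ℝ) ^ n = (1 / 2) ^ n * 4 ^ n := by rw [← mul_pow]; norm_num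
      _ ≤ _ := by gcongr
  obtain ⟨n, hn⟩ := pow_unbounded_of_one_lt (∑' k, ‖x k‖ * ‖y k‖) (one_lt_two)
  exact absurd (hbound n) (not_le.2 hn)

end BorelMultipliers

/-! ### Positive definite kernels -/

open ComplexConjugate

/-- Positive definite kernels. -/
structure IsPosKernel {X : Type*} (K : X → X → ℂ) : Prop where
  conj_symm : ∀ x y, conj (K x y) = K y x
  nonneg : ∀ (I : Finset X) (c : X → ℂ), 0 ≤ (∑ x ∈ I, ∑ y ∈ I, conj (c x) * c y * K x y).re

namespace IsPosKernel

theorem exists_inner {X : Type u} {K : X → X → ℂ} (h : IsPosKernel K) :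
    ∃ (H : Type u) (_ : NormedAddCommGroup H) (_ : InnerProductSpace ℂ H) (_ : CompleteSpace H)
      (k : X → H), ∀ x y, K x y = ⟪k x, k y⟫_ℂ := by
  -- The reproducing kernel space is built from an operator-valued kernel, so each scalar acts by
  -- multiplication on `ℂ`. The kernel functions at the vector `1` are the Gram vectors.
  let M : Matrix X X (ℂ →L[ℂ] ℂ) := fun x y => K x y • ContinuousLinearMap.id ℂ ℂ
  have hM : M.PosSemidef := by
    have h1 : M.IsHermitian ∧ ∀ vv : X →₀ ℂ,
        0 ≤ RCLike.re (vv.sum fun x w => vv.sum fun x' w' => ⟪M x' x w, w'⟫_ℂ) := by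
      refine ⟨?_, fun vv => ?_⟩
      · ext x y
        rw [Matrix.conjTranspose_apply]
        simp [M, ContinuousLinearMap.star_eq_adjoint, ← h.conj_symm y x, ContinuousLinearMap.adjoint_id]
      · refine (h.nonneg vv.support vv).trans_eq (congrArg Complex.re ?_)
        refine Finset.sum_congr rfl fun x _ => Finset.sum_congr rfl fun y _ => ?_
        simp only [M, smul_apply, ContinuousLinearMap.id_apply, smul_eq_mul, RCLike.inner_apply,
          map_mul, h.conj_symm]
        ring
    exact (RKHS.posSemidef_tfae.out 0 2).2 h1
  have : Fact M.PosSemidef := ⟨hM⟩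
  refine ⟨RKHS.OfKernel M, inferInstance, inferInstance, inferInstance,
    fun x => RKHS.kerFun (RKHS.OfKernel M) x 1, fun x y => ?_⟩
  rw [← RKHS.kernel_inner, RKHS.OfKernel.kernel_ofKernel]
  simp [M, h.conj_symm]

theorem norm_le {X : Type u} {K : X → X → ℂ} (h : IsPosKernel K) (x y : X) :
    ‖K x y‖ ≤ √‖K x x‖ * √‖K y y‖ := by
  obtain ⟨H, _, _, _, k, hk⟩ := h.exists_inner
  have h1 : ∀ x, √‖K x x‖ = ‖k x‖ := fun x => by
    rw [hk, inner_self_eq_norm_sq_to_K]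
    simp [Real.sqrt_sq]
  rw [h1, h1, hk]
  exact norm_inner_le_norm _ _

theorem add {X : Type*} {K L : X → X → ℂ} (hK : IsPosKernel K) (hL : IsPosKernel L) :
    IsPosKernel (K + L) := by
  refine ⟨fun x y => by simp [hK.conj_symm, hL.conj_symm], fun I c => ?_⟩
  simp only [Pi.add_apply, mul_add, Finset.sum_add_distrib, Complex.add_re]
  exact add_nonneg (hK.nonneg I c) (hL.nonneg I c)

theorem smul {X : Type*} {K : X → X → ℂ} (hK : IsPosKernel K) {r : ℝ} (hr : 0 ≤ r) :
    IsPosKernel (r • K) := by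
  refine ⟨fun x y => by simp [hK.conj_symm], fun I c => ?_⟩
  have : ∑ x ∈ I, ∑ y ∈ I, conj (c x) * c y * (r • K) x y =
      (r : ℂ) * ∑ x ∈ I, ∑ y ∈ I, conj (c x) * c y * K x y := by
    simp only [Finset.mul_sum, Pi.smul_apply, Complex.real_smul]
    exact Finset.sum_congr rfl fun _ _ => Finset.sum_congr rfl fun _ _ => by ring
  rw [this, Complex.re_ofReal_mul]
  exact mul_nonneg hr (hK.nonneg I c)

theorem of_rankOne {X : Type*} (p : X → ℂ) : IsPosKernel fun x y => conj (p x) * p y := by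
  refine ⟨fun x y => by simp [mul_comm], fun I c => ?_⟩
  have : ∑ x ∈ I, ∑ y ∈ I, conj (c x) * c y * (conj (p x) * p y) =
      conj (∑ x ∈ I, c x * p x) * ∑ y ∈ I, c y * p y := by
    rw [map_sum, Finset.sum_mul_sum]
    exact Finset.sum_congr rfl fun _ _ => Finset.sum_congr rfl fun _ _ => by
      rw [map_mul]; ring
  rw [this, ← Complex.normSq_eq_conj_mul_self, Complex.ofReal_re]
  exact Complex.normSq_nonneg _

theorem of_tendsto {X ι : Type*} {l : Filter ι} [l.NeBot] {K : ι → X → X → ℂ} {L : X → X → ℂ}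
    (hK : ∀ᶠ i in l, IsPosKernel (K i)) (h : ∀ x y, Tendsto (fun i => K i x y) l (𝓝 (L x y))) :
    IsPosKernel L := by
  refine ⟨fun x y => ?_, fun I c => ?_⟩
  · refine tendsto_nhds_unique ((Complex.continuous_conj.tendsto _).comp (h x y))
      ((h y x).congr' ?_)
    filter_upwards [hK] with i hi
    exact (hi.conj_symm x y).symm
  · refine ge_of_tendsto (b := 0) (x := l)
      (f := fun i => (∑ x ∈ I, ∑ y ∈ I, conj (c x) * c y * K i x y).re)
      ((Complex.continuous_re.tendsto _).comp ?_) ?_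
    · exact tendsto_finsetSum _ fun x _ => tendsto_finsetSum _ fun y _ => (h x y).const_mul _
    · filter_upwards [hK] with i hi
      exact hi.nonneg I c

end IsPosKernel

/-! ### Factorization of Schur multipliers through a Hilbert space -/

/-- A continuous linear functional on a product depends on finitely many coordinates. -/
theorem ContinuousLinearMap.exists_eq_sum_pi {ι : Type*} [DecidableEq ι] (f : (ι → ℂ) →L[ℂ] ℂ) :
    ∃ I : Finset ι, ∀ J, I ⊆ J → ∀ x, f x = ∑ i ∈ J, x i * f (Pi.single i 1) := by
  have h0 : f ⁻¹' Metric.ball 0 1 ∈ 𝓝 (0 : ι → ℂ) :=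
    f.continuous.continuousAt.preimage_mem_nhds (by
      rw [map_zero]; exact Metric.ball_mem_nhds _ one_pos)
  rw [nhds_pi, Filter.mem_pi] at h0
  obtain ⟨I, hI, t, ht, hsub⟩ := h0
  have hz : ∀ x : ι → ℂ, (∀ i ∈ I, x i = 0) → f x = 0 := by
    intro x hx
    by_contra hne
    have h1 : ((f x)⁻¹ • x) ∈ f ⁻¹' Metric.ball 0 1 := hsub fun i hi => by
      rw [Pi.smul_apply, hx i hi, smul_zero]
      exact mem_of_mem_nhds (ht i)
    simp [hne] at h1
  refine ⟨hI.toFinset, fun J hJ x => ?_⟩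
  have h2 := hz (x - ∑ i ∈ J, x i • Pi.single i 1) fun i hi => by
    have : i ∈ J := hJ (hI.mem_toFinset.2 hi)
    simp [Finset.sum_apply, Pi.single_apply, this]
  rw [map_sub, sub_eq_zero, map_sum] at h2
  simpa using h2

/-- The factorization of a Schur multiplier through a Hilbert space, in kernel form. -/
theorem FiniteSchurBound.mem_closure {S T : Type*} {Φ : S × T → ℂ} {C : ℝ} (hC : 0 ≤ C)
    (h : FiniteSchurBound Φ C) :
    Sum.elim Φ (fun _ => (C : ℂ)) ∈ closure ((fun K : (S ⊕ T) → (S ⊕ T) → ℂ =>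
      (Sum.elim (fun p : S × T => K (.inl p.1) (.inr p.2)) fun x => K x x)) ''
        {K | IsPosKernel K}) := by
  classical
  set R := fun K : (S ⊕ T) → (S ⊕ T) → ℂ =>
      (Sum.elim (fun p : S × T => K (.inl p.1) (.inr p.2)) fun x => K x x : S × T ⊕ S ⊕ T → ℂ)
    with hR
  set D := R '' {K | IsPosKernel K}
  have hRadd : ∀ K L, R (K + L) = R K + R L := fun K L => by
    ext i; rcases i with i | i <;> rfl
  have hRsmul : ∀ (r : ℝ) K, R (r • K) = r • R K := fun r K => by
    ext i; rcases i with i | i <;> rfl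
  have hconv : Convex ℝ D := by
    rintro _ ⟨K, hK, rfl⟩ _ ⟨L, hL, rfl⟩ a b ha hb -
    exact ⟨a • K + b • L, (hK.smul ha).add (hL.smul hb), by rw [hRadd, hRsmul, hRsmul]⟩
  by_contra hmem
  obtain ⟨f, v, hv1, hv2⟩ :=
    RCLike.geometric_hahn_banach_point_closed (𝕜 := ℂ) hconv.closure isClosed_closure hmem
  have hfsmul : ∀ (r : ℝ) K, (f (R (r • K))).re = r * (f (R K)).re := fun r K => by
    rw [hRsmul, ← Complex.coe_smul, map_smul, smul_eq_mul, Complex.re_ofReal_mul]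
  have hD1 : ∀ K, IsPosKernel K → v < (f (R K)).re := fun K hK =>
    hv2 _ (subset_closure ⟨K, hK, rfl⟩)
  have hv0 : v < 0 := by
    have h1 := hD1 _ (((IsPosKernel.of_rankOne (fun _ : S ⊕ T => (0 : ℂ)))).smul le_rfl)
    rwa [hfsmul, zero_mul] at h1
  -- The positive kernels form a cone: a negative value could be rescaled to equal `v`,
  -- contradicting the strict separation.
  have hD : ∀ K, IsPosKernel K → 0 ≤ (f (R K)).re := by
    intro K hK
    by_contra hlt
    push Not at hlt
    have h1 := hD1 _ (hK.smul (div_nonneg_of_nonpos hv0.le hlt.le))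
    rw [hfsmul, div_mul_cancel₀ _ hlt.ne] at h1
    exact lt_irrefl _ h1
  have hneg : (f (Sum.elim Φ (fun _ => (C : ℂ)))).re < 0 := hv1.trans hv0
  -- The topology is that of pointwise convergence, so the separating functional is a finite matrix
  -- `a` together with diagonal weights. `F` and `G` collect all rows and columns that occur.
  obtain ⟨I, hI⟩ := f.exists_eq_sum_pi
  let F : Finset S := I.biUnion (Sum.elim (fun p => {p.1}) (Sum.elim (fun s => {s}) fun _ => ∅))
  let G : Finset T := I.biUnion (Sum.elim (fun p => {p.2}) (Sum.elim (fun _ => ∅) fun t => {t}))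
  have hIJ : I ⊆ (F ×ˢ G).disjSum (F.disjSum G) := by
    rintro (p | s | t) hi
    · simp only [Finset.inl_mem_disjSum, Finset.mem_product]
      exact ⟨Finset.mem_biUnion.2 ⟨_, hi, by simp⟩, Finset.mem_biUnion.2 ⟨_, hi, by simp⟩⟩
    · simp only [Finset.inr_mem_disjSum, Finset.inl_mem_disjSum]
      exact Finset.mem_biUnion.2 ⟨_, hi, by simp⟩
    · simp only [Finset.inr_mem_disjSum]
      exact Finset.mem_biUnion.2 ⟨_, hi, by simp⟩
  set a : S → T → ℂ := fun s t => f (Pi.single (.inl (s, t)) 1) with ha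
  set l : S → ℝ := fun s => (f (Pi.single (.inr (.inl s)) 1)).re with hl
  set m : T → ℝ := fun t => (f (Pi.single (.inr (.inr t)) 1)).re with hm
  have hf : ∀ x : S × T ⊕ S ⊕ T → ℂ, f x = ∑ s ∈ F, ∑ t ∈ G, x (.inl (s, t)) * a s t +
      (∑ s ∈ F, x (.inr (.inl s)) * f (Pi.single (.inr (.inl s)) 1) +
        ∑ t ∈ G, x (.inr (.inr t)) * f (Pi.single (.inr (.inr t)) 1)) := fun x => by
    rw [hI _ hIJ, Finset.sum_disjSum, Finset.sum_disjSum, Finset.sum_product]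
  have hfre : ∀ (x : S × T ⊕ S ⊕ T → ℂ) (d : S → ℝ) (e : T → ℝ),
      (∀ s, x (.inr (.inl s)) = d s) → (∀ t, x (.inr (.inr t)) = e t) →
      (f x).re = (∑ s ∈ F, ∑ t ∈ G, x (.inl (s, t)) * a s t).re +
        (∑ s ∈ F, d s * l s + ∑ t ∈ G, e t * m t) := fun x d e hd he => by
    rw [hf, Complex.add_re, Complex.add_re, Complex.re_sum F, Complex.re_sum G]
    simp only [hd, he, Complex.re_ofReal_mul, Complex.re_sum, l, m]
  -- Positivity of the functional on the rank-one kernels built from `(p, q)`; only these kernels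
  -- are needed.
  have hpq : ∀ (p : S → ℂ) (q : T → ℂ), 0 ≤ (∑ s ∈ F, ∑ t ∈ G, conj (p s) * q t * a s t).re +
      (∑ s ∈ F, ‖p s‖ ^ 2 * l s + ∑ t ∈ G, ‖q t‖ ^ 2 * m t) := fun p q => by
    have h1 := hD _ (IsPosKernel.of_rankOne (Sum.elim p q))
    rwa [hfre _ (fun s => ‖p s‖ ^ 2) (fun t => ‖q t‖ ^ 2)] at h1
    all_goals intro s; push_cast; exact Complex.conj_mul' _
  have hl0 : ∀ s ∈ F, 0 ≤ l s := fun s hs => by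
    have h1 := hpq (Pi.single s 1) 0
    simpa [Pi.single_apply, hs, apply_ite, ite_pow] using h1
  have hm0 : ∀ t ∈ G, 0 ≤ m t := fun t ht => by
    have h1 := hpq 0 (Pi.single t 1)
    simpa [Pi.single_apply, ht, apply_ite, ite_pow] using h1
  rw [hfre _ (fun _ => C) (fun _ => C) (fun _ => rfl) (fun _ => rfl)] at hneg
  simp only [Sum.elim_inl, ← Finset.mul_sum, ← mul_add] at hneg
  -- The weights are only nonnegative. A small shift makes them strictly positive, so that they may
  -- be divided by, and keeps the strict inequality.
  obtain ⟨ε, hε, hneg⟩ : ∃ ε : ℝ, 0 < ε ∧ (∑ s ∈ F, ∑ t ∈ G, Φ (s, t) * a s t).re +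
      C * (∑ s ∈ F, (l s + ε) + ∑ t ∈ G, (m t + ε)) < 0 := by
    have hc : ContinuousAt (fun ε : ℝ => (∑ s ∈ F, ∑ t ∈ G, Φ (s, t) * a s t).re +
      C * (∑ s ∈ F, (l s + ε) + ∑ t ∈ G, (m t + ε))) 0 := by fun_prop
    have h1 := hc.eventually (eventually_lt_nhds (b := 0) (by simpa only [add_zero] using hneg))
    obtain ⟨ε, h2, h3⟩ := ((h1.filter_mono nhdsWithin_le_nhds).and
      (self_mem_nhdsWithin (s := Set.Ioi (0 : ℝ)))).exists
    exact ⟨ε, h3, h2⟩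
  have hlp : ∀ s ∈ F, 0 < l s + ε := fun s hs => add_pos_of_nonneg_of_pos (hl0 s hs) hε
  have hmp : ∀ t ∈ G, 0 < m t + ε := fun t ht => add_pos_of_nonneg_of_pos (hm0 t ht) hε
  have hbil : ∀ (p : S → ℂ) (q : T → ℂ), ‖∑ s ∈ F, ∑ t ∈ G, p s * q t * a s t‖ ≤
      2 * (√(∑ s ∈ F, ‖p s‖ ^ 2 * (l s + ε)) * √(∑ t ∈ G, ‖q t‖ ^ 2 * (m t + ε))) := by
    intro p q
    set A := ∑ s ∈ F, ‖p s‖ ^ 2 * (l s + ε)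
    set B := ∑ t ∈ G, ‖q t‖ ^ 2 * (m t + ε)
    set X := ∑ s ∈ F, ∑ t ∈ G, p s * q t * a s t
    have hA : 0 ≤ A := Finset.sum_nonneg fun s hs => mul_nonneg (sq_nonneg _) (hlp s hs).le
    have hB : 0 ≤ B := Finset.sum_nonneg fun t ht => mul_nonneg (sq_nonneg _) (hmp t ht).le
    obtain ⟨θ, hθ, hθX⟩ : ∃ θ : ℂ, ‖θ‖ = 1 ∧ θ * X = (‖X‖ : ℂ) := by
      obtain ⟨c, hc, h1⟩ := RCLike.exists_norm_eq_mul_self X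
      exact ⟨c, hc, h1.symm⟩
    -- The phase `θ` makes the bilinear term real and the factor `-r` varies its size; nonpositive
    -- discriminant is the weighted Cauchy–Schwarz bound `|X|² ≤ 4 A B`.
    have hquad : ∀ r : ℝ, 0 ≤ A * (r * r) + -‖X‖ * r + B := by
      intro r
      have h1 := hpq (fun s => conj (-(r : ℂ) * p s)) (fun t => θ * q t)
      have h2 : ∑ s ∈ F, ∑ t ∈ G, conj (conj (-(r : ℂ) * p s)) * (θ * q t) * a s t =
          ((-r * ‖X‖ : ℝ) : ℂ) := by
        push_cast
        rw [← hθX, Finset.mul_sum, Finset.mul_sum]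
        refine Finset.sum_congr rfl fun s _ => ?_
        rw [Finset.mul_sum, Finset.mul_sum]
        refine Finset.sum_congr rfl fun t _ => ?_
        rw [Complex.conj_conj]
        ring
      have h3 : ∑ s ∈ F, ‖conj (-(r : ℂ) * p s)‖ ^ 2 * l s ≤ A * (r * r) := by
        rw [Finset.sum_mul]
        refine Finset.sum_le_sum fun s _ => ?_
        simp only [RCLike.norm_conj, norm_mul, norm_neg, Complex.norm_real, mul_pow,
          Real.norm_eq_abs, sq_abs]
        nlinarith [mul_nonneg (mul_nonneg (sq_nonneg r) (sq_nonneg ‖p s‖)) hε.le]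
      have h4 : ∑ t ∈ G, ‖θ * q t‖ ^ 2 * m t ≤ B := by
        refine Finset.sum_le_sum fun t _ => ?_
        rw [norm_mul, hθ, one_mul]
        nlinarith [mul_nonneg (sq_nonneg ‖q t‖) hε.le]
      rw [h2, Complex.ofReal_re] at h1
      linarith
    have h5 := discrim_le_zero hquad
    rw [discrim] at h5
    refine le_of_sq_le_sq ?_ (by positivity)
    rw [mul_pow, mul_pow, Real.sq_sqrt hA, Real.sq_sqrt hB]
    linarith
  -- By `hbil` this rescaled matrix is contractive. Testing the Schur bound on the square roots of
  -- the weights recovers `∑ Φ a / 2`, and `2 √x √y ≤ x + y` then contradicts `hneg`.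
  have hb := h F G (fun s t => a s t / (2 * (√(l s + ε) * √(m t + ε)))) (fun ξ η => ?_)
    (fun s => (√(l s + ε) : ℝ)) (fun t => (√(m t + ε) : ℝ))
  · have h1 : ∑ s ∈ F, ∑ t ∈ G, a s t / (2 * (√(l s + ε) * √(m t + ε))) *
        (Φ (s, t) * ((√(l s + ε) : ℝ) * (√(m t + ε) : ℝ))) =
        2⁻¹ * ∑ s ∈ F, ∑ t ∈ G, Φ (s, t) * a s t := by
      rw [Finset.mul_sum]
      refine Finset.sum_congr rfl fun s hs => ?_
      rw [Finset.mul_sum]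
      refine Finset.sum_congr rfl fun t ht => ?_
      have h2 : ((√(l s + ε) : ℝ) : ℂ) ≠ 0 := by
        exact_mod_cast (Real.sqrt_pos.2 (hlp s hs)).ne'
      have h3 : ((√(m t + ε) : ℝ) : ℂ) ≠ 0 := by
        exact_mod_cast (Real.sqrt_pos.2 (hmp t ht)).ne'
      field_simp
    have h2 : ∑ s ∈ F, ‖((√(l s + ε) : ℝ) : ℂ)‖ ^ 2 = ∑ s ∈ F, (l s + ε) :=
      Finset.sum_congr rfl fun s hs => by
        rw [Complex.norm_real, Real.norm_eq_abs, sq_abs, Real.sq_sqrt (hlp s hs).le]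
    have h3 : ∑ t ∈ G, ‖((√(m t + ε) : ℝ) : ℂ)‖ ^ 2 = ∑ t ∈ G, (m t + ε) :=
      Finset.sum_congr rfl fun t ht => by
        rw [Complex.norm_real, Real.norm_eq_abs, sq_abs, Real.sq_sqrt (hmp t ht).le]
    rw [h1, h2, h3, norm_mul] at hb
    have h4 := (abs_le.1 (Complex.abs_re_le_norm (∑ s ∈ F, ∑ t ∈ G, Φ (s, t) * a s t))).1
    have hA : 0 ≤ ∑ s ∈ F, (l s + ε) := Finset.sum_nonneg fun s hs => (hlp s hs).le
    have hB : 0 ≤ ∑ t ∈ G, (m t + ε) := Finset.sum_nonneg fun t ht => (hmp t ht).le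
    have h5 : 2 * (√(∑ s ∈ F, (l s + ε)) * √(∑ t ∈ G, (m t + ε))) ≤
        ∑ s ∈ F, (l s + ε) + ∑ t ∈ G, (m t + ε) := by
      nlinarith [sq_nonneg (√(∑ s ∈ F, (l s + ε)) - √(∑ t ∈ G, (m t + ε))), Real.sq_sqrt hA,
        Real.sq_sqrt hB]
    have h6 := mul_le_mul_of_nonneg_left h5 hC
    norm_num at hb
    linarith
  · have h1 := hbil (fun s => ξ s / (√(l s + ε) : ℝ)) (fun t => η t / (√(m t + ε) : ℝ))
    have h2 : ∑ s ∈ F, ‖ξ s / (√(l s + ε) : ℝ)‖ ^ 2 * (l s + ε) = ∑ s ∈ F, ‖ξ s‖ ^ 2 :=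
      Finset.sum_congr rfl fun s hs => by
        rw [norm_div, div_pow, Complex.norm_real, Real.norm_eq_abs, sq_abs,
          Real.sq_sqrt (hlp s hs).le, div_mul_cancel₀ _ (hlp s hs).ne']
    have h3 : ∑ t ∈ G, ‖η t / (√(m t + ε) : ℝ)‖ ^ 2 * (m t + ε) = ∑ t ∈ G, ‖η t‖ ^ 2 :=
      Finset.sum_congr rfl fun t ht => by
        rw [norm_div, div_pow, Complex.norm_real, Real.norm_eq_abs, sq_abs,
          Real.sq_sqrt (hmp t ht).le, div_mul_cancel₀ _ (hmp t ht).ne']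
    rw [h2, h3] at h1
    have h4 : ∑ s ∈ F, ∑ t ∈ G, a s t / (2 * (√(l s + ε) * √(m t + ε))) * (ξ s * η t) =
        2⁻¹ * ∑ s ∈ F, ∑ t ∈ G, ξ s / (√(l s + ε) : ℝ) * (η t / (√(m t + ε) : ℝ)) * a s t := by
      rw [Finset.mul_sum]
      refine Finset.sum_congr rfl fun s _ => ?_
      rw [Finset.mul_sum]
      refine Finset.sum_congr rfl fun t _ => ?_
      rw [mul_comm ((√(l s + ε) : ℝ) : ℂ), div_mul_div_comm, div_mul_eq_mul_div,
        div_mul_eq_mul_div, ← div_eq_inv_mul, div_div]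
      congr 1
      · ring
      · ring
    rw [h4, norm_mul]
    norm_num
    linarith

/-- The factorization of a Schur multiplier through a Hilbert space. -/
theorem FiniteSchurBound.exists_inner {S T : Type u} {Φ : S × T → ℂ} {C : ℝ} (hC : 0 ≤ C)
    (h : FiniteSchurBound Φ C) :
    ∃ (H : Type u) (_ : NormedAddCommGroup H) (_ : InnerProductSpace ℂ H) (_ : CompleteSpace H)
      (u : S → H) (v : T → H), (∀ s, ‖u s‖ ^ 2 ≤ C) ∧ (∀ t, ‖v t‖ ^ 2 ≤ C) ∧
        ∀ s t, Φ (s, t) = ⟪u s, v t⟫_ℂ := by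
  have hcl := h.mem_closure hC
  rw [mem_closure_iff_clusterPt, ← map_principal] at hcl
  -- Along an ultrafilter of positive kernels the prescribed entries converge. The remaining entries
  -- are bounded by the diagonal, so they converge too, and the limit is an honest positive kernel.
  obtain ⟨U, hU, hlim⟩ := mapClusterPt_iff_ultrafilter.1 hcl
  have hpos : ∀ᶠ K in (U : Filter (S ⊕ T → S ⊕ T → ℂ)), IsPosKernel K := by
    filter_upwards [hU (mem_principal_self _)] with K hK using hK
  rw [tendsto_pi_nhds] at hlim
  have hdiag : ∀ x : S ⊕ T, Tendsto (fun K : S ⊕ T → S ⊕ T → ℂ => K x x) U (𝓝 (C : ℂ)) :=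
    fun x => hlim (.inr x)
  have hoff : ∀ s t, Tendsto (fun K : S ⊕ T → S ⊕ T → ℂ => K (.inl s) (.inr t)) U
      (𝓝 (Φ (s, t))) := fun s t => hlim (.inl (s, t))
  have hconv : ∀ x y, ∃ z, Tendsto (fun K : S ⊕ T → S ⊕ T → ℂ => K x y) U (𝓝 z) := by
    intro x y
    have h1 : ∀ᶠ K in (U : Filter (S ⊕ T → S ⊕ T → ℂ)),
        K x y ∈ Metric.closedBall (0 : ℂ) (√(‖(C : ℂ)‖ + 1) * √(‖(C : ℂ)‖ + 1)) := by
      filter_upwards [hpos, (hdiag x).norm.eventually (eventually_lt_nhds (lt_add_one _)),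
        (hdiag y).norm.eventually (eventually_lt_nhds (lt_add_one _))] with K hK h1 h2
      rw [mem_closedBall_zero_iff]
      refine (hK.norm_le x y).trans ?_
      gcongr
    obtain ⟨z, -, hz⟩ := (isCompact_closedBall (0 : ℂ) _).ultrafilter_le_nhds
      (U.map fun K : S ⊕ T → S ⊕ T → ℂ => K x y) (le_principal_iff.2 (mem_map.2 h1))
    exact ⟨z, hz⟩
  choose L hL using hconv
  have hLpos : IsPosKernel L := IsPosKernel.of_tendsto hpos hL
  obtain ⟨H, i1, i2, i3, k, hk⟩ := hLpos.exists_inner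
  have hnorm : ∀ x, ‖k x‖ ^ 2 ≤ C := fun x => by
    have h1 : ⟪k x, k x⟫_ℂ = C := by
      rw [← hk]
      exact tendsto_nhds_unique (hL x x) (hdiag x)
    rw [inner_self_eq_norm_sq_to_K] at h1
    exact (Complex.ofReal_injective (by push_cast; exact h1)).le
  refine ⟨H, i1, i2, i3, fun s => k (.inl s), fun t => k (.inr t), fun s => hnorm _,
    fun t => hnorm _, fun s t => ?_⟩
  rw [← hk]
  exact tendsto_nhds_unique (hoff s t) (hL _ _)

/-- The factorization of a Schur multiplier through a Hilbert space, with total families of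
vectors. -/
theorem FiniteSchurBound.exists_inner_total {S T : Type u} {Φ : S × T → ℂ} {C : ℝ} (hC : 0 ≤ C)
    (h : FiniteSchurBound Φ C) :
    ∃ (H : Type u) (_ : NormedAddCommGroup H) (_ : InnerProductSpace ℂ H) (_ : CompleteSpace H)
      (u : S → H) (v : T → H), (∀ s, ‖u s‖ ≤ √C) ∧ (∀ t, ‖v t‖ ≤ √C) ∧
        (∀ s t, Φ (s, t) = ⟪u s, v t⟫_ℂ) ∧
        (Submodule.span ℂ (Set.range u)).topologicalClosure = ⊤ ∧
        (Submodule.span ℂ (Set.range v)).topologicalClosure = ⊤ := by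
  obtain ⟨H, _, _, _, u, v, hu, hv, huv⟩ := h.exists_inner hC
  -- First `u` is projected to the closed span `V` of `v`, then `v` to the closed span `W` of the
  -- projected vectors. The pairing is unchanged. As `W ≤ V`, a vector of `W` orthogonal to all `v
  -- t` is orthogonal to `V`, hence zero, so both families are total in `W`.
  let V : Submodule ℂ H := (Submodule.span ℂ (Set.range v)).topologicalClosure
  have hvV : ∀ t, v t ∈ V := fun t =>
    Submodule.le_topologicalClosure _ (Submodule.subset_span ⟨t, rfl⟩)
  have hVc : CompleteSpace V := (Submodule.isClosed_topologicalClosure _).completeSpace_coe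
  let W : Submodule ℂ H :=
    (Submodule.span ℂ (Set.range fun s => V.starProjection (u s))).topologicalClosure
  have huW : ∀ s, V.starProjection (u s) ∈ W := fun s =>
    Submodule.le_topologicalClosure _ (Submodule.subset_span ⟨s, rfl⟩)
  have hWc : CompleteSpace W := (Submodule.isClosed_topologicalClosure _).completeSpace_coe
  have hWV : W ≤ V := by
    refine Submodule.topologicalClosure_minimal _ (Submodule.span_le.2 ?_)
      (Submodule.isClosed_topologicalClosure _)
    rintro _ ⟨s, rfl⟩
    exact V.starProjection_apply_mem _
  refine ⟨W, inferInstance, inferInstance, hWc, fun s => ⟨V.starProjection (u s), huW s⟩,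
    fun t => W.orthogonalProjectionOnto (v t), fun s => ?_, fun t => ?_, fun s t => ?_, ?_, ?_⟩
  · exact Real.le_sqrt_of_sq_le ((pow_le_pow_left₀ (norm_nonneg _)
      (V.norm_starProjection_apply_le (u s)) 2).trans (hu s))
  · exact Real.le_sqrt_of_sq_le ((pow_le_pow_left₀ (norm_nonneg _)
      (W.norm_orthogonalProjectionOnto_apply_le (v t)) 2).trans (hv t))
  · rw [Submodule.inner_orthogonalProjectionOnto_eq_of_mem_left, huv]
    change _ = ⟪V.starProjection (u s), v t⟫_ℂ
    rw [Submodule.inner_starProjection_left_eq_right,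
      Submodule.starProjection_eq_self_iff.2 (hvV t)]
  · rw [Submodule.topologicalClosure_eq_top_iff, Submodule.eq_bot_iff]
    rintro ⟨w, hw⟩ h0
    rw [Submodule.mem_orthogonal] at h0
    have h1 : W ≤ (ℂ ∙ w)ᗮ := by
      refine Submodule.topologicalClosure_minimal _ (Submodule.span_le.2 ?_)
        (Submodule.isClosed_orthogonal _)
      rintro _ ⟨s, rfl⟩
      rw [SetLike.mem_coe, Submodule.mem_orthogonal_singleton_iff_inner_left]
      exact h0 _ (Submodule.subset_span ⟨s, rfl⟩)
    have h2 := Submodule.mem_orthogonal_singleton_iff_inner_left.1 (h1 hw)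
    exact Subtype.ext (inner_self_eq_zero.1 h2)
  · rw [Submodule.topologicalClosure_eq_top_iff, Submodule.eq_bot_iff]
    rintro ⟨w, hw⟩ h0
    rw [Submodule.mem_orthogonal] at h0
    have h1 : V ≤ (ℂ ∙ w)ᗮ := by
      refine Submodule.topologicalClosure_minimal _ (Submodule.span_le.2 ?_)
        (Submodule.isClosed_orthogonal _)
      rintro _ ⟨t, rfl⟩
      rw [SetLike.mem_coe, Submodule.mem_orthogonal_singleton_iff_inner_left]
      have h2 := h0 _ (Submodule.subset_span ⟨t, rfl⟩)
      rwa [Submodule.inner_orthogonalProjectionOnto_eq_of_mem_right] at h2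
    have h2 := Submodule.mem_orthogonal_singleton_iff_inner_left.1 (h1 (hWV hw))
    exact Subtype.ext (inner_self_eq_zero.1 h2)

/-! ### Bounded analytic functions -/

/-- The pointwise limit of a bounded sequence of analytic functions is analytic. -/
theorem differentiableOn_of_tendsto_of_bounded {E : Type*} [NormedAddCommGroup E]
    [NormedSpace ℂ E] [CompleteSpace E] {U : Set ℂ} (hU : IsOpen U) {F : ℕ → ℂ → E} {f : ℂ → E}
    {B : ℝ} (hF : ∀ n, DifferentiableOn ℂ (F n) U) (hB : ∀ n, ∀ z ∈ U, ‖F n z‖ ≤ B)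
    (hlim : ∀ z ∈ U, Tendsto (fun n => F n z) atTop (𝓝 (f z))) : DifferentiableOn ℂ f U := by
  intro c hc
  obtain ⟨R, hR, hRU⟩ := Metric.nhds_basis_closedBall.mem_iff.1 (hU.mem_nhds hc)
  have hmem : ∀ θ, circleMap c R θ ∈ U := fun θ => hRU (circleMap_mem_closedBall c hR.le θ)
  have hcont : ∀ n, Continuous fun θ => F n (circleMap c R θ) := fun n =>
    (hF n).continuousOn.comp_continuous (continuous_circleMap c R) hmem
  have hfB : ∀ z ∈ U, ‖f z‖ ≤ B := fun z hz =>
    le_of_tendsto (hlim z hz).norm (Eventually.of_forall fun n => hB n z hz)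
  have hmeas : AEStronglyMeasurable (fun θ => f (circleMap c R θ)) volume :=
    aestronglyMeasurable_of_tendsto_ae atTop (fun n => (hcont n).aestronglyMeasurable)
      (Eventually.of_forall fun θ => hlim _ (hmem θ))
  have hint : CircleIntegrable f c R := by
    refine (intervalIntegrable_const (c := B)).mono_fun' hmeas.restrict
      (Eventually.of_forall fun θ => hfB _ (hmem θ))
  lift R to ℝ≥0 using hR.le
  have hps := hasFPowerSeriesOn_cauchy_integral hint (by exact_mod_cast hR)
  -- Pointwise convergence on the circle suffices: Cauchy's formula for `F n` passes to the limit by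
  -- dominated convergence, and a Cauchy integral of an integrable function is a power series.
  have heq : ∀ w ∈ Metric.ball c R, (2 * Real.pi * Complex.I : ℂ)⁻¹ •
      ∮ z in C(c, R), (z - w)⁻¹ • f z = f w := by
    intro w hw
    refine tendsto_nhds_unique (f := fun n => F n w) (l := atTop) ?_
      (hlim w (hRU (Metric.ball_subset_closedBall hw)))
    have h1 : ∀ n, (2 * Real.pi * Complex.I : ℂ)⁻¹ • ∮ z in C(c, R), (z - w)⁻¹ • F n z = F n w :=
      fun n => by
        rw [((hF n).mono hRU).circleIntegral_sub_inv_smul hw, inv_smul_smul₀]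
        simp [Real.pi_ne_zero, Complex.I_ne_zero]
    have hne : ∀ θ, circleMap c R θ - w ≠ 0 := fun θ h => by
      rw [sub_eq_zero] at h
      rw [← h, Metric.mem_ball, dist_eq_norm] at hw
      simp at hw
    have hdist : ∀ θ, (R - dist w c : ℝ) ≤ ‖circleMap c R θ - w‖ := fun θ => by
      have h2 : dist (circleMap c R θ) c = R := by simp [dist_eq_norm]
      have h3 := dist_triangle (circleMap c R θ) w c
      rw [h2] at h3
      rw [← dist_eq_norm]
      linarith
    rw [Metric.mem_ball] at hw
    simp only [← h1]
    refine Tendsto.const_smul ?_ _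
    simp only [circleIntegral]
    refine intervalIntegral.tendsto_integral_filter_of_dominated_convergence
      (fun _ => R * ((R - dist w c)⁻¹ * B)) (Eventually.of_forall fun n => ?_)
      (Eventually.of_forall fun n => Eventually.of_forall fun θ _ => ?_)
      intervalIntegrable_const (Eventually.of_forall fun θ _ => ?_)
    · refine Continuous.aestronglyMeasurable ?_
      simp only [deriv_circleMap]
      have h3 := hcont n
      have h4 : Continuous fun θ => (circleMap c R θ - w)⁻¹ :=
        ((continuous_circleMap c R).sub continuous_const).inv₀ hne
      exact ((continuous_circleMap 0 (R : ℝ)).mul continuous_const).smul (h4.smul h3)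
    · rw [norm_smul, norm_smul, norm_inv]
      have h5 : 0 < R - dist w c := by linarith
      have h6 : 0 ≤ B := (norm_nonneg _).trans (hfB c hc)
      gcongr
      · simp
      · exact hdist θ
      · exact hB n _ (hmem θ)
    · exact ((hlim _ (hmem θ)).const_smul _).const_smul _
  have hball : Metric.eball c (R : ℝ≥0∞) = Metric.ball c R := by
    rw [Metric.eball_coe]
  have hd := (hps.differentiableOn.congr fun w hw =>
    (heq w (hball ▸ hw)).symm).differentiableAt (Metric.eball_mem_nhds c (by
      exact_mod_cast hR))
  exact hd.differentiableWithinAt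

namespace ClosedHalfPlane

theorem extend_apply (f : ClosedHalfPlane → ℂ) (z : ClosedHalfPlane) :
    Function.extend Subtype.val f 0 (z : ℂ) = f z :=
  Subtype.val_injective.extend_apply f 0 z

theorem exists_seq_tendsto_zero :
    ∃ t : ℕ → ℝ≥0, (∀ n, 0 < t n) ∧ Tendsto t atTop (𝓝[>] 0) := by
  obtain ⟨t, -, h0, hlim⟩ := exists_seq_strictAnti_tendsto (0 : ℝ≥0)
  exact ⟨t, h0, tendsto_nhdsWithin_iff.2 ⟨hlim, Eventually.of_forall h0⟩⟩

end ClosedHalfPlane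

/-! ### The maximum principle for radial boundary values -/

namespace HInftyR

variable {f : ClosedHalfPlane → ℂ}

/-- The value at `z` is an average of boundary values against harmonic measure. A Cayley transform
turns this into the mean value property on the unit circle, first for `F` shifted upwards by `ε`,
which is analytic across the real line. Then `ε → 0` uses only the vertical limits that `H^∞_r`
provides at every real point. -/
theorem norm_le_of_boundary (hf : f ∈ HInftyR) {M : ℝ} (hM : ∀ x, ‖f (realPoint x)‖ ≤ M)
    (z : ClosedHalfPlane) : ‖f z‖ ≤ M := by
  obtain ⟨hd, ⟨B, hB⟩, hr⟩ := hf
  rcases eq_or_lt_of_le z.2 with hz | hz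
  · have : z = realPoint z.1.re := Subtype.ext (Complex.ext rfl hz.symm)
    rw [this]
    exact hM _
  set F := Function.extend Subtype.val f 0
  have hFB : ∀ w : ℂ, 0 < w.im → ‖F w‖ ≤ B := fun w hw => by
    have := ClosedHalfPlane.extend_apply f ⟨w, hw.le⟩
    change ‖Function.extend Subtype.val f 0 ((⟨w, hw.le⟩ : ClosedHalfPlane) : ℂ)‖ ≤ B
    rw [this]
    exact hB _ hw
  -- The disc is mapped to the half-plane with `0 ↦ z` and pole at `ζ = 1`. There division by zero
  -- returns a real value, so `hcreal` needs no exception.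
  let c : ℂ → ℂ := fun ζ => z.1.re + z.1.im * ((1 + ζ) / (1 - ζ)) * Complex.I
  have hc0 : c 0 = z.1 := by simp [c, Complex.re_add_im]
  have hcim : ∀ ζ, (c ζ).im = z.1.im * ((1 - ‖ζ‖ ^ 2) / ‖1 - ζ‖ ^ 2) := fun ζ => by
    simp only [c, Complex.add_im, Complex.ofReal_im, Complex.mul_I_im, Complex.re_ofReal_mul,
      zero_add]
    rw [Complex.div_re, ← Complex.normSq_eq_norm_sq, ← Complex.normSq_eq_norm_sq, ← add_div]
    simp [Complex.normSq_apply]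
    left
    ring
  have hcd : ∀ ζ, ζ ≠ 1 → DifferentiableAt ℂ c ζ := fun ζ hζ => by
    have : 1 - ζ ≠ 0 := sub_ne_zero.2 hζ.symm
    simp only [c]
    fun_prop (disch := assumption)
  have hcreal : ∀ θ : ℝ, ∃ x : ℝ, c (circleMap 0 1 θ) = x := fun θ => by
    refine ⟨(c (circleMap 0 1 θ)).re, Complex.ext rfl ?_⟩
    rw [hcim]
    simp
  choose x hx using hcreal
  have hmean : ∀ ε : ℝ, 0 < ε → F (z.1 + ε * Complex.I) =
      (2 * Real.pi)⁻¹ • ∫ θ in 0..2 * Real.pi, F (x θ + ε * Complex.I) := by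
    intro ε hε
    have him : ∀ ζ : ℂ, ‖ζ‖ ≤ 1 → 0 < (c ζ + ε * Complex.I).im := fun ζ hζ => by
      rw [Complex.add_im, hcim]
      have h1 : 0 ≤ 1 - ‖ζ‖ ^ 2 := by nlinarith [norm_nonneg ζ]
      have h2 : 0 ≤ z.1.im * ((1 - ‖ζ‖ ^ 2) / ‖1 - ζ‖ ^ 2) := by positivity
      simp only [Complex.mul_I_im, Complex.ofReal_re]
      linarith
    have hgd : ∀ ζ : ℂ, ‖ζ‖ ≤ 1 → ζ ≠ 1 →
        DifferentiableAt ℂ (fun ζ => F (c ζ + ε * Complex.I)) ζ := fun ζ h1 h2 =>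
      DifferentiableAt.comp (f := fun ζ => c ζ + ε * Complex.I) ζ
        (hd.differentiableAt ((isOpen_lt continuous_const Complex.continuous_im).mem_nhds
          (him ζ h1))) ((hcd ζ h2).add_const _)
    -- The pole of `c` lies on the unit circle, so the mean value property is used on radii `r < 1`
    -- and passed to the limit by bounded convergence.
    obtain ⟨r, hr0, hr1, hrlim⟩ : ∃ r : ℕ → ℝ, (∀ n, 0 ≤ r n) ∧ (∀ n, r n < 1) ∧
        Tendsto r atTop (𝓝 1) := by
      refine ⟨fun n => 1 - 1 / (n + 1), fun n => ?_, fun n => ?_, ?_⟩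
      · have : (1 : ℝ) / (n + 1) ≤ 1 := by
          rw [div_le_one (by positivity)]
          linarith [n.cast_nonneg (α := ℝ)]
        linarith
      · have : (0 : ℝ) < 1 / (n + 1) := by positivity
        linarith
      · simpa using tendsto_one_div_add_atTop_nhds_zero_nat.const_sub (1 : ℝ)
    have hnorm : ∀ n θ, ‖circleMap 0 (r n) θ‖ ≤ 1 ∧ circleMap 0 (r n) θ ≠ 1 := fun n θ => by
      have h1 : ‖circleMap 0 (r n) θ‖ < 1 := by
        rw [norm_circleMap_zero, abs_of_nonneg (hr0 n)]
        exact hr1 n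
      exact ⟨h1.le, fun h => by simp [h] at h1⟩
    have havg : ∀ n, (2 * Real.pi)⁻¹ • ∫ θ in 0..2 * Real.pi,
        F (c (circleMap 0 (r n) θ) + ε * Complex.I) = F (z.1 + ε * Complex.I) := fun n => by
      have h1 : ∀ ζ ∈ Metric.closedBall (0 : ℂ) |r n|,
          DifferentiableAt ℂ (fun ζ => F (c ζ + ε * Complex.I)) ζ := fun ζ hζ => by
        rw [mem_closedBall_zero_iff, abs_of_nonneg (hr0 n)] at hζ
        have h2 := hζ.trans_lt (hr1 n)
        exact hgd ζ h2.le fun h => by simp [h] at h2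
      have h2 := circleAverage_of_differentiable_on_off_countable (c := 0) (R := r n)
        Set.countable_empty (fun ζ hζ => (h1 ζ hζ).continuousAt.continuousWithinAt)
        (fun ζ hζ => h1 ζ (Metric.ball_subset_closedBall hζ.1))
      rw [Real.circleAverage] at h2
      simpa only [hc0] using h2
    refine tendsto_nhds_unique (l := atTop)
      (tendsto_const_nhds.congr fun n => (havg n).symm) (Tendsto.const_smul ?_ _)
    refine intervalIntegral.tendsto_integral_filter_of_dominated_convergence
      (fun _ => B) (Eventually.of_forall fun n => ?_)
      (Eventually.of_forall fun n => Eventually.of_forall fun θ _ => ?_)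
      intervalIntegrable_const ?_
    · refine Continuous.aestronglyMeasurable (continuous_iff_continuousAt.2 fun θ => ?_)
      exact ContinuousAt.comp (f := circleMap 0 (r n))
        (hgd _ (hnorm n θ).1 (hnorm n θ).2).continuousAt (continuous_circleMap 0 _).continuousAt
    · exact hFB _ (him _ (hnorm n θ).1)
    · have hne : ∀ᵐ θ : ℝ, θ ≠ 2 * Real.pi := by
        simp [ae_iff, measure_singleton]
      filter_upwards [hne] with θ hθ hmem
      rw [Set.uIoc_of_le Real.two_pi_pos.le] at hmem
      have h1 : circleMap 0 1 θ ≠ 1 := fun h => by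
        rw [circleMap_zero, Complex.ofReal_one, one_mul, Complex.exp_eq_one_iff] at h
        obtain ⟨n, hn⟩ := h
        have h2 : θ = n * (2 * Real.pi) := by
          have := congrArg Complex.im hn
          simpa using this
        have h3 : (0 : ℝ) < n := by
          by_contra h4
          push Not at h4
          nlinarith [hmem.1, Real.two_pi_pos]
        have h4 : (n : ℝ) < 2 := by
          by_contra h5
          push Not at h5
          nlinarith [hmem.2, Real.two_pi_pos]
        have h5 : n = 1 := by
          have h6 : 0 < n := by exact_mod_cast h3
          have h7 : n < 2 := by exact_mod_cast h4
          omega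
        exact hθ (by rw [h2, h5]; simp)
      rw [← hx]
      have h2 : Tendsto (fun n => circleMap 0 (r n) θ) atTop (𝓝 (circleMap 0 1 θ)) := by
        simp only [circleMap]
        have h3 : Tendsto (fun n => (r n : ℂ)) atTop (𝓝 ((1 : ℝ) : ℂ)) :=
          (Complex.continuous_ofReal.tendsto _).comp hrlim
        exact (h3.mul_const _).const_add _
      exact (hgd _ (by simp) h1).continuousAt.tendsto.comp h2
  have hF : ∀ w : ℂ, 0 < w.im → ContinuousAt F w := fun w hw =>
    (hd.differentiableAt ((isOpen_lt continuous_const Complex.continuous_im).mem_nhds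
        hw)).continuousAt
  obtain ⟨t, ht0, htlim⟩ := ClosedHalfPlane.exists_seq_tendsto_zero
  have hFraise : ∀ (w : ClosedHalfPlane) n, F (w.1 + (t n : ℝ) * Complex.I) = f (w.raise (t n)) :=
    fun w n => ClosedHalfPlane.extend_apply f (w.raise (t n))
  have hrep : f z = (2 * Real.pi)⁻¹ • ∫ θ in 0..2 * Real.pi, f (realPoint (x θ)) := by
    have h1 : Tendsto (fun n => F (z.1 + (t n : ℝ) * Complex.I)) atTop (𝓝 (f z)) := by
      rw [← ClosedHalfPlane.extend_apply f z]
      refine (hF z.1 hz).tendsto.comp ?_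
      have h2 : Tendsto (fun n => ((t n : ℝ) : ℂ)) atTop (𝓝 ((0 : ℝ≥0) : ℝ)) :=
        ((Complex.continuous_ofReal.comp NNReal.continuous_coe).tendsto _).comp
          (htlim.mono_right nhdsWithin_le_nhds)
      simpa using (h2.mul_const Complex.I).const_add z.1
    refine tendsto_nhds_unique (h1.congr fun n => hmean (t n) (NNReal.coe_pos.2 (ht0 n))) (Tendsto.const_smul ?_ _)
    have him : ∀ n θ, 0 < ((x θ : ℂ) + (t n : ℝ) * Complex.I).im := fun n θ => by
      simpa using ht0 n
    refine intervalIntegral.tendsto_integral_filter_of_dominated_convergence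
      (fun _ => B) (Eventually.of_forall fun n => ?_)
      (Eventually.of_forall fun n => Eventually.of_forall fun θ _ => hFB _ (him n θ))
      intervalIntegrable_const (Eventually.of_forall fun θ _ => ?_)
    · have hxm : Measurable x := by
        have h3 : x = fun θ => (c (circleMap 0 1 θ)).re := funext fun θ => by
          rw [hx, Complex.ofReal_re]
        rw [h3]
        have h4 := (continuous_circleMap 0 1).measurable
        simp only [c]
        fun_prop
      classical
      -- Nothing is known about the regularity of `F` off the open half-plane, so it is replaced
      -- there by zero.
      have h5 : Measurable ({w : ℂ | 0 < w.im}.piecewise F 0) :=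
        ContinuousOn.measurable_piecewise hd.continuousOn continuousOn_const
          (measurableSet_lt measurable_const Complex.measurable_im)
      have h6 : (fun θ => F (x θ + (t n : ℝ) * Complex.I)) = fun θ =>
          {w : ℂ | 0 < w.im}.piecewise F 0 (x θ + (t n : ℝ) * Complex.I) := funext fun θ =>
        (Set.piecewise_eq_of_mem {w : ℂ | 0 < w.im} F 0 (him n θ)).symm
      rw [h6]
      refine Measurable.aestronglyMeasurable (h5.comp ?_)
      fun_prop
    · exact ((hr (x θ)).comp htlim).congr fun n => (hFraise (realPoint (x θ)) n).symm
  rw [hrep, norm_smul, Real.norm_of_nonneg (by positivity)]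
  have h1 := intervalIntegral.norm_integral_le_of_norm_le_const (a := 0) (b := 2 * Real.pi)
    (f := fun θ => f (realPoint (x θ))) (C := M) fun θ _ => hM _
  rw [sub_zero, abs_of_pos Real.two_pi_pos] at h1
  calc _ ≤ (2 * Real.pi)⁻¹ * (M * (2 * Real.pi)) := by gcongr
    _ = M := by field_simp

end HInftyR

/-! ### Closure properties and dual-valued extension -/

namespace HInftyR

variable {f g : ClosedHalfPlane → ℂ}

theorem isOpen_upper : IsOpen {z : ℂ | 0 < z.im} :=
  isOpen_lt continuous_const Complex.continuous_im

theorem of_differentiableOn {F : ℂ → ℂ} (hF : DifferentiableOn ℂ F {z : ℂ | 0 < z.im})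
    (hfF : ∀ z : ClosedHalfPlane, 0 < z.1.im → f z = F z) {B : ℝ}
    (hB : ∀ z : ClosedHalfPlane, 0 < z.1.im → ‖f z‖ ≤ B)
    (hlim : ∀ x : ℝ, Tendsto (fun t : ℝ≥0 => f ((realPoint x).raise t)) (𝓝[>] 0)
      (𝓝 (f (realPoint x)))) : f ∈ HInftyR := by
  refine ⟨hF.congr fun z hz => ?_, ⟨B, hB⟩, hlim⟩
  exact (ClosedHalfPlane.extend_apply f ⟨z, le_of_lt hz⟩).trans (hfF _ hz)

theorem raise_im_pos (z : ClosedHalfPlane) {t : ℝ≥0} (ht : 0 < t) : 0 < (z.raise t).1.im := by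
  have h1 : (z.raise t).1.im = z.1.im + t := by simp [ClosedHalfPlane.raise]
  rw [h1]
  exact add_pos_of_nonneg_of_pos z.2 ht

theorem eventually_raise_im_pos (z : ClosedHalfPlane) :
    ∀ᶠ t : ℝ≥0 in 𝓝[>] 0, 0 < (z.raise t).1.im := by
  filter_upwards [self_mem_nhdsWithin] with t ht using raise_im_pos z ht

theorem tendsto_raise (z : ClosedHalfPlane) :
    Tendsto (fun t : ℝ≥0 => ((z.raise t : ClosedHalfPlane) : ℂ)) (𝓝[>] 0) (𝓝 z.1) := by
  refine Tendsto.mono_left ?_ nhdsWithin_le_nhds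
  have h1 : Continuous fun t : ℝ≥0 => z.1 + ((t : ℝ) : ℂ) * Complex.I := by fun_prop
  have h2 : Tendsto (fun t : ℝ≥0 => z.1 + ((t : ℝ) : ℂ) * Complex.I) (𝓝 0) (𝓝 z.1) := by
    simpa using h1.tendsto 0
  exact h2

/-- The vertical limits exist in the whole closed half-plane. -/
theorem tendsto (hf : f ∈ HInftyR) (z : ClosedHalfPlane) :
    Tendsto (fun t : ℝ≥0 => f (z.raise t)) (𝓝[>] 0) (𝓝 (f z)) := by
  rcases eq_or_lt_of_le z.2 with hz | hz
  · have : z = realPoint z.1.re := Subtype.ext (Complex.ext rfl hz.symm)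
    rw [this]
    exact hf.2.2 _
  · have h1 := (hf.1.differentiableAt (isOpen_upper.mem_nhds hz)).continuousAt.tendsto.comp
      (tendsto_raise z)
    rw [ClosedHalfPlane.extend_apply] at h1
    exact h1.congr fun t => ClosedHalfPlane.extend_apply f _

theorem exists_bound (hf : f ∈ HInftyR) : ∃ B : ℝ, 0 ≤ B ∧ ∀ z, ‖f z‖ ≤ B := by
  obtain ⟨B, hB⟩ := hf.2.1
  refine ⟨max B 0, le_max_right _ _, fun z => ?_⟩
  refine le_of_tendsto (tendsto hf z).norm ?_
  filter_upwards [eventually_raise_im_pos z] with t ht using (hB _ ht).trans (le_max_left _ _)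

theorem zero_mem : (0 : ClosedHalfPlane → ℂ) ∈ HInftyR :=
  of_differentiableOn (F := 0) (differentiableOn_const 0) (fun _ _ => rfl) (B := 0)
    (fun _ _ => by simp) fun _ => tendsto_const_nhds

theorem sum_mul_mem {ι : Type*} {F : ι → ClosedHalfPlane → ℂ} (hF : ∀ i, F i ∈ HInftyR)
    (I : Finset ι) (c : ι → ℂ) : (fun z => ∑ i ∈ I, c i * F i z) ∈ HInftyR := by
  choose B hB0 hB using fun i => exists_bound (hF i)
  refine of_differentiableOn
    (F := fun z => ∑ i ∈ I, c i * Function.extend Subtype.val (F i) 0 z)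
    (DifferentiableOn.fun_sum fun i _ => (hF i).1.const_mul _) (fun z _ => ?_)
    (B := ∑ i ∈ I, ‖c i‖ * B i) (fun z _ => (norm_sum_le _ _).trans ?_) fun x => ?_
  · simp only [ClosedHalfPlane.extend_apply]
  · refine Finset.sum_le_sum fun i _ => ?_
    rw [norm_mul]
    gcongr
    exact hB i z
  · exact tendsto_finsetSum _ fun i _ => ((hF i).2.2 x).const_mul _

/-- Uniform limits. -/
theorem of_uniform_approx (h : ∀ ε > 0, ∃ g ∈ HInftyR, ∀ z, ‖g z - f z‖ ≤ ε) :
    f ∈ HInftyR := by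
  choose G hG hGf using fun n : ℕ => h (1 / (n + 1)) (by positivity)
  have hunif : TendstoUniformly G f atTop := by
    rw [Metric.tendstoUniformly_iff]
    intro ε hε
    obtain ⟨N, hN⟩ := exists_nat_one_div_lt hε
    filter_upwards [eventually_ge_atTop N] with n hn z
    rw [dist_comm, dist_eq_norm]
    refine (hGf n z).trans_lt (lt_of_le_of_lt ?_ hN)
    gcongr
  choose B hB0 hB using fun n => exists_bound (hG n)
  have hfB : ∀ z, ‖f z‖ ≤ B 0 + 1 := fun z => by
    have h1 := hGf 0 z
    have h2 := norm_sub_norm_le (f z) (G 0 z)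
    rw [norm_sub_rev] at h2
    have h3 := hB 0 z
    norm_num at h1
    linarith
  refine of_differentiableOn (F := Function.extend Subtype.val f 0) ?_
    (fun z _ => (ClosedHalfPlane.extend_apply f z).symm) (B := B 0 + 1) (fun z _ => hfB z)
    fun x => ?_
  · refine differentiableOn_of_tendsto_of_bounded isOpen_upper
      (F := fun n => Function.extend Subtype.val (G n) 0) (B := B 0 + 1 + 1) (fun n => (hG n).1)
      (fun n z hz => ?_) fun z hz => ?_
    · have e := ClosedHalfPlane.extend_apply (G n) ⟨z, le_of_lt hz⟩
      change ‖Function.extend Subtype.val (G n) 0 ((⟨z, le_of_lt hz⟩ : ClosedHalfPlane) : ℂ)‖ ≤ _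
      rw [e]
      have h1 := hGf n ⟨z, le_of_lt hz⟩
      have h2 := norm_sub_norm_le (G n ⟨z, le_of_lt hz⟩) (f ⟨z, le_of_lt hz⟩)
      have h3 := hfB ⟨z, le_of_lt hz⟩
      have h4 : (1 : ℝ) / (n + 1) ≤ 1 := by
        rw [div_le_one (by positivity)]
        linarith [n.cast_nonneg (α := ℝ)]
      linarith
    · have e := fun g => ClosedHalfPlane.extend_apply g ⟨z, le_of_lt hz⟩
      change Tendsto (fun n => Function.extend Subtype.val (G n) 0
        ((⟨z, le_of_lt hz⟩ : ClosedHalfPlane) : ℂ)) _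
        (𝓝 (Function.extend Subtype.val f 0 ((⟨z, le_of_lt hz⟩ : ClosedHalfPlane) : ℂ)))
      simp only [e]
      exact hunif.tendsto_at _
  · have h1 : TendstoUniformly (fun n (t : ℝ≥0) => G n ((realPoint x).raise t))
        (fun t => f ((realPoint x).raise t)) atTop := hunif.comp _
    exact h1.tendsto_of_eventually_tendsto (Eventually.of_forall fun n => (hG n).2.2 x)
      (hunif.tendsto_at _)

/-- Boundary values in the dual space of a normed space extend to the closed half-plane. -/
theorem exists_dual {E ι : Type*} [NormedAddCommGroup E] [NormedSpace ℂ E] {e : ι → E}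
    (he : (Submodule.span ℂ (Set.range e)).topologicalClosure = ⊤)
    {F : ι → ClosedHalfPlane → ℂ} (hF : ∀ i, F i ∈ HInftyR) {M : ℝ} (hM : 0 ≤ M)
    (hb : ∀ x : ℝ, ∃ l : StrongDual ℂ E, ‖l‖ ≤ M ∧ ∀ i, F i (realPoint x) = l (e i)) :
    ∃ l : ClosedHalfPlane → StrongDual ℂ E, (∀ z, ‖l z‖ ≤ M) ∧ (∀ z i, F i z = l z (e i)) ∧
      ∀ h, (fun z => l z h) ∈ HInftyR := by
  let L : (ι →₀ ℂ) →ₗ[ℂ] E := Finsupp.linearCombination ℂ e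
  let A : ClosedHalfPlane → (ι →₀ ℂ) →ₗ[ℂ] ℂ := fun z =>
    Finsupp.linearCombination ℂ fun i => F i z
  have hAmem : ∀ c, (fun z => A z c) ∈ HInftyR := fun c => by
    have h1 := sum_mul_mem hF c.support c
    exact h1
  -- A finite combination of the `F i` is in `H^∞_r` and satisfies this estimate on the boundary,
  -- hence everywhere. In particular the values at `z` respect the linear relations among the `e i`.
  have hbound : ∀ z c, ‖A z c‖ ≤ M * ‖L c‖ := fun z c => by
    refine norm_le_of_boundary (hAmem c) (fun x => ?_) z
    obtain ⟨l, hl, hle⟩ := hb x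
    have h1 : A (realPoint x) c = l (L c) := by
      simp only [A, L, Finsupp.linearCombination_apply, Finsupp.sum, map_sum, map_smul, hle]
    rw [h1]
    exact (l.le_opNorm _).trans (by gcongr)
  have hdense : DenseRange L := by
    rw [DenseRange, ← LinearMap.coe_range, Finsupp.range_linearCombination,
      ← Submodule.dense_iff_topologicalClosure_eq_top] at *
    exact he
  have hmem : ∀ z, ‖(A z).extendOfNorm L‖ ≤ M := fun z =>
    LinearMap.opNorm_extendOfNorm_le hdense hM (hbound z)
  have hval : ∀ z c, (A z).extendOfNorm L (L c) = A z c := fun z c =>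
    LinearMap.extendOfNorm_eq hdense ⟨M, hbound z⟩ c
  refine ⟨fun z => (A z).extendOfNorm L, hmem, fun z i => ?_, fun h => ?_⟩
  · have h1 := hval z (Finsupp.single i 1)
    simp only [L, A, Finsupp.linearCombination_single, one_smul] at h1
    exact h1.symm
  -- Approximation of `h` by the span of `e` is uniform in `z` because the functionals share the
  -- bound `M`; `M + 1` avoids division by zero.
  · refine of_uniform_approx fun ε hε => ?_
    obtain ⟨c, hc⟩ := hdense.exists_dist_lt h (ε := ε / (M + 1)) (by positivity)
    refine ⟨_, hAmem c, fun z => ?_⟩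
    rw [← hval, ← map_sub]
    refine (ContinuousLinearMap.le_opNorm _ _).trans ?_
    rw [dist_comm, dist_eq_norm] at hc
    calc _ ≤ M * (ε / (M + 1)) := by
          gcongr
          exact hmem z
      _ ≤ (M + 1) * (ε / (M + 1)) := by gcongr; linarith
      _ = ε := by field_simp

end HInftyR

/-! ### Slices of functions on the bi-half-plane -/

namespace HInftyR₂

variable {Φ : ClosedHalfPlane × ClosedHalfPlane → ℂ}

theorem extend_apply (Φ : ClosedHalfPlane × ClosedHalfPlane → ℂ) (z w : ClosedHalfPlane) :
    Function.extend (Prod.map Subtype.val Subtype.val : _ → ℂ × ℂ) Φ 0 (z.1, w.1) = Φ (z, w) :=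
  (Subtype.val_injective.prodMap Subtype.val_injective).extend_apply Φ 0 (z, w)

/-- For `w` on the boundary the slice is not a slice of an analytic function. It is the bounded
pointwise limit of the slices at `w + tₙ i`, hence analytic. -/
theorem left_mem (h : Φ ∈ HInftyR₂) (w : ClosedHalfPlane) : (fun z => Φ (z, w)) ∈ HInftyR := by
  obtain ⟨hd, ⟨B, hB⟩, hlim⟩ := h
  obtain ⟨t, ht0, htlim⟩ := ClosedHalfPlane.exists_seq_tendsto_zero
  have hΦB : ∀ z : ClosedHalfPlane, 0 < z.1.im → ‖Φ (z, w)‖ ≤ B := fun z hz =>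
    le_of_tendsto ((hlim z w).2.comp htlim).norm (Eventually.of_forall fun n =>
      hB z _ hz (HInftyR.raise_im_pos w (ht0 n)))
  refine HInftyR.of_differentiableOn (F := Function.extend Subtype.val (fun z => Φ (z, w)) 0) ?_
    (fun z _ => (ClosedHalfPlane.extend_apply (fun z => Φ (z, w)) z).symm) hΦB
    fun x => (hlim (realPoint x) w).1
  refine differentiableOn_of_tendsto_of_bounded HInftyR.isOpen_upper (B := B)
    (F := fun n z => Function.extend (Prod.map Subtype.val Subtype.val : _ → ℂ × ℂ) Φ 0
      (z, (w.raise (t n)).1)) (fun n => ?_) (fun n z hz => ?_) fun z hz => ?_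
  · exact hd.comp (differentiableOn_id.prodMk (differentiableOn_const _))
      fun z hz => ⟨hz, HInftyR.raise_im_pos w (ht0 n)⟩
  · have e := extend_apply Φ ⟨z, le_of_lt hz⟩ (w.raise (t n))
    simp only at e ⊢
    rw [e]
    exact hB _ _ hz (HInftyR.raise_im_pos w (ht0 n))
  · have e := ClosedHalfPlane.extend_apply (fun z => Φ (z, w)) ⟨z, le_of_lt hz⟩
    simp only at e
    rw [e]
    exact ((hlim ⟨z, le_of_lt hz⟩ w).2.comp htlim).congr fun n => (extend_apply Φ _ _).symm

theorem right_mem (h : Φ ∈ HInftyR₂) (z : ClosedHalfPlane) : (fun w => Φ (z, w)) ∈ HInftyR := by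
  obtain ⟨hd, ⟨B, hB⟩, hlim⟩ := h
  refine left_mem (Φ := fun p => Φ (p.2, p.1)) ⟨?_, ⟨B, fun w z hw hz => hB z w hz hw⟩,
    fun w z => ⟨(hlim z w).2, (hlim z w).1⟩⟩ z
  refine (hd.comp (differentiableOn_snd.prodMk differentiableOn_fst)
    (t := {p : ℂ × ℂ | 0 < p.1.im ∧ 0 < p.2.im}) fun p hp => ⟨hp.2, hp.1⟩).congr fun p hp => ?_
  have e1 := extend_apply Φ ⟨p.2, le_of_lt hp.2⟩ ⟨p.1, le_of_lt hp.1⟩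
  have e2 := extend_apply (fun p => Φ (p.2, p.1)) ⟨p.1, le_of_lt hp.1⟩ ⟨p.2, le_of_lt hp.2⟩
  exact e2.trans e1.symm

end HInftyR₂

/-! ### Representations in the Haagerup tensor product -/

section ColumnNorm

variable {α : Type*} {φ : ℕ → α → ℂ}

theorem columnNorm_le {C : ℝ} (hC : 0 ≤ C)
    (h : ∀ z, ∑' n, ‖φ n z‖ₑ ^ 2 ≤ ENNReal.ofReal C) : columnNorm φ ≤ ENNReal.ofReal √C := by
  rw [Real.sqrt_eq_rpow, ← ENNReal.ofReal_rpow_of_nonneg hC (by norm_num)]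
  exact ENNReal.rpow_le_rpow (iSup_le h) (by norm_num)

theorem sum_enorm_sq {ι : Type*} (I : Finset ι) (a : ι → ℂ) :
    ∑ i ∈ I, ‖a i‖ₑ ^ 2 = ENNReal.ofReal (∑ i ∈ I, ‖a i‖ ^ 2) := by
  rw [ENNReal.ofReal_sum_of_nonneg fun _ _ => sq_nonneg _]
  refine Finset.sum_congr rfl fun i _ => ?_
  rw [ENNReal.ofReal_pow (norm_nonneg _), ofReal_norm]

theorem sum_norm_sq_le_columnNorm (h : columnNorm φ < ∞) (I : Finset ℕ) (z : α) :
    ∑ n ∈ I, ‖φ n z‖ ^ 2 ≤ (columnNorm φ).toReal ^ 2 := by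
  have h1 : columnNorm φ ^ 2 = ⨆ z, ∑' n, ‖φ n z‖ₑ ^ 2 := by
    rw [columnNorm, ← ENNReal.rpow_natCast, ← ENNReal.rpow_mul]
    norm_num
  have h2 : ∑ n ∈ I, ‖φ n z‖ₑ ^ 2 ≤ columnNorm φ ^ 2 := by
    rw [h1]
    exact (ENNReal.sum_le_tsum I).trans (le_iSup (fun z => ∑' n, ‖φ n z‖ₑ ^ 2) z)
  rw [sum_enorm_sq] at h2
  rw [← ENNReal.toReal_pow]
  exact (ENNReal.ofReal_le_iff_le_toReal (ENNReal.pow_lt_top h).ne).1 h2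

end ColumnNorm

/-- A function of class `H^∞_r` that vanishes on a dense set vanishes. -/
theorem HInftyR.eq_zero_of_dense {f : ClosedHalfPlane → ℂ} (hf : f ∈ HInftyR) {D : Set ℂ}
    (hD : Dense D) (h : ∀ z : ClosedHalfPlane, z.1 ∈ D → 0 < z.1.im → f z = 0) : f = 0 := by
  have h1 : ∀ z : ClosedHalfPlane, 0 < z.1.im → f z = 0 := by
    intro z hz
    by_contra hne
    rw [← ClosedHalfPlane.extend_apply f z] at hne
    have h2 := (hf.1.differentiableAt (isOpen_upper.mem_nhds hz)).continuousAt.eventually_ne hne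
    obtain ⟨w, hwD, hw, hw0⟩ := hD.inter_nhds_nonempty (h2.and (isOpen_upper.mem_nhds hz))
    have hw1 : 0 < w.im := hw0
    exact hw ((ClosedHalfPlane.extend_apply f ⟨w, hw1.le⟩).trans (h ⟨w, hw1.le⟩ hwD hw1))
  funext z
  refine tendsto_nhds_unique (tendsto hf z) (tendsto_const_nhds.congr' ?_)
  filter_upwards [eventually_raise_im_pos z] with t ht using (h1 _ ht).symm

/-- The boundary factorization is continued one variable at a time, first to `l z` in the dual and
then to `m w` in the bidual, each of norm at most `√C`. The series comes from an orthonormal basis,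
and no factor is lost. -/
theorem HInftyR₂.exists_representation {Φ : ClosedHalfPlane × ClosedHalfPlane → ℂ}
    (hΦ : Φ ∈ HInftyR₂) {C : ℝ} (hC : 0 ≤ C) (h : FiniteSchurBound (boundaryFunction Φ) C) :
    ∃ φ ψ, IsHaagerupRepresentation HInftyR HInftyR Φ φ ψ ∧
      columnNorm φ * columnNorm ψ ≤ ENNReal.ofReal C := by
  classical
  obtain ⟨H, _, _, _, u, v, hu, hv, huv, hut, hvt⟩ := h.exists_inner_total hC
  obtain ⟨l, hl, hlv, hlmem⟩ := HInftyR.exists_dual hvt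
    (F := fun t z => Φ (z, realPoint t)) (fun t => left_mem hΦ _) (Real.sqrt_nonneg C)
    fun x => ⟨innerSL ℂ (u x), by simpa using hu x, fun t => huv x t⟩
  have hlu : ∀ x, l (realPoint x) = InnerProductSpace.toDual ℂ H (u x) := fun x => by
    refine ContinuousLinearMap.ext_on (s := Set.range v) ?_ ?_
    · exact (Submodule.dense_iff_topologicalClosure_eq_top).2 hvt
    · rintro _ ⟨t, rfl⟩
      rw [← hlv, InnerProductSpace.toDual_apply_apply]
      exact huv x t
  -- At real points `l` is the functional of `u x`, so totality of `u` makes the values of `l` total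
  -- in the dual and allows the extension in the second variable.
  have hlt : (Submodule.span ℂ (Set.range l)).topologicalClosure = ⊤ := by
    rw [← Submodule.dense_iff_topologicalClosure_eq_top] at hut ⊢
    refine ((InnerProductSpace.toDual ℂ H).surjective.denseRange.dense_image
      (InnerProductSpace.toDual ℂ H).continuous hut).mono ?_
    rintro _ ⟨y, hy, rfl⟩
    induction hy using Submodule.span_induction with
    | mem y hy =>
      obtain ⟨x, rfl⟩ := hy
      rw [← hlu]
      exact Submodule.subset_span ⟨_, rfl⟩
    | zero => rw [map_zero]; exact Submodule.zero_mem _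
    | add y z _ _ hy hz => rw [map_add]; exact Submodule.add_mem _ hy hz
    | smul c y _ hy => rw [map_smulₛₗ]; exact Submodule.smul_mem _ _ hy
  -- Second extension, in `w`, over the dual space: at a real point `t` the boundary functional is
  -- evaluation at `v t`.
  obtain ⟨m, hm, hml, hmmem⟩ := HInftyR.exists_dual hlt
    (F := fun z w => Φ (z, w)) (fun z => right_mem hΦ z) (Real.sqrt_nonneg C)
    fun t => ⟨NormedSpace.inclusionInDoubleDual ℂ H (v t),
      (NormedSpace.double_dual_bound ℂ H _).trans (hv t), fun z => hlv z t⟩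
  obtain ⟨κ, b, -⟩ := exists_hilbertBasis ℂ H
  let φ : κ → ClosedHalfPlane → ℂ := fun i z => l z (b i)
  let ψ : κ → ClosedHalfPlane → ℂ := fun i w => m w (InnerProductSpace.toDual ℂ H (b i))
  have hsum : ∀ z w, HasSum (fun i => φ i z * ψ i w) (Φ (z, w)) := fun z w => by
    have h1 := b.hasSum_repr ((InnerProductSpace.toDual ℂ H).symm (l z))
    have h2 := (h1.map (InnerProductSpace.toDual ℂ H).toLinearEquiv.toAddMonoidHom
      (InnerProductSpace.toDual ℂ H).continuous).map (m w) (m w).continuous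
    have h3 : m w (InnerProductSpace.toDual ℂ H ((InnerProductSpace.toDual ℂ H).symm (l z))) =
        Φ (z, w) := by
      rw [LinearIsometryEquiv.apply_symm_apply, ← hml]
    rw [← h3]
    refine h2.congr_fun fun i => ?_
    change _ = m w (InnerProductSpace.toDual ℂ H (b.repr _ i • b i))
    rw [map_smulₛₗ, map_smul, b.repr_apply_apply, starRingEnd_apply, ← starRingEnd_apply,
      inner_conj_symm, InnerProductSpace.toDual_symm_apply, smul_eq_mul]
  have hφ : ∀ (I : Finset κ) z, ∑ i ∈ I, ‖φ i z‖ ^ 2 ≤ C := fun I z => by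
    have h1 := b.orthonormal.sum_inner_products_le (x := (InnerProductSpace.toDual ℂ H).symm (l z))
      (s := I)
    rw [LinearIsometryEquiv.norm_map] at h1
    have h2 : ∀ i, ‖⟪b i, (InnerProductSpace.toDual ℂ H).symm (l z)⟫_ℂ‖ = ‖φ i z‖ := fun i => by
      rw [norm_inner_symm, InnerProductSpace.toDual_symm_apply]
    simp only [h2] at h1
    refine h1.trans ((pow_le_pow_left₀ (norm_nonneg _) (hl z) 2).trans_eq (Real.sq_sqrt hC))
  have hψ : ∀ (I : Finset κ) w, ∑ i ∈ I, ‖ψ i w‖ ^ 2 ≤ C := fun I w => by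
    set S := ∑ i ∈ I, ‖ψ i w‖ ^ 2 with hS
    have hS0 : 0 ≤ S := Finset.sum_nonneg fun _ _ => sq_nonneg _
    -- Testing `m w` on the functional of `∑ ψᵢ bᵢ` gives `S`, while that vector has norm `√S`;
    -- hence `S ≤ √C √S`.
    have h1 : m w (InnerProductSpace.toDual ℂ H (∑ i ∈ I, ψ i w • b i)) = (S : ℂ) := by
      simp only [map_sum, map_smulₛₗ, smul_eq_mul, hS]
      push_cast
      exact Finset.sum_congr rfl fun i _ => Complex.conj_mul' _
    have h2 : ‖∑ i ∈ I, ψ i w • b i‖ ^ 2 = S := by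
      refine Complex.ofReal_injective ?_
      have h3 := b.orthonormal.inner_sum (fun i => ψ i w) (fun i => ψ i w) I
      rw [inner_self_eq_norm_sq_to_K] at h3
      push_cast
      refine h3.trans ?_
      rw [hS]
      push_cast
      exact Finset.sum_congr rfl fun i _ => Complex.conj_mul' _
    have h3 := (m w).le_opNorm (InnerProductSpace.toDual ℂ H (∑ i ∈ I, ψ i w • b i))
    rw [h1, LinearIsometryEquiv.norm_map, Complex.norm_real, Real.norm_of_nonneg hS0] at h3
    have h4 : S ^ 2 ≤ C * S := by
      calc S ^ 2 ≤ (‖m w‖ * ‖∑ i ∈ I, ψ i w • b i‖) ^ 2 := by gcongr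
        _ = ‖m w‖ ^ 2 * S := by rw [mul_pow, h2]
        _ ≤ √C ^ 2 * S := by gcongr; exact hm w
        _ = C * S := by rw [Real.sq_sqrt hC]
    by_contra hlt
    push Not at hlt
    nlinarith
  -- The space need not be separable. At each point only countably many `φ i` are nonzero, and one
  -- vanishing on a countable dense set vanishes identically, so countably many indices carry the
  -- series.
  let κ₀ : Set κ := {i | φ i ≠ 0}
  have hκ : κ₀.Countable := by
    obtain ⟨D, hDc, hD⟩ := TopologicalSpace.exists_countable_dense ℂ
    have hc : (Subtype.val ⁻¹' D : Set ClosedHalfPlane).Countable :=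
      hDc.preimage Subtype.val_injective
    refine (hc.biUnion fun z _ => (summable_of_sum_le (fun _ => sq_nonneg _)
      fun I => hφ I z).countable_support).mono fun i hi => ?_
    by_contra hn
    refine hi (HInftyR.eq_zero_of_dense (hlmem (b i)) hD fun z hz _ => ?_)
    by_contra hne
    refine hn (Set.mem_biUnion hz ?_)
    rw [Function.mem_support]
    exact pow_ne_zero 2 (norm_ne_zero_iff.2 hne)
  have := hκ.to_subtype
  obtain ⟨k, hk⟩ := exists_injective_nat κ₀
  let φ' : ℕ → ClosedHalfPlane → ℂ := Function.extend k (fun i => φ i) 0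
  let ψ' : ℕ → ClosedHalfPlane → ℂ := Function.extend k (fun i => ψ i) 0
  have hcol : ∀ χ : κ → ClosedHalfPlane → ℂ, (∀ (I : Finset κ) z, ∑ i ∈ I, ‖χ i z‖ ^ 2 ≤ C) →
      columnNorm (Function.extend k (fun i : κ₀ => χ i) 0) ≤ ENNReal.ofReal √C := by
    intro χ hχ
    refine columnNorm_le hC fun z => ?_
    have h1 : (fun n => ‖Function.extend k (fun i : κ₀ => χ i) 0 n z‖ₑ ^ 2) =
        Function.extend k (fun i : κ₀ => ‖χ i z‖ₑ ^ 2) 0 := funext fun n => by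
      by_cases hn : ∃ i, k i = n
      · obtain ⟨i, rfl⟩ := hn
        rw [hk.extend_apply, hk.extend_apply]
      · rw [Function.extend_apply' _ _ _ hn, Function.extend_apply' _ _ _ hn]
        simp
    rw [h1, tsum_extend_zero hk, ENNReal.tsum_eq_iSup_sum]
    refine iSup_le fun I => ?_
    rw [sum_enorm_sq I fun i : κ₀ => χ i z]
    refine ENNReal.ofReal_le_ofReal ?_
    have h2 := hχ (I.map (Function.Embedding.subtype _)) z
    rw [Finset.sum_map] at h2
    exact h2
  have hmem : ∀ χ : κ → ClosedHalfPlane → ℂ, (∀ i, χ i ∈ HInftyR) → ∀ n,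
      Function.extend k (fun i : κ₀ => χ i) 0 n ∈ HInftyR := by
    intro χ hχ n
    by_cases hn : ∃ i, k i = n
    · obtain ⟨i, rfl⟩ := hn
      rw [hk.extend_apply]
      exact hχ _
    · rw [Function.extend_apply' _ _ _ hn]
      exact HInftyR.zero_mem
  refine ⟨φ', ψ', ⟨hmem φ fun i => hlmem _, hmem ψ fun i => hmmem _,
    (hcol φ hφ).trans_lt ENNReal.ofReal_lt_top, (hcol ψ hψ).trans_lt ENNReal.ofReal_lt_top,
    fun z w => ?_⟩, ?_⟩
  · have h1 : (fun n => φ' n z * ψ' n w) =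
        Function.extend k (fun i : κ₀ => φ i z * ψ i w) 0 := funext fun n => by
      simp only [φ', ψ']
      by_cases hn : ∃ i, k i = n
      · obtain ⟨i, rfl⟩ := hn
        simp only [hk.extend_apply]
      · simp [Function.extend_apply' _ _ _ hn]
    rw [h1, hasSum_extend_zero hk]
    refine (Function.Injective.hasSum_iff Subtype.val_injective fun i hi => ?_).2 (hsum z w)
    have h2 : φ i = 0 := by
      by_contra h3
      exact hi ⟨⟨i, h3⟩, rfl⟩
    rw [h2, Pi.zero_apply, zero_mul]
  · refine (mul_le_mul' (hcol φ hφ) (hcol ψ hψ)).trans_eq ?_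
    rw [← ENNReal.ofReal_mul (Real.sqrt_nonneg _), Real.mul_self_sqrt hC]

/-! ### Functions in the Haagerup tensor product are analytic Schur multipliers -/

theorem norm_sum_mul_sq_le (I : Finset ℕ) (a b : ℕ → ℂ) :
    ‖∑ n ∈ I, a n * b n‖ ^ 2 ≤ (∑ n ∈ I, ‖a n‖ ^ 2) * ∑ n ∈ I, ‖b n‖ ^ 2 := by
  have h1 : ‖∑ n ∈ I, a n * b n‖ ≤ ∑ n ∈ I, ‖a n‖ * ‖b n‖ :=
    (norm_sum_le _ _).trans_eq (Finset.sum_congr rfl fun _ _ => norm_mul _ _)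
  exact (pow_le_pow_left₀ (norm_nonneg _) h1 2).trans (Finset.sum_mul_sq_le_sq_mul_sq I _ _)

/-- Coordinatewise convergence of bounded sequences in `ℓ²` is weak convergence. -/
theorem tendsto_of_hasSum_mul {ι : Type*} {l : Filter ι} {a : ι → ℕ → ℂ} {a₀ b : ℕ → ℂ} {A B : ℝ}
    {f : ι → ℂ} {f₀ : ℂ} (hA : 0 ≤ A) (ha : ∀ i (I : Finset ℕ), ∑ n ∈ I, ‖a i n‖ ^ 2 ≤ A)
    (hb : ∀ I : Finset ℕ, ∑ n ∈ I, ‖b n‖ ^ 2 ≤ B) (hlim : ∀ n, Tendsto (a · n) l (𝓝 (a₀ n)))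
    (hf : ∀ i, HasSum (fun n => a i n * b n) (f i)) (hf₀ : HasSum (fun n => a₀ n * b n) f₀) :
    Tendsto f l (𝓝 f₀) := by
  have hs : Summable fun n => ‖b n‖ ^ 2 := summable_of_sum_le (fun _ => sq_nonneg _) hb
  -- The tails are small uniformly in `i` by Cauchy–Schwarz: those of `b` are small and the `a i`
  -- are uniformly bounded.
  have hunif : TendstoUniformly (fun (I : Finset ℕ) i => ∑ n ∈ I, a i n * b n) f atTop := by
    rw [Metric.tendstoUniformly_iff]
    intro ε hε
    rw [summable_iff_vanishing_norm] at hs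
    obtain ⟨s, hs⟩ := hs ((ε / 2) ^ 2 / (A + 1)) (by positivity)
    filter_upwards [eventually_ge_atTop s] with I hI i
    have h1 : ‖f i - ∑ n ∈ I, a i n * b n‖ ≤ ε / 2 := by
      refine le_of_tendsto ((hf i).sub_const _).norm ?_
      filter_upwards [eventually_ge_atTop I] with J hJ
      rw [← Finset.sum_sdiff hJ, add_sub_cancel_right]
      have h2 := hs (J \ I) (Finset.disjoint_of_subset_right hI Finset.sdiff_disjoint)
      refine le_of_sq_le_sq ((norm_sum_mul_sq_le _ _ _).trans ?_) (by positivity)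
      have h3 := (Real.le_norm_self _).trans h2.le
      calc _ ≤ A * ((ε / 2) ^ 2 / (A + 1)) := by
            gcongr
            exact ha i _
        _ ≤ (A + 1) * ((ε / 2) ^ 2 / (A + 1)) := by gcongr; linarith
        _ = (ε / 2) ^ 2 := by field_simp
    rw [dist_eq_norm]
    linarith
  exact hunif.tendsto_of_eventually_tendsto
    (Eventually.of_forall fun I => tendsto_finsetSum _ fun n _ => (hlim n).mul_const _) hf₀

/-- The sum of a bounded orthogonal series of analytic functions is analytic. -/
theorem exists_differentiableOn_hasSum {E : Type*} [NormedAddCommGroup E] [NormedSpace ℂ E]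
    [CompleteSpace E] {U : Set ℂ} (hU : IsOpen U) {e : ℕ → E}
    (he : ∀ (I : Finset ℕ) (c : ℕ → ℂ), ‖∑ n ∈ I, c n • e n‖ ^ 2 ≤ ∑ n ∈ I, ‖c n‖ ^ 2)
    {φ : ℕ → ℂ → ℂ} (hφ : ∀ n, DifferentiableOn ℂ (φ n) U) {A : ℝ}
    (hφA : ∀ z ∈ U, ∀ I : Finset ℕ, ∑ n ∈ I, ‖φ n z‖ ^ 2 ≤ A) :
    ∃ F : ℂ → E, DifferentiableOn ℂ F U ∧ ∀ z ∈ U, HasSum (fun n => φ n z • e n) (F z) := by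
  have hsum : ∀ z ∈ U, Summable fun n => φ n z • e n := fun z hz => by
    have hs : Summable fun n => ‖φ n z‖ ^ 2 := summable_of_sum_le (fun _ => sq_nonneg _) (hφA z hz)
    rw [summable_iff_vanishing_norm] at hs ⊢
    intro ε hε
    obtain ⟨s, hs⟩ := hs (ε ^ 2) (by positivity)
    exact ⟨s, fun t ht => lt_of_pow_lt_pow_left₀ 2 hε.le
      ((he t _).trans_lt ((Real.le_norm_self _).trans_lt (hs t ht)))⟩
  refine ⟨fun z => ∑' n, φ n z • e n, ?_, fun z hz => (hsum z hz).hasSum⟩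
  refine differentiableOn_of_tendsto_of_bounded hU (B := √A)
    (F := fun N z => ∑ n ∈ Finset.range N, φ n z • e n)
    (fun N => DifferentiableOn.fun_sum fun n _ => (hφ n).smul_const _) (fun N z hz => ?_)
    fun z hz => (hsum z hz).hasSum.tendsto_sum_nat
  exact Real.le_sqrt_of_sq_le ((he _ _).trans (hφA z hz _))

/-- The coordinate functionals obey the same Bessel bound in the dual. Placing the second factor
there keeps the pairing complex bilinear, which analyticity requires. -/
theorem Ell2.norm_sum_innerSL_δ_sq_le (I : Finset ℕ) (c : ℕ → ℂ) :
    ‖∑ n ∈ I, c n • innerSL ℂ (δ n : Ell2 ℕ)‖ ^ 2 ≤ ∑ n ∈ I, ‖c n‖ ^ 2 := by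
  have hS : 0 ≤ ∑ n ∈ I, ‖c n‖ ^ 2 := Finset.sum_nonneg fun _ _ => sq_nonneg _
  rw [← Real.le_sqrt (norm_nonneg _) hS]
  refine ContinuousLinearMap.opNorm_le_bound _ (Real.sqrt_nonneg _) fun f => ?_
  refine le_of_sq_le_sq ?_ (by positivity)
  simp only [_root_.sum_apply, _root_.smul_apply, innerSL_apply_apply, inner_δ, smul_eq_mul]
  refine (norm_sum_mul_sq_le I c f).trans ?_
  rw [mul_pow, Real.sq_sqrt hS]
  gcongr
  exact sum_norm_sq_le f I

/-! ### Regularity, multiplier property and norm bound of represented functions -/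

namespace IsHaagerupRepresentation

variable {Φ : ClosedHalfPlane × ClosedHalfPlane → ℂ} {φ ψ : ℕ → ClosedHalfPlane → ℂ}

theorem swap (h : IsHaagerupRepresentation HInftyR HInftyR Φ φ ψ) :
    IsHaagerupRepresentation HInftyR HInftyR (fun p => Φ (p.2, p.1)) ψ φ :=
  ⟨h.right_mem, h.left_mem, h.right_bounded, h.left_bounded, fun z w => by
    simpa only [mul_comm] using h.hasSum w z⟩

theorem tendsto_left (h : IsHaagerupRepresentation HInftyR HInftyR Φ φ ψ) (z w : ClosedHalfPlane) :
    Tendsto (fun t : ℝ≥0 => Φ (z.raise t, w)) (𝓝[>] 0) (𝓝 (Φ (z, w))) :=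
  tendsto_of_hasSum_mul (a := fun t n => φ n (z.raise t)) (sq_nonneg _)
    (fun _ I => sum_norm_sq_le_columnNorm h.left_bounded I _)
    (fun I => sum_norm_sq_le_columnNorm h.right_bounded I w)
    (fun n => HInftyR.tendsto (h.left_mem n) z) (fun _ => h.hasSum _ w) (h.hasSum z w)

open Ell2 in
-- Joint analyticity comes from evaluating the dual-valued `G(w) = ∑ ψₙ(w) ⟪δₙ, ·⟫` at the
-- `ℓ²`-valued `F(z) = ∑ φₙ(z) δₙ`. Both are analytic in one variable and evaluation is bounded
-- bilinear.
theorem mem_HInftyR₂ (h : IsHaagerupRepresentation HInftyR HInftyR Φ φ ψ) : Φ ∈ HInftyR₂ := by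
  set A := (columnNorm φ).toReal
  set B := (columnNorm ψ).toReal
  have hA := sum_norm_sq_le_columnNorm h.left_bounded
  have hB := sum_norm_sq_le_columnNorm h.right_bounded
  refine ⟨?_, ⟨√(A ^ 2 * B ^ 2), fun z w _ _ => ?_⟩,
    fun z w => ⟨h.tendsto_left z w, h.swap.tendsto_left w z⟩⟩
  · have hup : ∀ z : ℂ, 0 < z.im → ∃ z' : ClosedHalfPlane, z'.1 = z := fun z hz => ⟨⟨z, hz.le⟩, rfl⟩
    obtain ⟨F, hF, hFs⟩ := exists_differentiableOn_hasSum HInftyR.isOpen_upper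
      (e := fun n => (δ n : Ell2 ℕ)) (fun I c => (norm_sum_δ_sq I c).le)
      (fun n => (h.left_mem n).1) (A := A ^ 2) fun z hz I => by
        obtain ⟨z, rfl⟩ := hup z hz
        simpa only [ClosedHalfPlane.extend_apply] using hA I z
    obtain ⟨G, hG, hGs⟩ := exists_differentiableOn_hasSum HInftyR.isOpen_upper
      (e := fun n => innerSL ℂ (δ n : Ell2 ℕ)) norm_sum_innerSL_δ_sq_le
      (fun n => (h.right_mem n).1) (A := B ^ 2) fun z hz I => by
        obtain ⟨z, rfl⟩ := hup z hz
        simpa only [ClosedHalfPlane.extend_apply] using hB I z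
    have hd : DifferentiableOn ℂ (fun p : ℂ × ℂ => G p.2 (F p.1))
        {p : ℂ × ℂ | 0 < p.1.im ∧ 0 < p.2.im} :=
      (hG.comp differentiableOn_snd fun p hp => hp.2).clm_apply
        (hF.comp differentiableOn_fst fun p hp => hp.1)
    refine hd.congr fun p hp => ?_
    obtain ⟨z, w⟩ := p
    obtain ⟨z, rfl⟩ := hup z hp.1
    obtain ⟨w, rfl⟩ := hup w hp.2
    rw [HInftyR₂.extend_apply]
    refine (h.hasSum z w).unique ?_
    have h1 : ∀ n, F z n = φ n z := fun n => by
      have h2 := hFs z hp.1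
      simp only [ClosedHalfPlane.extend_apply] at h2
      refine (hasSum_eval h2 n).unique ?_
      have h3 : (φ n z • (δ n : Ell2 ℕ)) n = φ n z := by
        rw [lp.coeFn_smul, Pi.smul_apply, δ_apply_self, smul_eq_mul, mul_one]
      have h4 := hasSum_single (f := fun k => (φ k z • (δ k : Ell2 ℕ)) n) n fun k hk => by
        rw [lp.coeFn_smul, Pi.smul_apply, δ_apply_ne hk.symm, smul_zero]
      rwa [h3] at h4
    have h2 := (hGs w hp.2).mapL (ContinuousLinearMap.apply ℂ ℂ (F z))
    simp only [ClosedHalfPlane.extend_apply] at h2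
    refine h2.congr_fun fun n => ?_
    rw [ContinuousLinearMap.apply_apply, smul_apply, innerSL_apply_apply, inner_δ,
      h1, smul_eq_mul, mul_comm]
  · refine Real.le_sqrt_of_sq_le (le_of_tendsto ((h.hasSum z w).norm.pow 2)
      (Eventually.of_forall fun I => (norm_sum_mul_sq_le _ _ _).trans ?_))
    gcongr
    · exact hA I z
    · exact hB I w

/-- The boundary function is a pointwise limit of the continuous functions `x ↦ f(x + tₙ i)`. -/
theorem measurable_boundary {f : ClosedHalfPlane → ℂ} (hf : f ∈ HInftyR) :
    Measurable fun x : ℝ => f (realPoint x) := by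
  obtain ⟨t, ht0, htlim⟩ := ClosedHalfPlane.exists_seq_tendsto_zero
  refine measurable_of_tendsto_metrizable (f := fun n x => f ((realPoint x).raise (t n)))
    (fun n => Continuous.measurable ?_)
    (tendsto_pi_nhds.2 fun x => (hf.2.2 x).comp htlim)
  have h1 : (fun x : ℝ => f ((realPoint x).raise (t n))) = fun x : ℝ =>
      Function.extend Subtype.val f 0 ((x : ℂ) + ((t n : ℝ) : ℂ) * Complex.I) := funext fun x =>
    (ClosedHalfPlane.extend_apply f ((realPoint x).raise (t n))).symm
  rw [h1]
  refine hf.1.continuousOn.comp_continuous (by fun_prop) fun x => ?_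
  simpa using ht0 n

theorem mem_analyticSchurMultipliers (h : IsHaagerupRepresentation HInftyR HInftyR Φ φ ψ) :
    Φ ∈ analyticSchurMultipliers.{u} := by
  refine ⟨h.mem_HInftyR₂, ?_⟩
  intro H _ _ _ E₁ E₂
  exact isSchurMultiplier_of_hasSum E₁ E₂ (fun n => measurable_boundary (h.left_mem n))
    (fun n => measurable_boundary (h.right_mem n))
    (fun N x => sum_norm_sq_le_columnNorm h.left_bounded _ _)
    (fun N x => sum_norm_sq_le_columnNorm h.right_bounded _ _) (sq_nonneg _) (sq_nonneg _)
    fun x y => h.hasSum _ _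

theorem discreteSchurNorm_le (h : IsHaagerupRepresentation HInftyR HInftyR Φ φ ψ) :
    discreteSchurNorm (boundaryFunction Φ) ≤ columnNorm φ * columnNorm ψ := by
  have h1 : IsSchurBound (boundaryFunction Φ) _ :=
    isSchurBound_of_hasSum (φ := fun n x => φ n (realPoint x)) (ψ := fun n x => ψ n (realPoint x))
      (fun I x => sum_norm_sq_le_columnNorm h.left_bounded I _)
      (fun I x => sum_norm_sq_le_columnNorm h.right_bounded I _) (sq_nonneg _) (sq_nonneg _)
      fun x y => h.hasSum _ _
  refine (iInf₂_le _ h1).trans_eq ?_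
  rw [Real.sqrt_sq ENNReal.toReal_nonneg, Real.sqrt_sq ENNReal.toReal_nonneg,
    ← ENNReal.ofReal.eq_1, ENNReal.ofReal_mul ENNReal.toReal_nonneg,
    ENNReal.ofReal_toReal h.left_bounded.ne, ENNReal.ofReal_toReal h.right_bounded.ne]

end IsHaagerupRepresentation

end

theorem theorem3p1 :
    analyticSchurMultipliers.{u} = haagerupTensor HInftyR HInftyR ∧
      ∀ Φ ∈ analyticSchurMultipliers.{u},
        haagerupNorm HInftyR HInftyR Φ = discreteSchurNorm (boundaryFunction Φ) := by
  refine ⟨Set.Subset.antisymm (fun Φ hΦ => ?_) fun Φ hΦ => ?_, fun Φ hΦ => le_antisymm ?_ ?_⟩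
  · obtain ⟨C, hC, h⟩ := exists_finiteSchurBound hΦ.2
    obtain ⟨φ, ψ, hrep, -⟩ := HInftyR₂.exists_representation hΦ.1 hC h
    exact ⟨φ, ψ, hrep⟩
  · obtain ⟨φ, ψ, h⟩ := hΦ
    exact h.mem_analyticSchurMultipliers
  -- Every Schur bound `C` produces a representation whose product of column norms is at most `C`.
  · refine le_iInf₂ fun C hC => ?_
    obtain ⟨φ, ψ, hrep, hle⟩ :=
      HInftyR₂.exists_representation hΦ.1 C.2 hC.finiteSchurBound
    refine (iInf₂_le_of_le φ ψ (iInf_le_of_le hrep hle)).trans_eq ?_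
    exact ENNReal.ofReal_coe_nnreal
  · exact le_iInf₂ fun φ ψ => le_iInf fun h => h.discreteSchurNorm_le
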